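/- Let $0<q<1$, $\sigma,\tau\in\mathbb R$ and let $l,n,m,p$ be nonnegative integers with $0\le n\le l$. Write $(a;q)_k=\prod_{i=0}^{k-1}(1-aq^i)$ for $k\in\{0,1,2,\dots\}\cup\{\infty\}$ and $(a_1,\dots,a_r;q)_k=\prod_{j}(a_j;q)_k$. Define, with $x=\cos\theta$, the Askey--Wilson polynomials $$p_n(x;a,b,c,d\mid q)=a^{-n}(ab,ac,ad;q)_n\;{}_4\varphi_3\!\left({q^{-n},\,abcdq^{n-1},\,ae^{i\theta},\,ae^{-i\theta}\atop ab,\ ac,\ ad};q,q\right),$$ the polynomials $$p_n^{(\alpha,\beta)}(x;s,t\mid q)=p_n(x;q^{1/2+\alpha}s/t,\,q^{1/2}t/s,\,-q^{1/2}/(st),\,-stq^{1/2+\beta}\mid q),$$ $$l_n^{(\alpha)}(x;s,t\mid q)=p_n(x;q^{1/2+\alpha}s/t,\,q^{1/2}t/s,\,-q^{1/2}/(st),\,0\mid q),$$ and the big $q$-Jacobi polynomials $$P_n^{(\alpha,\beta)}(x;c,d;q)={}_3\varphi_2\!\left({q^{-n},\,q^{n+\alpha+\beta+1},\,q^{1+\alpha}x/c\atop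 q^{\alpha+1},\ -q^{1+\alpha}d/c};q,q\right).$$ Here ${}_{r+1}\varphi_r\!\left({a_1,\dots,a_{r+1}\atop b_1,\dots,b_r};q,z\right)=\sum_{k\ge0}\frac{(a_1,\dots,a_{r+1};q)_k}{(q,b_1,\dots,b_r;q)_k}z^k$. Let $dm^{(p)}(x;s,t\mid q)$, for $s=q^\tau$, $t=q^\sigma$, be the normalised orthogonality measure of the polynomials $l_k^{(p)}(\cdot;s,t\mid q)$, that is, with $a=q^{1/2+p}s/t$, $b=q^{1/2}t/s$, $c=-q^{1/2}/(st)$, the following measure divided by its total mass: the absolutely continuous measure on $[-1,1]$ with density $$\frac{1}{2\pi}\,\frac{(e^{2i\theta},e^{-2i\theta};q)_\infty}{\prod_{e\in\{a,b,c\}}(e\,e^{i\theta},e\,e^{-i\theta};q)_\infty}\,\frac{1}{\sqrt{1-x^2}},\qquad x=\cos\theta,$$ plus, for each $e\in\{a,b,c\}$, with $f,g$ the other two parameters, and each integer $k\ge0$ with $|eq^k|>1$, a point mass at $\tfrac12\bigl(eq^k+e^{-1}q^{-k}\bigr)$ of weight $$\frac{(e^{-2};q)_\infty}{(q,ef,eg,f/e,g/e;q)_\infty}\;\frac{1-e^2q^{2k}}{1-e^2}\;\frac{(e^2,ef,eg;q)_k}{(q,qe/f,qe/g;q)_k}\;(-1)^k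 q^{-k(k-1)/2}(e^2fg)^{-k}.$$ Then $p_l^{(0,0)}\,l_m^{(p)}\,l_{m+n}^{(p)}(\,\cdot\,;q^\tau,q^\sigma\mid q)$ is integrable with respect to this measure and $$P^{(n,n)}_{l-n}(-q^m;q^{2\tau},1;q)\,P^{(n,n)}_{l-n}(-q^{m+p};q^{2\sigma},1;q)=\frac1C\int_{\mathbb R}\bigl(p^{(0,0)}_l\,l_m^{(p)}\,l_{m+n}^{(p)}\bigr)(x;q^\tau,q^\sigma\mid q)\,dm^{(p)}(x;q^\tau,q^\sigma\mid q),$$ where $$C=D^{n,l}(\tau,\sigma)\,(q,q^{1+p},-q^{1-2\tau},-q^{1+p-2\sigma};q)_{m+n},$$ $$D^{n,l}(\tau,\sigma)=(-q^{2\sigma-l},-q^{2\tau-l};q)_{l-n}\,\frac{(q^{l-n+1};q)_n}{(q;q)_n}\,(q^{n+1};q)_l\;q^{\frac12(l-n)(l-n-2\sigma-2\tau)}.$$ -/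

import Mathlib

open MeasureTheory

noncomputable section

namespace QSpecial

/-- The `q`-shifted factorial `(a;q)_k = ∏_{i=0}^{k-1} (1 - a q^i)`. -/
def qPoch (a q : ℝ) (k : ℕ) : ℝ := ∏ i ∈ Finset.range k, (1 - a * q ^ i)

/-- The infinite `q`-shifted factorial `(a;q)_∞` (convergent for `|q| < 1`). -/
def qPochInf (a q : ℝ) : ℝ := ∏' i : ℕ, (1 - a * q ^ i)

/-- `(a e^{iθ}, a e^{-iθ};q)_k` as a polynomial in `x = cos θ`:
each factor is `(1 - a q^i e^{iθ}) (1 - a q^i e^{-iθ}) = 1 - 2 a q^i x + a^2 q^{2i}`. -/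
def qPochPair (a x q : ℝ) (k : ℕ) : ℝ :=
  ∏ i ∈ Finset.range k, (1 - 2 * (a * q ^ i) * x + (a * q ^ i) ^ 2)

/-- `(a e^{iθ}, a e^{-iθ};q)_∞` with `x = cos θ`. -/
def qPochPairInf (a x q : ℝ) : ℝ :=
  ∏' i : ℕ, (1 - 2 * (a * q ^ i) * x + (a * q ^ i) ^ 2)

/-- The Askey-Wilson polynomial
`p_n(cos θ; a,b,c,d | q) = a^{-n} (ab,ac,ad;q)_n
  ₄φ₃(q^{-n}, abcd q^{n-1}, a e^{iθ}, a e^{-iθ}; ab, ac, ad; q, q)`, with `x = cos θ`.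
The series terminates at `k = n`, because `(q^{-n};q)_k = 0` for `k > n`. -/
def askeyWilson (n : ℕ) (x a b c d q : ℝ) : ℝ :=
  (a ^ n)⁻¹ * (qPoch (a * b) q n * qPoch (a * c) q n * qPoch (a * d) q n) *
    ∑ k ∈ Finset.range (n + 1),
      qPoch (q ^ (-(n : ℤ))) q k * qPoch (a * b * c * d * q ^ ((n : ℤ) - 1)) q k *
          qPochPair a x q k /
        (qPoch q q k * qPoch (a * b) q k * qPoch (a * c) q k * qPoch (a * d) q k) * q ^ k

/-- The `q`-Jacobi polynomial `p_n^{(α,β)}(x; s, t | q)` of Askey-Wilson type. -/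
def qJacobi (n : ℕ) (α β x s t q : ℝ) : ℝ :=
  askeyWilson n x (q ^ (1 / 2 + α) * s / t) (q ^ (1 / 2 : ℝ) * t / s)
    (-(q ^ (1 / 2 : ℝ)) / (s * t)) (-(s * t * q ^ (1 / 2 + β))) q

/-- The `q`-Laguerre polynomial `l_n^{(α)}(x; s, t | q)` of Askey-Wilson type. -/
def qLaguerre (n : ℕ) (α x s t q : ℝ) : ℝ :=
  askeyWilson n x (q ^ (1 / 2 + α) * s / t) (q ^ (1 / 2 : ℝ) * t / s)
    (-(q ^ (1 / 2 : ℝ)) / (s * t)) 0 q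

/-- The big `q`-Jacobi polynomial
`P_n^{(α,β)}(x; c, d; q) = ₃φ₂(q^{-n}, q^{n+α+β+1}, q^{1+α} x/c; q^{α+1}, -q^{1+α} d/c; q, q)`
(a series terminating at `k = n`). -/
def bigQJacobi (n : ℕ) (α β x c d q : ℝ) : ℝ :=
  ∑ k ∈ Finset.range (n + 1),
    qPoch (q ^ (-(n : ℤ))) q k * qPoch (q ^ ((n : ℝ) + α + β + 1)) q k *
        qPoch (q ^ (1 + α) * x / c) q k /
      (qPoch q q k * qPoch (q ^ (α + 1)) q k * qPoch (-(q ^ (1 + α) * d / c)) q k) * q ^ k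

/-- The density on `[-1,1]`, with respect to Lebesgue measure, of the absolutely continuous part of
the Askey-Wilson measure: with `x = cos θ` it is
`(2π)⁻¹ (e^{2iθ}, e^{-2iθ};q)_∞ / ∏_{e = a,b,c,d} (e e^{iθ}, e e^{-iθ};q)_∞ · (1 - x^2)^{-1/2}`;
note `cos 2θ = 2 x^2 - 1`. -/
def askeyWilsonDensity (x a b c d q : ℝ) : ℝ :=
  (2 * Real.pi)⁻¹ * qPochPairInf 1 (2 * x ^ 2 - 1) q /
    (qPochPairInf a x q * qPochPairInf b x q * qPochPairInf c x q * qPochPairInf d x q) /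
    Real.sqrt (1 - x ^ 2)

/-- The mass of the Askey-Wilson measure at `x_k = (a q^k + (a q^k)⁻¹) / 2`, where `|a q^k| > 1`:
`(a^{-2};q)_∞ / (q,ab,ac,ad,b/a,c/a,d/a;q)_∞ · (1 - a^2 q^{2k}) / (1 - a^2)
  · (a^2,ab,ac,ad;q)_k / (q,qa/b,qa/c,qa/d;q)_k · (q/(abcd))^k`.
The factors `b^k (qa/b;q)_k = ∏_{i<k} (b - a q^{i+1})`, and likewise for `c` and `d`, are
multiplied out, so that the formula also makes sense when one of `b, c, d` is zero. -/
def askeyWilsonMass (k : ℕ) (a b c d q : ℝ) : ℝ :=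
  qPochInf (a ^ 2)⁻¹ q /
      (qPochInf q q * qPochInf (a * b) q * qPochInf (a * c) q * qPochInf (a * d) q *
        qPochInf (b / a) q * qPochInf (c / a) q * qPochInf (d / a) q) *
    ((1 - a ^ 2 * q ^ (2 * k)) / (1 - a ^ 2)) *
    (qPoch (a ^ 2) q k * qPoch (a * b) q k * qPoch (a * c) q k * qPoch (a * d) q k /
      (qPoch q q k *
        ∏ i ∈ Finset.range k,
          ((b - a * q ^ (i + 1)) * (c - a * q ^ (i + 1)) * (d - a * q ^ (i + 1))))) *
    (q / a) ^ k

/-- The discrete part of the Askey-Wilson measure coming from the parameter `a`: point masses at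
`(a q^k + (a q^k)⁻¹) / 2` for the finitely many `k ≥ 0` with `|a q^k| > 1`. -/
def askeyWilsonDiscrete (a b c d q : ℝ) : Measure ℝ :=
  Measure.sum fun k : ℕ =>
    if 1 < |a * q ^ k| then
      ENNReal.ofReal (askeyWilsonMass k a b c d q) •
        Measure.dirac ((a * q ^ k + (a * q ^ k)⁻¹) / 2)
    else 0

/-- The (not yet normalised) orthogonality measure of the Askey-Wilson polynomials
`p_n(·; a,b,c,d | q)` with real parameters whose pairwise products are less than one. -/
def askeyWilsonMeasure (a b c d q : ℝ) : Measure ℝ :=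
  (volume.restrict (Set.Icc (-1) 1)).withDensity
      (fun x => ENNReal.ofReal (askeyWilsonDensity x a b c d q)) +
    (askeyWilsonDiscrete a b c d q + askeyWilsonDiscrete b a c d q +
      askeyWilsonDiscrete c a b d q + askeyWilsonDiscrete d a b c q)

/-- The normalised orthogonality measure `dm^{(α)}(·; s, t | q)` of the `q`-Laguerre polynomials
`l_n^{(α)}(·; s, t | q)`: the Askey-Wilson measure for the parameters of `qLaguerre`, divided by its
total mass. -/
def qLaguerreMeasure (α s t q : ℝ) : Measure ℝ :=
  let μ := askeyWilsonMeasure (q ^ (1 / 2 + α) * s / t) (q ^ (1 / 2 : ℝ) * t / s)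
    (-(q ^ (1 / 2 : ℝ)) / (s * t)) 0 q
  (μ Set.univ)⁻¹ • μ

/-- The constant `D^{n,l}(τ,σ)`, for `0 ≤ n ≤ l`. -/
def addConst (n l : ℕ) (τ σ q : ℝ) : ℝ :=
  qPoch (-(q ^ (2 * σ - (l : ℝ)))) q (l - n) * qPoch (-(q ^ (2 * τ - (l : ℝ)))) q (l - n) *
    (qPoch (q ^ (l - n + 1)) q n / qPoch q q n) * qPoch (q ^ (n + 1)) q l *
    q ^ ((1 / 2 : ℝ) * ((l : ℝ) - n) * ((l : ℝ) - n - 2 * σ - 2 * τ))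

/-- The constant `C = D^{n,l}(τ,σ) (q, q^{1+p}, -q^{1-2τ}, -q^{1+p-2σ};q)_{m+n}`. -/
def prodConst (n l m p : ℕ) (τ σ q : ℝ) : ℝ :=
  addConst n l τ σ q *
    (qPoch q q (m + n) * qPoch (q ^ (1 + p)) q (m + n) *
      qPoch (-(q ^ (1 - 2 * τ))) q (m + n) * qPoch (-(q ^ (1 + (p : ℝ) - 2 * σ))) q (m + n))

end QSpecial

end

/-! Put h = q^{1/2}, s = q^τ, t = q^σ, Z = -1/s², Z' = -1/t², and let S(l,m,k) be the integral of
p_l l_m l_k against the normalised measure. Expanding 2x p_l l_m l_k by the three-term recurrence of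
l_m, and again by that of p_l, gives a second-order recurrence in l in which S(l+1,m,k) has a
nonzero coefficient. Orthogonality of the l_m supplies S(0,m,k), so S is determined. It remains to
see that the product of the two big q-Jacobi polynomials, suitably normalised, satisfies the same
recurrence (`linearisation_of_recurrence`).

Contiguous relations. Let n = k - m and write G_{l,n}(Y,Z) for `bigJacobiSum`, at Y = q^{k+1} Z and,
for the other factor, Y' = q^{k+1+p} Z'. These arguments depend on k alone, so at fixed k a shift of
m is a shift of n. The functions G_{l,n-1}, (argument - constant) G_{l,n} and (quadratic factor)
G_{l,n+1} are all combinations of the same three quantities, namely G_{l+1,n}, G_{l,n}, G_{l-1,n}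
times `contigUp`, `contigMid`, `contigDown`; apart from an overall 1/Z the remaining coefficients do
not involve Z. Multiplying the relations for Z with those for Z' therefore gives one bilinear form
in two triples. Its mixed terms cancel (`contig_form_diag`) and its diagonal entries are what the
recurrence of p_l demands (`contig_step`, `bigJacobiProd_recurrence`). For n = 0 the index -1 is
avoided through the symmetry S(l,m+1,m) = S(l,m,m+1).

The measure. Orthogonality follows from the integrals of (a e^{iθ}, a e^{-iθ};q)_k, and these follow
from the total mass, which has to be 1/(q,ab,ac,bc;q)_∞ whenever the pairwise products of a, b, c
are below one, point masses included (`scaledMass_eq`). If all moduli are below one, the contour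
shift z ↦ qz yields the first moment (`circ_firstMoment`), hence the effect of a ↦ aq; iterating
leads to a = b = c = 0. For larger parameters, multiplication by 1 - 2ax + a² replaces a by aq in
the weight and in the point masses alike. The resulting contiguous relation propagates the formula
by induction on the number of shifts that make the parameters small. One constant stays open; it is
found from b → 1/a, where a single point mass carries everything. -/

noncomputable section

/-! ### Infinite q-shifted factorials. -/

namespace QSpecial

open Filter Topology Complex

/-- The infinite `q`-shifted factorial `(z;q)_∞` of a complex argument. -/
def cqPochInf (q : ℝ) (z : ℂ) : ℂ := ∏' i : ℕ, (1 - z * (q : ℂ) ^ i)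

section

variable {q : ℝ} (hq0 : 0 < q) (hq1 : q < 1)

include hq0 hq1

theorem summable_norm_mul_pow (z : ℂ) : Summable fun i : ℕ => ‖-(z * (q : ℂ) ^ i)‖ := by
  have : Summable fun i : ℕ => ‖z‖ * q ^ i :=
    (summable_geometric_of_lt_one hq0.le hq1).mul_left _
  refine this.congr fun i => ?_
  simp [abs_of_pos hq0]

theorem multipliable_one_sub_mul_pow (z : ℂ) :
    Multipliable fun i : ℕ => (1 - z * (q : ℂ) ^ i) := by
  simpa [sub_eq_add_neg] using multipliable_one_add_of_summable (summable_norm_mul_pow hq0 hq1 z)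

theorem cqPochInf_eq (z : ℂ) : cqPochInf q z = (1 - z) * cqPochInf q (z * q) := by
  unfold cqPochInf
  rw [tprod_eq_zero_mul']
  · simp [pow_succ', mul_assoc]
  · simpa [pow_succ', mul_assoc] using multipliable_one_sub_mul_pow hq0 hq1 (z * q)

theorem cqPochInf_ne_zero {z : ℂ} (h : ∀ i : ℕ, z * (q : ℂ) ^ i ≠ 1) : cqPochInf q z ≠ 0 := by
  have := tprod_one_add_ne_zero_of_summable (f := fun i : ℕ => -(z * (q : ℂ) ^ i))
    (fun i => by
      rw [← sub_eq_add_neg]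
      exact sub_ne_zero.2 (h i).symm) (summable_norm_mul_pow hq0 hq1 z)
  simpa [cqPochInf, sub_eq_add_neg] using this

theorem cqPochInf_ne_zero_of_norm_lt {z : ℂ} (h : ‖z‖ < 1) : cqPochInf q z ≠ 0 := by
  refine cqPochInf_ne_zero hq0 hq1 fun i hi => ?_
  have h1 : ‖z * (q : ℂ) ^ i‖ = 1 := by rw [hi]; simp
  have h2 : ‖z * (q : ℂ) ^ i‖ ≤ ‖z‖ := by
    rw [norm_mul, norm_pow, Complex.norm_real, Real.norm_of_nonneg hq0.le]
    exact mul_le_of_le_one_right (norm_nonneg _) (pow_le_one₀ hq0.le hq1.le)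
  linarith

/-- The product converges uniformly on every ball, so the limit is entire. This is what makes the
contour shifts below legitimate. -/
theorem differentiable_cqPochInf : Differentiable ℂ (cqPochInf q) := by
  intro z
  have hU : IsOpen (Metric.ball (0 : ℂ) (‖z‖ + 1)) := Metric.isOpen_ball
  have hu : Summable fun i : ℕ => (‖z‖ + 1) * q ^ i :=
    (summable_geometric_of_lt_one hq0.le hq1).mul_left _
  have h := Summable.hasProdLocallyUniformlyOn_nat_one_add (f := fun (i : ℕ) (w : ℂ) => -(w * (q : ℂ) ^ i))
    hU hu (Eventually.of_forall fun i w hw => by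
      rw [norm_neg, norm_mul, norm_pow, Complex.norm_real, Real.norm_of_nonneg hq0.le]
      have : ‖w‖ < ‖z‖ + 1 := by simpa using hw
      gcongr) (fun i => by fun_prop)
  have h2 := (hasProdLocallyUniformlyOn_iff_tendstoLocallyUniformlyOn.1 h).differentiableOn
    (Eventually.of_forall fun s => by
      simp only [← sub_eq_add_neg]
      fun_prop) hU
  have h3 := h2.differentiableAt (hU.mem_nhds (x := z) (by simp))
  simpa [cqPochInf, sub_eq_add_neg, Function.comp_def] using! h3

theorem continuous_cqPochInf : Continuous (cqPochInf q) :=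
  (differentiable_cqPochInf hq0 hq1).continuous

omit hq0 hq1 in
@[simp] theorem cqPochInf_zero : cqPochInf q 0 = 1 := by simp [cqPochInf]

theorem ofReal_qPochInf (a : ℝ) : ((qPochInf a q : ℝ) : ℂ) = cqPochInf q a := by
  unfold qPochInf cqPochInf
  have hm : Multipliable fun i : ℕ => (1 - a * q ^ i) := by
    have : Summable fun i : ℕ => ‖-(a * q ^ i)‖ := by
      simpa using summable_norm_mul_pow hq0 hq1 (a : ℂ)
    simpa [sub_eq_add_neg] using multipliable_one_add_of_summable this
  have := hm.map_tprod Complex.ofRealHom Complex.continuous_ofReal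
  simpa using this

theorem qPochInf_eq (a : ℝ) : qPochInf a q = (1 - a) * qPochInf (a * q) q := by
  have := cqPochInf_eq hq0 hq1 (a : ℂ)
  rw [← ofReal_qPochInf hq0 hq1, ← ofReal_mul, ← ofReal_qPochInf hq0 hq1] at this
  exact_mod_cast this

theorem continuous_qPochInf : Continuous fun a : ℝ => qPochInf a q := by
  have : (fun a : ℝ => qPochInf a q) = fun a : ℝ => (cqPochInf q a).re := by
    ext a; rw [← ofReal_qPochInf hq0 hq1, ofReal_re]
  rw [this]
  exact Complex.continuous_re.comp ((continuous_cqPochInf hq0 hq1).comp Complex.continuous_ofReal)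

omit hq0 hq1 in
@[simp] theorem qPochInf_zero : qPochInf 0 q = 1 := by simp [qPochInf]

theorem qPochInf_one : qPochInf 1 q = 0 := by
  rw [qPochInf_eq hq0 hq1]; simp

theorem qPochInf_ne_zero {a : ℝ} (h : ∀ i : ℕ, a * q ^ i ≠ 1) : qPochInf a q ≠ 0 := by
  have := cqPochInf_ne_zero hq0 hq1 (z := (a : ℂ)) (fun i => by exact_mod_cast h i)
  rw [← ofReal_qPochInf hq0 hq1] at this
  exact_mod_cast this

omit hq0 in
theorem mul_pow_lt_one {a : ℝ} (h0 : 0 ≤ q) (h : a < 1) (i : ℕ) : a * q ^ i < 1 := by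
  have h1 : q ^ i ≤ 1 := pow_le_one₀ h0 hq1.le
  have h2 : 0 ≤ q ^ i := pow_nonneg h0 _
  rcases le_total a 0 with ha | ha
  · exact lt_of_le_of_lt (mul_nonpos_of_nonpos_of_nonneg ha h2) one_pos
  · exact lt_of_le_of_lt (mul_le_of_le_one_right ha h1) h

theorem qPochInf_ne_zero_of_lt {a : ℝ} (h : a < 1) : qPochInf a q ≠ 0 :=
  qPochInf_ne_zero hq0 hq1 fun i => (mul_pow_lt_one hq1 hq0.le h i).ne

/-- There is no zero on the segment from 0 to a and the value at 0 is 1, so the sign cannot change.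
No lower bound on a is needed. -/
theorem qPochInf_pos {a : ℝ} (h : a < 1) : 0 < qPochInf a q := by
  refine lt_of_le_of_ne ?_ (qPochInf_ne_zero_of_lt hq0 hq1 h).symm
  by_contra! hneg
  have hc := continuous_qPochInf hq0 hq1
  obtain ⟨t, ht, h0⟩ : ∃ t ∈ Set.Icc (0 : ℝ) 1, qPochInf (t * a) q = 0 := by
    have := intermediate_value_Icc' (f := fun t : ℝ => qPochInf (t * a) q) zero_le_one
      (hc.comp (by fun_prop : Continuous fun t : ℝ => t * a)).continuousOn
    exact this ⟨by simpa using hneg.le, by simp⟩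
  refine qPochInf_ne_zero_of_lt hq0 hq1 ?_ h0
  rcases le_total a 0 with ha | ha
  · exact lt_of_le_of_lt (mul_nonpos_of_nonneg_of_nonpos ht.1 ha) one_pos
  · exact lt_of_le_of_lt (mul_le_of_le_one_left ha ht.2) h

theorem qPochInf_eq_qPoch_mul (a : ℝ) (k : ℕ) :
    qPochInf a q = qPoch a q k * qPochInf (a * q ^ k) q := by
  induction k with
  | zero => simp [qPoch]
  | succ k ih =>
    rw [ih, qPochInf_eq hq0 hq1 (a * q ^ k), qPoch, qPoch, Finset.prod_range_succ]
    ring_nf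

theorem tendsto_qPoch (a : ℝ) : Tendsto (fun k => qPoch a q k) atTop (𝓝 (qPochInf a q)) := by
  have h1 : Tendsto (fun k : ℕ => a * q ^ k) atTop (𝓝 (a * 0)) :=
    (tendsto_pow_atTop_nhds_zero_of_lt_one hq0.le hq1).const_mul a
  have hm : Multipliable fun i : ℕ => (1 - a * q ^ i) := by
    have : Summable fun i : ℕ => ‖-(a * q ^ i)‖ := by
      simpa using summable_norm_mul_pow hq0 hq1 (a : ℂ)
    simpa [sub_eq_add_neg] using multipliable_one_add_of_summable this
  exact hm.hasProd.tendsto_prod_nat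

/-- The product `(a z;q)_∞ (a / z;q)_∞` in terms of `x = (z + 1 / z) / 2`. -/
theorem ofReal_qPochPairInf (a x : ℝ) {z w : ℂ} (hzw : z * w = 1) (hx : z + w = 2 * x) :
    ((qPochPairInf a x q : ℝ) : ℂ) = cqPochInf q (a * z) * cqPochInf q (a * w) := by
  unfold qPochPairInf cqPochInf
  rw [← (multipliable_one_sub_mul_pow hq0 hq1 (a * z)).tprod_mul
    (multipliable_one_sub_mul_pow hq0 hq1 (a * w))]
  have hf : ∀ i : ℕ, (1 - a * z * (q : ℂ) ^ i) * (1 - a * w * (q : ℂ) ^ i) =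
      ((1 - 2 * (a * q ^ i) * x + (a * q ^ i) ^ 2 : ℝ) : ℂ) := by
    intro i
    push_cast
    linear_combination (a * (q : ℂ) ^ i) ^ 2 * hzw - (a * (q : ℂ) ^ i) * hx
  simp only [hf]
  have hm : Multipliable fun i : ℕ => (1 - 2 * (a * q ^ i) * x + (a * q ^ i) ^ 2) := by
    have hs : Summable fun i : ℕ => ‖-(2 * (a * q ^ i) * x) + (a * q ^ i) ^ 2‖ := by
      have h1 : Summable fun i : ℕ => -(2 * (a * q ^ i) * x) :=
        ((summable_geometric_of_lt_one hq0.le hq1).mul_left (-(2 * a * x))).congr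
          fun i => by ring
      have h2 : Summable fun i : ℕ => (a * q ^ i) ^ 2 :=
        ((summable_geometric_of_lt_one (sq_nonneg q) (by nlinarith)).mul_left (a ^ 2)).congr
          fun i => by ring
      exact (h1.add h2).norm
    refine (multipliable_one_add_of_summable hs).congr fun i => by ring
  have := hm.map_tprod Complex.ofRealHom Complex.continuous_ofReal
  simpa using this

theorem qPochPairInf_eq (a x : ℝ) :
    qPochPairInf a x q = (1 - 2 * a * x + a ^ 2) * qPochPairInf (a * q) x q := by
  -- Every real x, inside [-1,1] or not, is (z + 1/z)/2 for a complex z, a root of z² - 2xz + 1.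
  obtain ⟨z, w, hzw, hx⟩ : ∃ z w : ℂ, z * w = 1 ∧ z + w = 2 * x := by
    obtain ⟨r, hr⟩ := IsAlgClosed.exists_pow_nat_eq ((x : ℂ) ^ 2 - 1) (n := 2) (by norm_num)
    exact ⟨x + r, x - r, by linear_combination -hr, by ring⟩
  have h1 := ofReal_qPochPairInf hq0 hq1 a x hzw hx
  have h2 := ofReal_qPochPairInf hq0 hq1 (a * q) x hzw hx
  rw [cqPochInf_eq hq0 hq1 (a * z), cqPochInf_eq hq0 hq1 (a * w)] at h1
  have : ((qPochPairInf a x q : ℝ) : ℂ) =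
      ((1 - 2 * a * x + a ^ 2) * qPochPairInf (a * q) x q : ℝ) := by
    rw [h1]
    push_cast [h2]
    rw [show (a : ℂ) * z * q = a * q * z by ring, show (a : ℂ) * w * q = a * q * w by ring]
    linear_combination (cqPochInf q (a * q * z) * cqPochInf q (a * q * w)) *
      (a ^ 2 * hzw - a * hx)
  exact_mod_cast this

theorem qPochPairInf_eq_mul (a : ℝ) {A : ℝ} (hA : A ≠ 0) :
    qPochPairInf a ((A + A⁻¹) / 2) q = qPochInf (a * A) q * qPochInf (a / A) q := by
  have h := ofReal_qPochPairInf hq0 hq1 a ((A + A⁻¹) / 2) (z := A) (w := (A : ℂ)⁻¹)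
    (mul_inv_cancel₀ (by exact_mod_cast hA)) (by push_cast; ring)
  rw [← ofReal_mul, ← ofReal_inv, ← ofReal_mul, ← ofReal_qPochInf hq0 hq1,
    ← ofReal_qPochInf hq0 hq1, ← ofReal_mul] at h
  rw [div_eq_mul_inv a A]
  exact_mod_cast h

/-- For x = cos θ the two infinite products are complex conjugates. Nonnegativity and continuity of
the weight on [-1,1] come from here. -/
theorem qPochPairInf_cos (a θ : ℝ) :
    qPochPairInf a (Real.cos θ) q = normSq (cqPochInf q (a * exp (θ * I))) := by
  have hc : ∀ z : ℂ, cqPochInf q ((starRingEnd ℂ) z) = (starRingEnd ℂ) (cqPochInf q z) := by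
    intro z
    unfold cqPochInf
    have := (multipliable_one_sub_mul_pow hq0 hq1 z).map_tprod (starRingEnd ℂ)
      Complex.continuous_conj
    simpa using this.symm
  have h := ofReal_qPochPairInf hq0 hq1 a (Real.cos θ) (z := exp (θ * I))
    (w := exp (-(θ * I))) (by rw [← exp_add]; simp) (by
      rw [ofReal_cos, two_cos, neg_mul])
  have h2 : (a : ℂ) * exp (-(θ * I)) = (starRingEnd ℂ) (a * exp (θ * I)) := by
    simp [← exp_conj]
  rw [h2, hc, mul_conj] at h
  exact_mod_cast h

omit hq0 hq1 in
@[simp] theorem qPochPairInf_zero (x : ℝ) : qPochPairInf 0 x q = 1 := by simp [qPochPairInf]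

end

end QSpecial

end

/-! ### Integrals over the unit circle and the first moment of the weight. -/

noncomputable section

namespace QSpecial

open Filter Topology Complex

/-- The integral over the unit circle with respect to the angle. -/
def circ (g : ℂ → ℂ) : ℂ := ∫ θ in (0 : ℝ)..2 * Real.pi, g (exp (θ * I))

theorem circ_congr {f g : ℂ → ℂ} (h : ∀ z, ‖z‖ = 1 → f z = g z) : circ f = circ g := by
  unfold circ
  congr 1
  ext θ
  exact h _ (norm_exp_ofReal_mul_I θ)

theorem circ_inv (g : ℂ → ℂ) : circ (fun z => g z⁻¹) = circ g := by
  unfold circ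
  have h := intervalIntegral.integral_comp_sub_left (fun θ : ℝ => g (exp (θ * I)))
    (2 * Real.pi) (a := 0) (b := 2 * Real.pi)
  simp only [sub_self, sub_zero] at h
  rw [← h]
  congr 1
  ext θ
  change g _ = _
  congr 1
  rw [← exp_neg]
  push_cast
  rw [sub_mul, exp_sub, exp_two_pi_mul_I, exp_neg, one_div]

/-- The angular integral is a contour integral of g(z)/(iz) dz, so by Cauchy's theorem on the
annulus r ≤ |z| ≤ 1 it does not depend on the radius. Every q-shift of an integral over the circle
uses this. -/
theorem circ_scale {r : ℝ} (hr0 : 0 < r) (hr1 : r ≤ 1) {g : ℂ → ℂ}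
    (hg : ∀ z, r ≤ ‖z‖ → ‖z‖ ≤ 1 → DifferentiableAt ℂ g z) :
    circ (fun z => g (r * z)) = circ g := by
  have h := circleIntegral_sub_center_inv_smul_eq_of_differentiable_on_annulus_off_countable
    (c := 0) hr0 hr1 (f := g) (s := ∅) Set.countable_empty
    (fun z hz => (hg z (by simpa using hz.2) (by simpa using hz.1)).continuousAt.continuousWithinAt)
    (fun z hz => by
      simp only [Set.sdiff_empty, Set.mem_sdiff, Metric.mem_ball, dist_zero_right,
        Metric.mem_closedBall, not_le] at hz
      exact hg z hz.2.le hz.1.le)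
  have key : ∀ R : ℝ, 0 < R → (∮ z in C(0, R), (z - 0)⁻¹ • g z) =
      I * circ (fun z => g (R * z)) := by
    intro R hR
    unfold circ circleIntegral
    rw [← intervalIntegral.integral_const_mul]
    congr 1
    ext θ
    have : circleMap 0 R θ ≠ 0 := circleMap_ne_center hR.ne'
    simp only [deriv_circleMap, sub_zero, smul_eq_mul]
    field_simp
    simp [circleMap, mul_comm]
  rw [key 1 one_pos, key r hr0] at h
  have := mul_left_cancel₀ I_ne_zero h
  simpa using this.symm

theorem circ_eq_of_differentiable {g : ℂ → ℂ} (hg : Differentiable ℂ g) :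
    circ g = 2 * Real.pi * g 0 := by
  have h := DiffContOnCl.circleAverage (c := 0) (R := 1) (f := g) hg.diffContOnCl
  rw [Real.circleAverage] at h
  have h2 : (∫ θ in (0 : ℝ)..2 * Real.pi, g (circleMap 0 1 θ)) = circ g := by
    simp [circ, circleMap]
  rw [h2] at h
  rw [← h]
  have : (Real.pi : ℂ) ≠ 0 := by exact_mod_cast Real.pi_ne_zero
  simp only [real_smul]
  push_cast
  field_simp

theorem continuous_circ_integrand {g : ℂ → ℂ} (hg : ∀ z, ‖z‖ = 1 → ContinuousAt g z) :
    Continuous fun θ : ℝ => g (exp (θ * I)) := by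
  rw [continuous_iff_continuousAt]
  intro θ
  exact ContinuousAt.comp (g := g) (f := fun θ : ℝ => exp (θ * I))
    (hg _ (norm_exp_ofReal_mul_I θ)) (by fun_prop)

theorem circ_add {f g : ℂ → ℂ} (hf : ∀ z, ‖z‖ = 1 → ContinuousAt f z)
    (hg : ∀ z, ‖z‖ = 1 → ContinuousAt g z) :
    circ (fun z => f z + g z) = circ f + circ g :=
  intervalIntegral.integral_add ((continuous_circ_integrand hf).intervalIntegrable _ _)
    ((continuous_circ_integrand hg).intervalIntegrable _ _)

theorem circ_const_mul (c : ℂ) (f : ℂ → ℂ) : circ (fun z => c * f z) = c * circ f :=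
  intervalIntegral.integral_const_mul _ _

/-- Integration against the Chebyshev measure as an integral over the unit circle. -/
theorem integral_measureT_eq_circ {f : ℝ → ℝ} {g : ℂ → ℂ}
    (hg : ∀ z, ‖z‖ = 1 → ContinuousAt g z)
    (h : ∀ θ : ℝ, (f (Real.cos θ) : ℂ) = g (exp (θ * I))) :
    ((∫ x, f x ∂Polynomial.Chebyshev.measureT : ℝ) : ℂ) = circ g / 2 := by
  rw [Polynomial.Chebyshev.integral_measureT_eq_integral_cos, ← intervalIntegral.integral_ofReal]
  have hc : Continuous fun θ : ℝ => (f (Real.cos θ) : ℂ) := by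
    simp only [h]
    exact continuous_circ_integrand hg
  have h2 : circ g = ∫ θ in (0 : ℝ)..2 * Real.pi, (f (Real.cos θ) : ℂ) := by
    unfold circ
    simp only [h]
  have h3 := intervalIntegral.integral_comp_sub_left (fun θ : ℝ => (f (Real.cos θ) : ℂ))
    (2 * Real.pi) (a := 0) (b := Real.pi)
  simp only [Real.cos_two_pi_sub, sub_zero] at h3
  rw [show 2 * Real.pi - Real.pi = Real.pi by ring] at h3
  have h4 := intervalIntegral.integral_add_adjacent_intervals
    (hc.intervalIntegrable (μ := volume) 0 Real.pi)
    (hc.intervalIntegrable (μ := volume) Real.pi (2 * Real.pi))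
  rw [h2, ← h4, ← h3]
  ring

section

variable {q : ℝ} (hq0 : 0 < q) (hq1 : q < 1)

include hq0 hq1

theorem differentiableAt_cqPochInf_comp {g : ℂ → ℂ} {z : ℂ} (hg : DifferentiableAt ℂ g z) :
    DifferentiableAt ℂ (fun w => cqPochInf q (g w)) z :=
  DifferentiableAt.comp z (differentiable_cqPochInf hq0 hq1 _) hg

omit hq0 hq1 in
theorem norm_real_mul_lt_one {e : ℝ} (he : |e| < 1) {z : ℂ} (hz : ‖z‖ ≤ 1) :
    ‖(e : ℂ) * z‖ < 1 := by
  rw [norm_mul, norm_real, Real.norm_eq_abs]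
  nlinarith [norm_nonneg z, abs_nonneg e]

/-- The weight function `(z², z⁻²;q)_∞ / ∏ (e z, e / z;q)_∞` on the unit circle has first moment
given by the elementary symmetric functions of the parameters. -/
theorem circ_firstMoment {a b c : ℝ} (ha : |a| < 1) (hb : |b| < 1) (hc : |c| < 1) :
    circ (fun z => (z + z⁻¹ - (a + b + c) + a * b * c) *
      (cqPochInf q (z ^ 2) * cqPochInf q ((z⁻¹) ^ 2) /
        ((cqPochInf q (a * z) * cqPochInf q (a * z⁻¹)) *
          (cqPochInf q (b * z) * cqPochInf q (b * z⁻¹)) *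
          (cqPochInf q (c * z) * cqPochInf q (c * z⁻¹))))) = 0 := by
  -- F is half of the integrand: the integrand is F(z) + F(1/z), while F(qz) = -F(1/z). Shifting the
  -- contour from |z| = 1 to |z| = q hence shows that the integral of F equals its own negative.
  set F : ℂ → ℂ := fun z => z * cqPochInf q (z ^ 2) * cqPochInf q (q * (z⁻¹) ^ 2) /
    ((cqPochInf q (a * z) * cqPochInf q (a * (q * z⁻¹))) *
      (cqPochInf q (b * z) * cqPochInf q (b * (q * z⁻¹))) *
      (cqPochInf q (c * z) * cqPochInf q (c * (q * z⁻¹)))) with hF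
  have hqC : (q : ℂ) ≠ 0 := by exact_mod_cast hq0.ne'
  -- On the closed annulus both |ez| and |eq/z| stay below 1 for each parameter e, so no pole is
  -- crossed.
  have hdiff : ∀ z, q ≤ ‖z‖ → ‖z‖ ≤ 1 → DifferentiableAt ℂ F z := by
    intro z hz1 hz2
    have hz0 : z ≠ 0 := norm_pos_iff.1 (hq0.trans_le hz1)
    have hqz : ‖(q : ℂ) * z⁻¹‖ ≤ 1 := by
      rw [norm_mul, norm_inv, norm_real, Real.norm_of_nonneg hq0.le]
      exact mul_inv_le_one_of_le₀ hz1 (norm_nonneg _)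
    have hne : ∀ e : ℝ, |e| < 1 → cqPochInf q (e * z) * cqPochInf q (e * (q * z⁻¹)) ≠ 0 :=
      fun e he => mul_ne_zero
        (cqPochInf_ne_zero_of_norm_lt hq0 hq1 (norm_real_mul_lt_one he hz2))
        (cqPochInf_ne_zero_of_norm_lt hq0 hq1 (norm_real_mul_lt_one he hqz))
    have hd : ∀ e : ℝ, DifferentiableAt ℂ
        (fun z => cqPochInf q (e * z) * cqPochInf q (e * (q * z⁻¹))) z := fun e =>
      (differentiableAt_cqPochInf_comp hq0 hq1 (by fun_prop)).mul
        (differentiableAt_cqPochInf_comp hq0 hq1 (by fun_prop (disch := assumption)))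
    refine DifferentiableAt.div ?_ (((hd a).mul (hd b)).mul (hd c))
      (mul_ne_zero (mul_ne_zero (hne a ha) (hne b hb)) (hne c hc))
    exact (differentiableAt_id.mul
      (differentiableAt_cqPochInf_comp hq0 hq1 (by fun_prop))).mul
        (differentiableAt_cqPochInf_comp hq0 hq1 (by fun_prop (disch := assumption)))
  have hanti : ∀ z, ‖z‖ = 1 → F (q * z) = -F z⁻¹ := by
    intro z hz
    have hz0 : z ≠ 0 := norm_pos_iff.1 (by rw [hz]; exact one_pos)
    have e1 : ∀ e : ℝ, (e : ℂ) * (q * (q * z)⁻¹) = e * z⁻¹ := fun e => by field_simp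
    have e2 : ∀ e : ℝ, (e : ℂ) * (q * (z⁻¹)⁻¹) = e * (q * z) := fun e => by simp
    simp only [hF, e1, e2]
    rw [show (q : ℂ) * ((q * z)⁻¹) ^ 2 = (z⁻¹) ^ 2 * (q : ℂ)⁻¹ by field_simp,
      show (q * z : ℂ) ^ 2 = (q * z ^ 2) * q by ring,
      show (q : ℂ) * ((z⁻¹)⁻¹) ^ 2 = q * z ^ 2 by simp]
    rw [cqPochInf_eq hq0 hq1 (q * z ^ 2 : ℂ), cqPochInf_eq hq0 hq1 ((z⁻¹) ^ 2 * (q : ℂ)⁻¹),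
      show (z⁻¹) ^ 2 * (q : ℂ)⁻¹ * q = (z⁻¹) ^ 2 by field_simp, ← neg_div]
    congr 1
    · field_simp
      ring
    · ring
  have hsum : ∀ z, ‖z‖ = 1 → (z + z⁻¹ - (a + b + c) + a * b * c) *
      (cqPochInf q (z ^ 2) * cqPochInf q ((z⁻¹) ^ 2) /
        ((cqPochInf q (a * z) * cqPochInf q (a * z⁻¹)) *
          (cqPochInf q (b * z) * cqPochInf q (b * z⁻¹)) *
          (cqPochInf q (c * z) * cqPochInf q (c * z⁻¹)))) = F z + F z⁻¹ := by
    intro z hz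
    have hz0 : z ≠ 0 := norm_pos_iff.1 (by rw [hz]; exact one_pos)
    have hz' : ‖z⁻¹‖ ≤ 1 := by rw [norm_inv, hz]; simp
    have h1 : ∀ e : ℝ, |e| < 1 → cqPochInf q (e * z) ≠ 0 := fun e he =>
      cqPochInf_ne_zero_of_norm_lt hq0 hq1 (norm_real_mul_lt_one he hz.le)
    have h2 : ∀ e : ℝ, |e| < 1 → cqPochInf q (e * z⁻¹) ≠ 0 := fun e he =>
      cqPochInf_ne_zero_of_norm_lt hq0 hq1 (norm_real_mul_lt_one he hz')
    have r1 : ∀ e : ℝ, cqPochInf q (e * z) = (1 - e * z) * cqPochInf q (e * (q * z)) := fun e => by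
      rw [cqPochInf_eq hq0 hq1]; ring_nf
    have r2 : ∀ e : ℝ, cqPochInf q (e * z⁻¹) = (1 - e * z⁻¹) * cqPochInf q (e * (q * z⁻¹)) :=
      fun e => by rw [cqPochInf_eq hq0 hq1]; ring_nf
    have n1 : ∀ e : ℝ, |e| < 1 → 1 - e * z ≠ 0 ∧ cqPochInf q (e * (q * z)) ≠ 0 := fun e he =>
      mul_ne_zero_iff.1 (r1 e ▸ h1 e he)
    have n2 : ∀ e : ℝ, |e| < 1 → 1 - e * z⁻¹ ≠ 0 ∧ cqPochInf q (e * (q * z⁻¹)) ≠ 0 := fun e he =>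
      mul_ne_zero_iff.1 (r2 e ▸ h2 e he)
    simp only [hF, inv_inv]
    rw [cqPochInf_eq hq0 hq1 (z ^ 2), cqPochInf_eq hq0 hq1 ((z⁻¹) ^ 2), r1 a, r1 b, r1 c, r2 a,
      r2 b, r2 c, mul_comm (z ^ 2) (q : ℂ), mul_comm ((z⁻¹) ^ 2) (q : ℂ)]
    obtain ⟨a1, a2⟩ := n1 a ha
    obtain ⟨a3, a4⟩ := n2 a ha
    obtain ⟨b1, b2⟩ := n1 b hb
    obtain ⟨b3, b4⟩ := n2 b hb
    obtain ⟨c1, c2⟩ := n1 c hc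
    obtain ⟨c3, c4⟩ := n2 c hc
    generalize cqPochInf q (a * (q * z)) = A1 at *
    generalize cqPochInf q (a * (q * z⁻¹)) = A2 at *
    generalize cqPochInf q (b * (q * z)) = B1 at *
    generalize cqPochInf q (b * (q * z⁻¹)) = B2 at *
    generalize cqPochInf q (c * (q * z)) = C1 at *
    generalize cqPochInf q (c * (q * z⁻¹)) = C2 at *
    generalize cqPochInf q (q * z ^ 2) = P1
    generalize cqPochInf q (q * z⁻¹ ^ 2) = P2
    have hw : z * z⁻¹ = 1 := mul_inv_cancel₀ hz0
    generalize z⁻¹ = w at *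
    rw [div_add_div _ _ (by simp [*]) (by simp [*]), mul_div_assoc', div_eq_div_iff
      (by simp [*]) (by simp [*])]
    have key : (z + w - (a + b + c) + a * b * c) * ((1 - z ^ 2) * (1 - w ^ 2)) =
        z * (1 - z ^ 2) * ((1 - a * w) * (1 - b * w) * (1 - c * w)) +
        w * (1 - w ^ 2) * ((1 - a * z) * (1 - b * z) * (1 - c * z)) := by
      have hw' : w = 1 / z := by field_simp; linear_combination hw
      rw [hw']
      field_simp
      ring
    linear_combination (A1 * A2 * B1 * B2 * C1 * C2) * (A1 * A2 * B1 * B2 * C1 * C2) *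
      (1 - a * z) * (1 - b * z) * (1 - c * z) *
      (1 - a * w) * (1 - b * w) * (1 - c * w) * P1 * P2 * key
  rw [circ_congr hsum]
  have hcF : ∀ z, ‖z‖ = 1 → ContinuousAt F z := fun z hz =>
    (hdiff z (by rw [hz]; exact hq1.le) hz.le).continuousAt
  have hcF' : ∀ z, ‖z‖ = 1 → ContinuousAt (fun z => F z⁻¹) z := fun z hz => by
    have hz0 : z ≠ 0 := norm_pos_iff.1 (by rw [hz]; exact one_pos)
    exact ContinuousAt.comp (g := F) (f := fun z => z⁻¹) (hcF _ (by rw [norm_inv, hz, inv_one]))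
      (continuousAt_inv₀ hz0)
  rw [circ_add hcF hcF', circ_inv]
  have h1 := circ_scale hq0 hq1.le hdiff
  rw [circ_congr hanti] at h1
  have h2 : circ (fun z => -F z⁻¹) = -circ F := by
    have := circ_const_mul (-1) (fun z => F z⁻¹)
    simp only [neg_one_mul] at this
    rw [this, circ_inv]
  rw [h2] at h1
  linear_combination -h1

end

end QSpecial

end

/-! ### Total mass for vanishing parameters (continuous q-Hermite weight). -/

noncomputable section

namespace QSpecial

open Filter Topology Complex

/-- The finite `q`-shifted factorial of a complex argument. -/
def cqPoch (q : ℝ) (z : ℂ) (k : ℕ) : ℂ := ∏ i ∈ Finset.range k, (1 - z * (q : ℂ) ^ i)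

section

variable {q : ℝ} (hq0 : 0 < q) (hq1 : q < 1)

omit hq0 hq1 in
theorem cqPoch_succ (z : ℂ) (k : ℕ) :
    cqPoch q z (k + 1) = (1 - z * (q : ℂ) ^ k) * cqPoch q z k := by
  rw [cqPoch, cqPoch, Finset.prod_range_succ, mul_comm]

omit hq0 hq1 in
theorem cqPoch_mul_shift (z : ℂ) (k : ℕ) :
    (1 - z) * cqPoch q (q * z) k = (1 - z * (q : ℂ) ^ k) * cqPoch q z k := by
  rw [← cqPoch_succ, cqPoch, cqPoch, Finset.prod_range_succ', mul_comm]
  simp only [pow_zero, mul_one, pow_succ]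
  congr 1
  exact Finset.prod_congr rfl fun i _ => by ring

omit hq0 hq1 in
theorem differentiable_cqPoch (k : ℕ) : Differentiable ℂ fun z => cqPoch q z k := by
  unfold cqPoch
  fun_prop

include hq0 hq1

theorem differentiableAt_cqPochInf_inv {z : ℂ} (hz : z ≠ 0) :
    DifferentiableAt ℂ (fun z => cqPochInf q (q * (z⁻¹) ^ 2)) z :=
  differentiableAt_cqPochInf_comp hq0 hq1 (by fun_prop (disch := assumption))

/-- Truncating one infinite product makes an induction possible. For k = 0 the integrand becomes
entire after z ↦ 1/z and the mean value property applies. The step uses the second moment M of the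
truncated weight: shifting z ↦ q^{1/2} z gives a linear equation for M in terms of the known
integral. -/
theorem circ_cqPoch_mul (k : ℕ) :
    circ (fun z => cqPoch q (z ^ 2) k * cqPochInf q (q * (z⁻¹) ^ 2)) =
      2 * Real.pi / qPoch q q k := by
  induction k with
  | zero =>
    have h1 := circ_inv fun z => cqPochInf q (q * z ^ 2)
    simp only [cqPoch, qPoch, Finset.range_zero, Finset.prod_empty, one_mul, ofReal_one, div_one]
    rw [h1, circ_eq_of_differentiable
      (fun z => differentiableAt_cqPochInf_comp hq0 hq1 (by fun_prop))]
    simp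
  | succ k ih =>
    set r := Real.sqrt q with hr
    have hr0 : 0 < r := Real.sqrt_pos.2 hq0
    have hr1 : r ≤ 1 := Real.sqrt_le_one.2 hq1.le
    have hrq : (r : ℂ) ^ 2 = q := by rw [← ofReal_pow, Real.sq_sqrt hq0.le]
    have hqC : (q : ℂ) ≠ 0 := by exact_mod_cast hq0.ne'
    have hrC : (r : ℂ) ≠ 0 := by exact_mod_cast hr0.ne'
    set Θ : ℂ → ℂ := fun z => cqPoch q (z ^ 2) k * cqPochInf q (q * (z⁻¹) ^ 2) with hΘ
    have hd : ∀ z, z ≠ 0 → DifferentiableAt ℂ Θ z := fun z hz =>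
      (DifferentiableAt.comp (g := fun z => cqPoch q z k) (f := fun z : ℂ => z ^ 2) z
        (differentiable_cqPoch k _) (by fun_prop)).mul (differentiableAt_cqPochInf_inv hq0 hq1 hz)
    have hd1 : ∀ z, z ≠ 0 → DifferentiableAt ℂ (fun z => z ^ 2 * Θ z) z := fun z hz =>
      (by fun_prop : DifferentiableAt ℂ (fun z : ℂ => z ^ 2) z).mul (hd z hz)
    have hn : ∀ z : ℂ, ‖z‖ = 1 → z ≠ 0 := fun z hz =>
      norm_pos_iff.1 (by rw [hz]; exact one_pos)
    have hs := circ_scale hr0 hr1 (g := fun z => z ^ 2 * Θ z)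
      fun z hz _ => hd1 z (norm_pos_iff.1 (hr0.trans_le hz))
    -- Integrated, this reads M = -q I + q^{k+1} M, where I is the integral of Θ.
    have hshift : ∀ z, ‖z‖ = 1 → (r * z) ^ 2 * Θ (r * z) =
        (-q : ℂ) * Θ z + (q : ℂ) ^ (k + 1) * (z ^ 2 * Θ z) := by
      intro z hz
      have hz0 := hn z hz
      simp only [hΘ]
      rw [mul_pow, hrq, mul_inv, mul_pow, inv_pow (r : ℂ), hrq,
        show (q : ℂ) * ((q : ℂ)⁻¹ * z⁻¹ ^ 2) = z⁻¹ ^ 2 by field_simp,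
        cqPochInf_eq hq0 hq1 (z⁻¹ ^ 2), mul_comm (z⁻¹ ^ 2) (q : ℂ)]
      have h1 := cqPoch_mul_shift (q := q) (z ^ 2) k
      have h2 : z ^ 2 * (1 - z⁻¹ ^ 2) = -(1 - z ^ 2) := by field_simp; ring
      linear_combination (q * cqPoch q (q * z ^ 2) k * cqPochInf q (q * z⁻¹ ^ 2)) * h2 -
        q * cqPochInf q (q * z⁻¹ ^ 2) * h1
    rw [circ_congr hshift, circ_add
      (fun z hz => ((hd z (hn z hz)).continuousAt).const_mul _)
      (fun z hz => ((hd1 z (hn z hz)).continuousAt).const_mul _),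
      circ_const_mul, circ_const_mul, ih] at hs
    have hsucc : ∀ z, ‖z‖ = 1 → cqPoch q (z ^ 2) (k + 1) * cqPochInf q (q * (z⁻¹) ^ 2) =
        Θ z + (-(q : ℂ) ^ k) * (z ^ 2 * Θ z) := by
      intro z _
      rw [cqPoch_succ, hΘ]
      ring
    rw [circ_congr hsucc, circ_add
      (fun z hz => (hd z (hn z hz)).continuousAt)
      (fun z hz => ((hd1 z (hn z hz)).continuousAt).const_mul _), circ_const_mul, ih]
    have hq1' : (1 : ℂ) - q ^ (k + 1) ≠ 0 := by
      have : q ^ (k + 1) < 1 := pow_lt_one₀ hq0.le hq1 (by simp)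
      have h : (1 - q ^ (k + 1) : ℝ) ≠ 0 := by linarith
      exact_mod_cast h
    have hP : (qPoch q q k : ℂ) ≠ 0 := by
      have : qPoch q q k ≠ 0 := Finset.prod_ne_zero_iff.2 fun i _ => by
        have : q * q ^ i < 1 := mul_pow_lt_one hq1 hq0.le hq1 i
        linarith
      exact_mod_cast this
    have hPs : (qPoch q q (k + 1) : ℂ) = qPoch q q k * (1 - q ^ (k + 1)) := by
      rw [qPoch, qPoch, Finset.prod_range_succ]
      push_cast
      ring
    rw [hPs]
    generalize circ (fun z => z ^ 2 * Θ z) = M at *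
    have hM : M = -q * (2 * Real.pi / qPoch q q k) / (1 - q ^ (k + 1)) := by
      field_simp
      field_simp at hs
      linear_combination -hs
    rw [hM]
    field_simp
    ring

theorem tendsto_cqPoch (z : ℂ) : Tendsto (fun k => cqPoch q z k) atTop (𝓝 (cqPochInf q z)) :=
  (multipliable_one_sub_mul_pow hq0 hq1 z).hasProd.tendsto_prod_nat

theorem norm_cqPoch_le (z : ℂ) (hz : ‖z‖ = 1) (k : ℕ) : ‖cqPoch q z k‖ ≤ qPochInf (-1) q := by
  have hmono : Monotone fun k => qPoch (-1) q k := monotone_nat_of_le_succ fun n => by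
    rw [qPoch, qPoch, Finset.prod_range_succ]
    refine le_mul_of_one_le_right (Finset.prod_nonneg fun i _ => ?_) ?_
    · have := pow_pos hq0 i
      linarith
    · have := pow_pos hq0 n
      linarith
  refine le_trans ?_ (hmono.ge_of_tendsto (tendsto_qPoch hq0 hq1 (-1)) k)
  rw [cqPoch, norm_prod, qPoch]
  refine Finset.prod_le_prod (fun _ _ => norm_nonneg _) fun i _ => (norm_sub_le _ _).trans ?_
  rw [norm_mul, norm_pow, hz, norm_real, Real.norm_of_nonneg hq0.le]
  simp

/-- Limit k → ∞ of `circ_cqPoch_mul`, dominated through |(z;q)_k| ≤ (-1;q)_∞ on the unit circle. -/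
theorem circ_cqPochInf_mul :
    circ (fun z => cqPochInf q (z ^ 2) * cqPochInf q (q * (z⁻¹) ^ 2)) =
      2 * Real.pi / qPochInf q q := by
  have hc : Continuous fun θ : ℝ => cqPochInf q (q * ((exp (θ * I))⁻¹) ^ 2) :=
    continuous_circ_integrand (g := fun z => cqPochInf q (q * (z⁻¹) ^ 2)) fun z hz =>
      (differentiableAt_cqPochInf_inv hq0 hq1
        (norm_pos_iff.1 (by rw [hz]; exact one_pos))).continuousAt
  have h1 : Tendsto (fun k => circ (fun z => cqPoch q (z ^ 2) k * cqPochInf q (q * (z⁻¹) ^ 2)))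
      atTop (𝓝 (circ (fun z => cqPochInf q (z ^ 2) * cqPochInf q (q * (z⁻¹) ^ 2)))) := by
    refine intervalIntegral.tendsto_integral_filter_of_dominated_convergence
      (fun θ : ℝ => qPochInf (-1) q * ‖cqPochInf q (q * ((exp (θ * I))⁻¹) ^ 2)‖) ?_ ?_ ?_ ?_
    · refine Eventually.of_forall fun k => Continuous.aestronglyMeasurable ?_
      refine Continuous.mul ?_ hc
      exact (differentiable_cqPoch k).continuous.comp (by fun_prop)
    · refine Eventually.of_forall fun k => Eventually.of_forall fun θ _ => ?_
      rw [norm_mul]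
      gcongr
      refine norm_cqPoch_le hq0 hq1 _ ?_ k
      rw [norm_pow, norm_exp_ofReal_mul_I, one_pow]
    · exact (hc.norm.const_mul _).intervalIntegrable _ _
    · exact Eventually.of_forall fun θ _ => (tendsto_cqPoch hq0 hq1 _).mul_const _
  simp only [circ_cqPoch_mul hq0 hq1] at h1
  refine tendsto_nhds_unique h1 ?_
  refine Tendsto.div tendsto_const_nhds ?_ ?_
  · exact (Complex.continuous_ofReal.tendsto _).comp (tendsto_qPoch hq0 hq1 q)
  · exact_mod_cast qPochInf_ne_zero_of_lt hq0 hq1 hq1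

/-- The weight is Θ(z) + Θ(q^{1/2} z) with Θ(z) = (z²;q)_∞ (q/z²;q)_∞, because (1 - z²) + (1 - z⁻²)
= (1 - z²)(1 - z⁻²). Both summands have the same integral, by `circ_scale`. -/
theorem circ_hermite :
    circ (fun z => cqPochInf q (z ^ 2) * cqPochInf q ((z⁻¹) ^ 2)) =
      4 * Real.pi / qPochInf q q := by
  set r := Real.sqrt q with hr
  have hr0 : 0 < r := Real.sqrt_pos.2 hq0
  have hr1 : r ≤ 1 := Real.sqrt_le_one.2 hq1.le
  have hrq : (r : ℂ) ^ 2 = q := by rw [← ofReal_pow, Real.sq_sqrt hq0.le]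
  have hqC : (q : ℂ) ≠ 0 := by exact_mod_cast hq0.ne'
  have hn : ∀ z : ℂ, ‖z‖ = 1 → z ≠ 0 := fun z hz =>
    norm_pos_iff.1 (by rw [hz]; exact one_pos)
  set Θ : ℂ → ℂ := fun z => cqPochInf q (z ^ 2) * cqPochInf q (q * (z⁻¹) ^ 2) with hΘ
  have hd : ∀ z, z ≠ 0 → DifferentiableAt ℂ Θ z := fun z hz =>
    (differentiableAt_cqPochInf_comp hq0 hq1 (by fun_prop)).mul
      (differentiableAt_cqPochInf_inv hq0 hq1 hz)
  have hs := circ_scale hr0 hr1 (g := Θ)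
    fun z hz _ => hd z (norm_pos_iff.1 (hr0.trans_le hz))
  have hd' : ∀ z, ‖z‖ = 1 → ContinuousAt (fun z => Θ (r * z)) z := fun z hz =>
    ContinuousAt.comp (x := z) (g := Θ) (f := fun z : ℂ => (r : ℂ) * z)
      (hd _ (mul_ne_zero (by exact_mod_cast hr0.ne') (hn z hz))).continuousAt (by fun_prop)
  have hsum : ∀ z, ‖z‖ = 1 → cqPochInf q (z ^ 2) * cqPochInf q ((z⁻¹) ^ 2) =
      Θ z + Θ (r * z) := by
    intro z hz
    have hz0 := hn z hz
    simp only [hΘ]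
    rw [mul_pow, hrq, mul_inv, mul_pow, inv_pow (r : ℂ), hrq,
      show (q : ℂ) * ((q : ℂ)⁻¹ * z⁻¹ ^ 2) = z⁻¹ ^ 2 by field_simp,
      cqPochInf_eq hq0 hq1 (z⁻¹ ^ 2), mul_comm (z⁻¹ ^ 2) (q : ℂ),
      cqPochInf_eq hq0 hq1 (z ^ 2), mul_comm (z ^ 2) (q : ℂ)]
    field_simp
    ring
  rw [circ_congr hsum, circ_add (fun z hz => (hd z (hn z hz)).continuousAt) hd', hs,
    circ_cqPochInf_mul hq0 hq1]
  ring

end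

end QSpecial

end

/-! ### The weight on [-1,1]: bounds, integrability and limits in the parameters. -/

noncomputable section

namespace QSpecial

open Filter Topology Complex Polynomial.Chebyshev

theorem ae_measureT_mem_Ioo : ∀ᵐ x ∂measureT, x ∈ Set.Ioo (-1 : ℝ) 1 := by
  have h1 : ∀ᵐ x ∂measureT, x ∈ Set.Ioc (-1 : ℝ) 1 := by
    unfold measureT
    exact ae_restrict_mem measurableSet_Ioc
  have h2 : ∀ᵐ x ∂measureT, x ≠ (1 : ℝ) := by
    have hac : measureT ≪ volume :=
      Measure.absolutelyContinuous_of_le Measure.restrict_le_self |>.trans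
        (withDensity_absolutelyContinuous _ _)
    exact hac.ae_le (Measure.ae_ne volume 1)
  filter_upwards [h1, h2] with x hx hx'
  exact ⟨hx.1, lt_of_le_of_ne hx.2 hx'⟩

instance : IsFiniteMeasure measureT := by
  have h : Integrable (fun _ : ℝ => (1 : ℝ)) measureT := integrable_measureT continuousOn_const
  rw [integrable_const_iff] at h
  exact h.resolve_left one_ne_zero

/-- The part of the weight function of the continuous dual `q`-Hahn polynomials that is left when
the Chebyshev factor `(1 - x^2)^(-1/2)` is split off. -/
def hahnWeight (q a b c x : ℝ) : ℝ :=
  qPochPairInf 1 (2 * x ^ 2 - 1) q /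
    (qPochPairInf a x q * qPochPairInf b x q * qPochPairInf c x q)

section

variable {q : ℝ} (hq0 : 0 < q) (hq1 : q < 1)

theorem qPochPairInf_neg (e x : ℝ) : qPochPairInf (-e) x q = qPochPairInf e (-x) q := by
  unfold qPochPairInf
  congr 1
  ext i
  ring

include hq0 hq1

theorem qPochPairInf_eq_normSq (e : ℝ) {x : ℝ} (hx : x ∈ Set.Icc (-1 : ℝ) 1) :
    qPochPairInf e x q = normSq (cqPochInf q (e * exp (Real.arccos x * I))) := by
  rw [← qPochPairInf_cos hq0 hq1, Real.cos_arccos hx.1 hx.2]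

theorem qPochPairInf_nonneg (e : ℝ) {x : ℝ} (hx : x ∈ Set.Icc (-1 : ℝ) 1) :
    0 ≤ qPochPairInf e x q := by
  rw [qPochPairInf_eq_normSq hq0 hq1 e hx]
  exact normSq_nonneg _

theorem continuousOn_qPochPairInf :
    ContinuousOn (fun p : ℝ × ℝ => qPochPairInf p.1 p.2 q) (Set.univ ×ˢ Set.Icc (-1) 1) := by
  have : Continuous fun p : ℝ × ℝ =>
      normSq (cqPochInf q (p.1 * exp (Real.arccos p.2 * I))) := by
    refine continuous_normSq.comp ((continuous_cqPochInf hq0 hq1).comp ?_)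
    have : Continuous Real.arccos := Real.continuous_arccos
    fun_prop
  exact this.continuousOn.congr fun p hp => qPochPairInf_eq_normSq hq0 hq1 p.1 hp.2

theorem continuousOn_qPochPairInf_right (e : ℝ) :
    ContinuousOn (fun x => qPochPairInf e x q) (Set.Icc (-1) 1) :=
  (continuousOn_qPochPairInf hq0 hq1).comp (f := fun x => (e, x)) (by fun_prop)
    fun x hx => ⟨Set.mem_univ _, hx⟩

theorem continuous_qPochPairInf_left {x : ℝ} (hx : x ∈ Set.Icc (-1 : ℝ) 1) :
    Continuous fun e => qPochPairInf e x q := by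
  rw [← continuousOn_univ]
  exact (continuousOn_qPochPairInf hq0 hq1).comp (f := fun e => (e, x)) (by fun_prop)
    fun e _ => ⟨Set.mem_univ _, hx⟩

omit hq0 hq1 in
theorem two_mul_sq_sub_one_mem {x : ℝ} (hx : x ∈ Set.Icc (-1 : ℝ) 1) :
    2 * x ^ 2 - 1 ∈ Set.Icc (-1 : ℝ) 1 := by
  constructor
  · nlinarith [sq_nonneg x]
  · nlinarith [hx.1, hx.2]

theorem continuousOn_qPochPairInf_double (e : ℝ) :
    ContinuousOn (fun x => qPochPairInf e (2 * x ^ 2 - 1) q) (Set.Icc (-1) 1) :=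
  (continuousOn_qPochPairInf_right hq0 hq1 e).comp (f := fun x => 2 * x ^ 2 - 1) (by fun_prop)
    fun _ hx => two_mul_sq_sub_one_mem hx

omit hq0 hq1 in
theorem aemeasurable_measureT {f : ℝ → ℝ} (hf : ContinuousOn f (Set.Icc (-1) 1)) :
    AEMeasurable f measureT := by
  unfold measureT
  exact (hf.mono Set.Ioc_subset_Icc_self).aemeasurable measurableSet_Ioc

theorem aemeasurable_hahnWeight (a b c : ℝ) : AEMeasurable (hahnWeight q a b c) measureT :=
  (aemeasurable_measureT (continuousOn_qPochPairInf_double hq0 hq1 1)).div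
    (((aemeasurable_measureT (continuousOn_qPochPairInf_right hq0 hq1 a)).mul
      (aemeasurable_measureT (continuousOn_qPochPairInf_right hq0 hq1 b))).mul
      (aemeasurable_measureT (continuousOn_qPochPairInf_right hq0 hq1 c)))

theorem hahnWeight_nonneg (a b c : ℝ) {x : ℝ} (hx : x ∈ Set.Icc (-1 : ℝ) 1) :
    0 ≤ hahnWeight q a b c x := by
  unfold hahnWeight
  have h := fun e => qPochPairInf_nonneg hq0 hq1 e hx
  exact div_nonneg (qPochPairInf_nonneg hq0 hq1 1 (two_mul_sq_sub_one_mem hx))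
    (mul_nonneg (mul_nonneg (h a) (h b)) (h c))

/-- The minimum of |(z;q)_∞|² over the compact disc of radius r is positive, since there are no
zeros in the open unit disc. The bound is uniform in the parameter. -/
theorem exists_le_qPochPairInf {r : ℝ} (hr : r < 1) :
    ∃ δ > 0, ∀ e, |e| ≤ r → ∀ x ∈ Set.Icc (-1 : ℝ) 1, δ ≤ qPochPairInf e x q := by
  rcases lt_or_ge r 0 with h0 | h0
  · exact ⟨1, one_pos, fun e he => absurd (he.trans_lt h0) (not_lt.2 (abs_nonneg e))⟩
  obtain ⟨z, hz, hmin⟩ := (isCompact_closedBall (0 : ℂ) r).exists_isMinOn ⟨0, by simpa⟩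
    (continuous_normSq.comp (continuous_cqPochInf hq0 hq1)).continuousOn
  have hz' : ‖z‖ ≤ r := by simpa using hz
  refine ⟨normSq (cqPochInf q z), normSq_pos.2
    (cqPochInf_ne_zero_of_norm_lt hq0 hq1 (hz'.trans_lt hr)), fun e he x hx => ?_⟩
  rw [qPochPairInf_eq_normSq hq0 hq1 e hx]
  refine hmin ?_
  simp only [Metric.mem_closedBall, dist_zero_right, norm_mul, norm_real, norm_exp_ofReal_mul_I,
    mul_one, Real.norm_eq_abs]
  exact he

theorem exists_le_qPochPairInf_of_abs_lt {e : ℝ} (he : |e| < 1) :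
    ∃ δ > 0, ∀ x ∈ Set.Icc (-1 : ℝ) 1, δ * 1 ≤ qPochPairInf e x q := by
  obtain ⟨δ, hδ, h⟩ := exists_le_qPochPairInf hq0 hq1 he
  exact ⟨δ, hδ, fun x hx => by simpa using h e le_rfl x hx⟩

omit hq1 hq0 in
theorem exists_abs_mul_pow_lt_one (h0 : 0 ≤ q) (h1 : q < 1) (e : ℝ) : ∃ k : ℕ, |e * q ^ k| < 1 := by
  have h : Tendsto (fun k : ℕ => |e * q ^ k|) atTop (𝓝 |e * 0|) :=
    ((tendsto_pow_atTop_nhds_zero_of_lt_one h0 h1).const_mul e).abs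
  simp only [mul_zero, abs_zero] at h
  exact (h.eventually_lt_const one_pos).exists

/-- Finitely many factors are split off until the parameter is below 1. Each factor is at least (e -
1)² on [-1,1], except that for e = 1 it equals 2(1 - x); this exception happens at most once. -/
theorem exists_mul_le_qPochPairInf_of_nonneg {e : ℝ} (he : 0 ≤ e) :
    ∃ δ > 0, ∀ x ∈ Set.Icc (-1 : ℝ) 1, δ * (1 - x) ≤ qPochPairInf e x q := by
  obtain ⟨k, hk⟩ := exists_abs_mul_pow_lt_one hq0.le hq1 e
  induction k generalizing e with
  | zero =>
    obtain ⟨δ, hδ, h⟩ := exists_le_qPochPairInf_of_abs_lt hq0 hq1 (e := e) (by simpa using hk)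
    refine ⟨δ / 2, by positivity, fun x hx => le_trans ?_ (h x hx)⟩
    nlinarith [hx.1]
  | succ k ih =>
    by_cases h1 : e = 1
    · obtain ⟨δ, hδ, h⟩ := exists_le_qPochPairInf_of_abs_lt hq0 hq1 (e := q)
        (by rwa [abs_of_pos hq0])
      refine ⟨2 * δ, by positivity, fun x hx => ?_⟩
      rw [qPochPairInf_eq hq0 hq1, h1, one_mul]
      nlinarith [h x hx, hx.2]
    · obtain ⟨δ, hδ, h⟩ := ih (e := e * q) (by positivity)
        (by rwa [pow_succ', ← mul_assoc] at hk)
      refine ⟨(e - 1) ^ 2 * δ, mul_pos (by have := sub_ne_zero.2 h1; positivity) hδ,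
        fun x hx => ?_⟩
      rw [qPochPairInf_eq hq0 hq1, mul_assoc]
      refine mul_le_mul ?_ (h x hx) (mul_nonneg hδ.le (by linarith [hx.2])) ?_
      · nlinarith [hx.2]
      · nlinarith [hx.2, sq_nonneg (e - 1)]

theorem exists_mul_le_qPochPairInf_of_nonpos {e : ℝ} (he : e ≤ 0) :
    ∃ δ > 0, ∀ x ∈ Set.Icc (-1 : ℝ) 1, δ * (1 + x) ≤ qPochPairInf e x q := by
  obtain ⟨δ, hδ, h⟩ := exists_mul_le_qPochPairInf_of_nonneg hq0 hq1 (e := -e) (by linarith)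
  refine ⟨δ, hδ, fun x hx => ?_⟩
  have := h (-x) ⟨by linarith [hx.2], by linarith [hx.1]⟩
  rwa [qPochPairInf_neg, neg_neg, sub_neg_eq_add] at this

/-- The first factor of the numerator is 4(1 - x²), which offsets simple zeros of the denominator at
both endpoints. -/
theorem exists_qPochPairInf_double_le :
    ∃ C, ∀ x ∈ Set.Icc (-1 : ℝ) 1, qPochPairInf 1 (2 * x ^ 2 - 1) q ≤ C * (1 - x ^ 2) := by
  obtain ⟨C, hC⟩ := isCompact_Icc.exists_bound_of_continuousOn
    (continuousOn_qPochPairInf_double hq0 hq1 q)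
  refine ⟨4 * C, fun x hx => ?_⟩
  rw [qPochPairInf_eq hq0 hq1, one_mul]
  have h1 := (le_abs_self _).trans (hC x hx)
  have h2 : 0 ≤ 1 - x ^ 2 := by nlinarith [hx.1, hx.2]
  nlinarith

/-- Pointwise lower bounds for the three factors of the denominator bound the weight function. -/
theorem exists_hahnWeight_le_of_le {a b c : ℝ} {u v w : ℝ → ℝ} {K : ℝ}
    (hu : ∃ δ > 0, ∀ x ∈ Set.Icc (-1 : ℝ) 1, δ * u x ≤ qPochPairInf a x q)
    (hv : ∃ δ > 0, ∀ x ∈ Set.Icc (-1 : ℝ) 1, δ * v x ≤ qPochPairInf b x q)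
    (hw : ∃ δ > 0, ∀ x ∈ Set.Icc (-1 : ℝ) 1, δ * w x ≤ qPochPairInf c x q)
    (h0 : ∀ x ∈ Set.Ioo (-1 : ℝ) 1, 0 < u x ∧ 0 < v x ∧ 0 < w x)
    (h : ∀ x ∈ Set.Ioo (-1 : ℝ) 1, 1 - x ^ 2 ≤ K * (u x * v x * w x)) :
    ∃ C, ∀ x ∈ Set.Ioo (-1 : ℝ) 1, hahnWeight q a b c x ≤ C := by
  obtain ⟨d1, hd1, hu⟩ := hu
  obtain ⟨d2, hd2, hv⟩ := hv
  obtain ⟨d3, hd3, hw⟩ := hw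
  obtain ⟨C, hC⟩ := exists_qPochPairInf_double_le hq0 hq1
  refine ⟨|C| * K / (d1 * d2 * d3), fun x hx => ?_⟩
  have hx' := Set.Ioo_subset_Icc_self hx
  obtain ⟨u0, v0, w0⟩ := h0 x hx
  have hden : d1 * d2 * d3 * (u x * v x * w x) ≤
      qPochPairInf a x q * qPochPairInf b x q * qPochPairInf c x q := by
    calc d1 * d2 * d3 * (u x * v x * w x) = (d1 * u x) * (d2 * v x) * (d3 * w x) := by ring
      _ ≤ _ := by
        gcongr
        · exact mul_nonneg (qPochPairInf_nonneg hq0 hq1 _ hx') (qPochPairInf_nonneg hq0 hq1 _ hx')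
        · exact qPochPairInf_nonneg hq0 hq1 _ hx'
        · exact hu x hx'
        · exact hv x hx'
        · exact hw x hx'
  have hpos : 0 < d1 * d2 * d3 * (u x * v x * w x) := by positivity
  unfold hahnWeight
  rw [div_le_div_iff₀ (hpos.trans_le hden) (by positivity)]
  have h1 : 0 < 1 - x ^ 2 := by nlinarith [hx.1, hx.2]
  have hK : 0 ≤ K := by
    by_contra! hK
    have : K * (u x * v x * w x) ≤ 0 := mul_nonpos_of_nonpos_of_nonneg hK.le (by positivity)
    linarith [h x hx]
  calc qPochPairInf 1 (2 * x ^ 2 - 1) q * (d1 * d2 * d3)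
      ≤ (|C| * (K * (u x * v x * w x))) * (d1 * d2 * d3) := by
        gcongr
        refine (hC x hx').trans ?_
        calc C * (1 - x ^ 2) ≤ |C| * (1 - x ^ 2) := by gcongr; exact le_abs_self C
          _ ≤ _ := by gcongr; exact h x hx
    _ = |C| * K * (d1 * d2 * d3 * (u x * v x * w x)) := by ring
    _ ≤ _ := by gcongr

/-- A parameter at least 1 can make the denominator vanish at x = 1, one at most -1 can do so at x =
-1. Pairwise products below one allow at most one parameter of each kind, and the numerator
compensates both zeros. -/
theorem exists_hahnWeight_le {a b c : ℝ} (hab : a * b < 1) (hac : a * c < 1) (hbc : b * c < 1) :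
    ∃ C, ∀ x ∈ Set.Ioo (-1 : ℝ) 1, hahnWeight q a b c x ≤ C := by
  have T : ∀ e : ℝ, (∃ δ > 0, ∀ x ∈ Set.Icc (-1 : ℝ) 1, δ * 1 ≤ qPochPairInf e x q) ∨
      (1 ≤ e ∧ ∃ δ > 0, ∀ x ∈ Set.Icc (-1 : ℝ) 1, δ * (1 - x) ≤ qPochPairInf e x q) ∨
      (e ≤ -1 ∧ ∃ δ > 0, ∀ x ∈ Set.Icc (-1 : ℝ) 1, δ * (1 + x) ≤ qPochPairInf e x q) := by
    intro e
    by_cases h : |e| < 1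
    · exact Or.inl (exists_le_qPochPairInf_of_abs_lt hq0 hq1 h)
    · rcases le_abs'.1 (not_lt.1 h) with h | h
      · exact Or.inr (Or.inr ⟨h, exists_mul_le_qPochPairInf_of_nonpos hq0 hq1 (by linarith)⟩)
      · exact Or.inr (Or.inl ⟨h, exists_mul_le_qPochPairInf_of_nonneg hq0 hq1 (by linarith)⟩)
  rcases T a with ha | ⟨ha', ha⟩ | ⟨ha', ha⟩ <;> rcases T b with hb | ⟨hb', hb⟩ | ⟨hb', hb⟩ <;>
    rcases T c with hc | ⟨hc', hc⟩ | ⟨hc', hc⟩ <;>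
    first
    -- Two parameters that are both at least 1 or both at most -1 contradict the product condition.
    -- In all other cases 1 - x² ≤ 2uvw holds, because each factor of 1 - x² that is missing from
    -- uvw is at most 2.
    | (exfalso; nlinarith)
    | (refine exists_hahnWeight_le_of_le hq0 hq1 (K := 2) ha hb hc (fun x hx => ?_)
        (fun x hx => ?_)
       · refine ⟨?_, ?_, ?_⟩ <;> linarith [hx.1, hx.2]
       · nlinarith [hx.1, hx.2])

theorem integrable_mul_hahnWeight {a b c : ℝ} (hab : a * b < 1) (hac : a * c < 1)
    (hbc : b * c < 1) {f : ℝ → ℝ} (hf : Continuous f) :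
    Integrable (fun x => f x * hahnWeight q a b c x) measureT := by
  obtain ⟨C, hC⟩ := exists_hahnWeight_le hq0 hq1 hab hac hbc
  have hw : Integrable (hahnWeight q a b c) measureT := by
    refine Integrable.of_bound (aemeasurable_hahnWeight hq0 hq1 a b c).aestronglyMeasurable C ?_
    filter_upwards [ae_measureT_mem_Ioo] with x hx
    rw [Real.norm_of_nonneg (hahnWeight_nonneg hq0 hq1 a b c (Set.Ioo_subset_Icc_self hx))]
    exact hC x hx
  obtain ⟨D, hD⟩ := isCompact_Icc.exists_bound_of_continuousOn
    (hf.continuousOn (s := Set.Icc (-1 : ℝ) 1))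
  refine hw.bdd_mul (c := D) hf.aestronglyMeasurable ?_
  filter_upwards [ae_measureT_mem_Ioo] with x hx
  exact hD x (Set.Ioo_subset_Icc_self hx)

/-- Multiplying the weight function by the first factor for `a` shifts `a` to `a q`. -/
theorem mul_hahnWeight (a b c : ℝ) {x : ℝ} (hx : x ∈ Set.Ioo (-1 : ℝ) 1) :
    (1 - 2 * a * x + a ^ 2) * hahnWeight q a b c x = hahnWeight q (a * q) b c x := by
  have h : 1 - 2 * a * x + a ^ 2 ≠ 0 := by nlinarith [sq_nonneg (a - x), hx.1, hx.2]
  unfold hahnWeight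
  rw [qPochPairInf_eq hq0 hq1 a, mul_assoc (1 - 2 * a * x + a ^ 2),
    mul_assoc (1 - 2 * a * x + a ^ 2), mul_div_assoc', mul_div_mul_left _ _ h]

omit hq0 hq1 in
theorem hahnWeight_swap (a b c x : ℝ) : hahnWeight q a b c x = hahnWeight q b a c x := by
  unfold hahnWeight
  rw [mul_comm (qPochPairInf a x q)]

omit hq0 hq1 in
theorem hahnWeight_swap_right (a b c x : ℝ) : hahnWeight q a b c x = hahnWeight q a c b x := by
  unfold hahnWeight
  rw [mul_right_comm]

theorem qPochPairInf_pos (e : ℝ) {x : ℝ} (hx : x ∈ Set.Ioo (-1 : ℝ) 1) :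
    0 < qPochPairInf e x q := by
  have hx' := Set.Ioo_subset_Icc_self hx
  rcases le_total 0 e with he | he
  · obtain ⟨δ, hδ, h⟩ := exists_mul_le_qPochPairInf_of_nonneg hq0 hq1 he
    exact (mul_pos hδ (by linarith [hx.2])).trans_le (h x hx')
  · obtain ⟨δ, hδ, h⟩ := exists_mul_le_qPochPairInf_of_nonpos hq0 hq1 he
    exact (mul_pos hδ (by linarith [hx.1])).trans_le (h x hx')

theorem tendsto_integral_hahnWeight {a b c : ℕ → ℝ} {a' b' c' C : ℝ}
    (ha : Tendsto a atTop (𝓝 a')) (hb : Tendsto b atTop (𝓝 b')) (hc : Tendsto c atTop (𝓝 c'))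
    (hC : ∀ k, ∀ x ∈ Set.Ioo (-1 : ℝ) 1, hahnWeight q (a k) (b k) (c k) x ≤ C) :
    Tendsto (fun k => ∫ x, hahnWeight q (a k) (b k) (c k) x ∂measureT) atTop
      (𝓝 (∫ x, hahnWeight q a' b' c' x ∂measureT)) := by
  refine tendsto_integral_of_dominated_convergence (fun _ => C)
    (fun k => (aemeasurable_hahnWeight hq0 hq1 _ _ _).aestronglyMeasurable)
    (integrable_const C) (fun k => ?_) ?_
  · filter_upwards [ae_measureT_mem_Ioo] with x hx
    rw [Real.norm_of_nonneg (hahnWeight_nonneg hq0 hq1 _ _ _ (Set.Ioo_subset_Icc_self hx))]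
    exact hC k x hx
  · filter_upwards [ae_measureT_mem_Ioo] with x hx
    have hl := fun e => (continuous_qPochPairInf_left hq0 hq1 (Set.Ioo_subset_Icc_self hx)).tendsto e
    have hp := fun e => (qPochPairInf_pos hq0 hq1 e hx).ne'
    exact tendsto_const_nhds.div
      ((((hl a').comp ha).mul ((hl b').comp hb)).mul ((hl c').comp hc))
      (mul_ne_zero (mul_ne_zero (hp a') (hp b')) (hp c'))

/-- The bound must hold uniformly as |a| reaches 1. The first factor satisfies 1 - 2ax + a² ≥ 1 - x²
and cancels the numerator; what is left of the a-product has parameter aq, of modulus at most q. -/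
theorem exists_uniform_hahnWeight_le {r : ℝ} (hr : r < 1) :
    ∃ C, ∀ a b c, |a| ≤ 1 → |b| ≤ r → |c| ≤ r → ∀ x ∈ Set.Ioo (-1 : ℝ) 1,
      hahnWeight q a b c x ≤ C := by
  obtain ⟨C, hC⟩ := exists_qPochPairInf_double_le hq0 hq1
  obtain ⟨d, hd, hd'⟩ := exists_le_qPochPairInf hq0 hq1 hq1
  obtain ⟨e, he, he'⟩ := exists_le_qPochPairInf hq0 hq1 hr
  refine ⟨|C| / (d * e * e), fun a b c ha hb hc x hx => ?_⟩
  have hx' := Set.Ioo_subset_Icc_self hx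
  have h1 : 0 < 1 - x ^ 2 := by nlinarith [hx.1, hx.2]
  have h2 : 1 - x ^ 2 ≤ 1 - 2 * a * x + a ^ 2 := by nlinarith [sq_nonneg (a - x)]
  have h3 : (1 - x ^ 2) * (d * e * e) ≤
      qPochPairInf a x q * qPochPairInf b x q * qPochPairInf c x q := by
    rw [qPochPairInf_eq hq0 hq1 a, mul_assoc, mul_assoc, mul_assoc]
    have haq : |a * q| ≤ q := by
      rw [abs_mul, abs_of_pos hq0]
      exact mul_le_of_le_one_left hq0.le ha
    have k1 := hd' _ haq x hx'
    have k2 := he' _ hb x hx'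
    have k3 := he' _ hc x hx'
    gcongr
    all_goals linarith
  have hpos : 0 < (1 - x ^ 2) * (d * e * e) := by positivity
  unfold hahnWeight
  rw [div_le_div_iff₀ (hpos.trans_le h3) (by positivity)]
  calc qPochPairInf 1 (2 * x ^ 2 - 1) q * (d * e * e)
      ≤ (|C| * (1 - x ^ 2)) * (d * e * e) := by
        gcongr
        exact (hC x hx').trans (by gcongr; exact le_abs_self C)
    _ = |C| * ((1 - x ^ 2) * (d * e * e)) := by ring
    _ ≤ _ := by gcongr

/-! ### Total mass of the weight when all parameters have modulus below one. -/

theorem ofReal_hahnWeight_cos (a b c θ : ℝ) :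
    ((hahnWeight q a b c (Real.cos θ) : ℝ) : ℂ) =
      cqPochInf q (exp (θ * I) ^ 2) * cqPochInf q ((exp (θ * I))⁻¹ ^ 2) /
        ((cqPochInf q (a * exp (θ * I)) * cqPochInf q (a * (exp (θ * I))⁻¹)) *
          (cqPochInf q (b * exp (θ * I)) * cqPochInf q (b * (exp (θ * I))⁻¹)) *
          (cqPochInf q (c * exp (θ * I)) * cqPochInf q (c * (exp (θ * I))⁻¹))) := by
  have h1 : exp (θ * I) * (exp (θ * I))⁻¹ = 1 := mul_inv_cancel₀ (exp_ne_zero _)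
  have h2 : exp (θ * I) + (exp (θ * I))⁻¹ = 2 * (Real.cos θ : ℂ) := by
    rw [ofReal_cos, two_cos, ← exp_neg, neg_mul]
  have he := fun e => ofReal_qPochPairInf hq0 hq1 e (Real.cos θ) h1 h2
  have h0 := ofReal_qPochPairInf hq0 hq1 1 (2 * Real.cos θ ^ 2 - 1)
    (z := exp (θ * I) ^ 2) (w := (exp (θ * I))⁻¹ ^ 2) (by rw [← mul_pow, h1, one_pow]) (by
      push_cast
      linear_combination (exp (θ * I) + (exp (θ * I))⁻¹ + 2 * (cos θ : ℂ)) * (by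
        simpa using h2 : exp (θ * I) + (exp (θ * I))⁻¹ = 2 * (cos θ : ℂ)) - 2 * h1)
  unfold hahnWeight
  push_cast [he, h0]
  simp

theorem integral_hahnWeight_zero :
    ∫ x, hahnWeight q 0 0 0 x ∂measureT = 2 * Real.pi / qPochInf q q := by
  have h := integral_measureT_eq_circ (f := hahnWeight q 0 0 0)
    (g := fun z => cqPochInf q (z ^ 2) * cqPochInf q ((z⁻¹) ^ 2)) (fun z hz => by
      have hz0 : z ≠ 0 := norm_pos_iff.1 (by rw [hz]; exact one_pos)
      exact ((differentiableAt_cqPochInf_comp hq0 hq1 (by fun_prop)).mul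
        (differentiableAt_cqPochInf_comp hq0 hq1
          (by fun_prop (disch := assumption)))).continuousAt)
    (fun θ => by rw [ofReal_hahnWeight_cos hq0 hq1]; simp)
  rw [circ_hermite hq0 hq1] at h
  have h2 : ((∫ x, hahnWeight q 0 0 0 x ∂measureT : ℝ) : ℂ) =
      ((2 * Real.pi / qPochInf q q : ℝ) : ℂ) := by
    rw [h]
    push_cast
    ring
  exact_mod_cast h2

theorem integral_firstMoment {a b c : ℝ} (ha : |a| < 1) (hb : |b| < 1) (hc : |c| < 1) :
    ∫ x, (2 * x - (a + b + c) + a * b * c) * hahnWeight q a b c x ∂measureT = 0 := by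
  have h := integral_measureT_eq_circ
    (f := fun x => (2 * x - (a + b + c) + a * b * c) * hahnWeight q a b c x)
    (g := fun z => (z + z⁻¹ - (a + b + c) + a * b * c) *
      (cqPochInf q (z ^ 2) * cqPochInf q ((z⁻¹) ^ 2) /
        ((cqPochInf q (a * z) * cqPochInf q (a * z⁻¹)) *
          (cqPochInf q (b * z) * cqPochInf q (b * z⁻¹)) *
          (cqPochInf q (c * z) * cqPochInf q (c * z⁻¹))))) (fun z hz => by
      have hz0 : z ≠ 0 := norm_pos_iff.1 (by rw [hz]; exact one_pos)
      have hz' : ‖z⁻¹‖ ≤ 1 := by rw [norm_inv, hz]; simp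
      have hd : ∀ e : ℝ, DifferentiableAt ℂ
          (fun z => cqPochInf q (e * z) * cqPochInf q (e * z⁻¹)) z := fun e =>
        (differentiableAt_cqPochInf_comp hq0 hq1 (by fun_prop)).mul
          (differentiableAt_cqPochInf_comp hq0 hq1 (by fun_prop (disch := assumption)))
      have hn : ∀ e : ℝ, |e| < 1 → cqPochInf q (e * z) * cqPochInf q (e * z⁻¹) ≠ 0 :=
        fun e he => mul_ne_zero
          (cqPochInf_ne_zero_of_norm_lt hq0 hq1 (norm_real_mul_lt_one he hz.le))
          (cqPochInf_ne_zero_of_norm_lt hq0 hq1 (norm_real_mul_lt_one he hz'))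
      refine (DifferentiableAt.mul (by fun_prop (disch := assumption)) (DifferentiableAt.div
        ((differentiableAt_cqPochInf_comp hq0 hq1 (by fun_prop)).mul
          (differentiableAt_cqPochInf_comp hq0 hq1 (by fun_prop (disch := assumption))))
        (((hd a).mul (hd b)).mul (hd c))
        (mul_ne_zero (mul_ne_zero (hn a ha) (hn b hb)) (hn c hc)))).continuousAt)
    (fun θ => by
      have h2 : exp (θ * I) + (exp (θ * I))⁻¹ = 2 * (Real.cos θ : ℂ) := by
        rw [ofReal_cos, two_cos, ← exp_neg, neg_mul]
      rw [ofReal_mul, ofReal_hahnWeight_cos hq0 hq1, h2]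
      push_cast
      rfl)
  rw [circ_firstMoment hq0 hq1 ha hb hc, zero_div] at h
  exact_mod_cast h

omit hq0 hq1 in
theorem mul_lt_one_of_abs_lt {a b : ℝ} (ha : |a| < 1) (hb : |b| < 1) : a * b < 1 :=
  calc a * b ≤ |a * b| := le_abs_self _
    _ = |a| * |b| := abs_mul a b
    _ < 1 := by nlinarith [abs_nonneg a, abs_nonneg b]

/-- The factor 1 - 2ax + a² equals -a(2x - (a+b+c) + abc) + (1-ab)(1-ac), and the first summand
integrates to zero by `integral_firstMoment`. -/
theorem integral_hahnWeight_shift {a b c : ℝ} (ha : |a| < 1) (hb : |b| < 1) (hc : |c| < 1) :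
    ∫ x, hahnWeight q (a * q) b c x ∂measureT =
      (1 - a * b) * (1 - a * c) * ∫ x, hahnWeight q a b c x ∂measureT := by
  have hi := fun f hf => integrable_mul_hahnWeight hq0 hq1 (mul_lt_one_of_abs_lt ha hb)
    (mul_lt_one_of_abs_lt ha hc) (mul_lt_one_of_abs_lt hb hc) (f := f) hf
  have h0 := integral_firstMoment hq0 hq1 ha hb hc
  have h1 : ∫ x, hahnWeight q (a * q) b c x ∂measureT =
      ∫ x, (-a) * ((2 * x - (a + b + c) + a * b * c) * hahnWeight q a b c x) +
        ((1 - a * b) * (1 - a * c)) * (1 * hahnWeight q a b c x) ∂measureT := by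
    refine integral_congr_ae ?_
    filter_upwards [ae_measureT_mem_Ioo] with x hx
    rw [← mul_hahnWeight hq0 hq1 a b c hx]
    ring
  rw [h1, integral_add ((hi _ (by fun_prop)).const_mul _)
    ((hi (fun _ => 1) (by fun_prop)).const_mul _), integral_const_mul, integral_const_mul, h0]
  simp

/-- The left side, called N, is unchanged when one parameter is multiplied by q. Iterating in all
three parameters and passing to the limit identifies it with its value at a = b = c = 0, the
q-Hermite integral. -/
theorem integral_hahnWeight_of_abs_lt {a b c : ℝ} (ha : |a| < 1) (hb : |b| < 1) (hc : |c| < 1) :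
    qPochInf (a * b) q * qPochInf (a * c) q * qPochInf (b * c) q *
      ∫ x, hahnWeight q a b c x ∂measureT = 2 * Real.pi / qPochInf q q := by
  set N : ℝ → ℝ → ℝ → ℝ := fun a b c => qPochInf (a * b) q * qPochInf (a * c) q *
    qPochInf (b * c) q * ∫ x, hahnWeight q a b c x ∂measureT with hN
  have hqa : ∀ e : ℝ, |e| < 1 → |e * q| < 1 := fun e he => by
    rw [abs_mul, abs_of_pos hq0]
    nlinarith [abs_nonneg e]
  have s1 : ∀ a b c : ℝ, |a| < 1 → |b| < 1 → |c| < 1 → N (a * q) b c = N a b c := by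
    intro a b c ha hb hc
    simp only [hN]
    rw [integral_hahnWeight_shift hq0 hq1 ha hb hc, qPochInf_eq hq0 hq1 (a * b),
      qPochInf_eq hq0 hq1 (a * c), mul_right_comm a q b, mul_right_comm a q c]
    ring
  have p1 : ∀ a b c, N a b c = N b a c := fun a b c => by
    simp only [hN, hahnWeight_swap a b c]
    rw [mul_comm a b]
    ring
  have p2 : ∀ a b c, N a b c = N a c b := fun a b c => by
    simp only [hN, hahnWeight_swap_right a b c]
    rw [mul_comm b c]
    ring
  have step : ∀ a b c : ℝ, |a| < 1 → |b| < 1 → |c| < 1 →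
      N (a * q) (b * q) (c * q) = N a b c := by
    intro a b c ha hb hc
    rw [s1 _ _ _ ha (hqa b hb) (hqa c hc), p1, s1 _ _ _ hb ha (hqa c hc), p1, p2, p1,
      s1 _ _ _ hc ha hb, p1, p2]
  have hk : ∀ k : ℕ, N (a * q ^ k) (b * q ^ k) (c * q ^ k) = N a b c ∧
      |a * q ^ k| < 1 ∧ |b * q ^ k| < 1 ∧ |c * q ^ k| < 1 := by
    intro k
    induction k with
    | zero => simp [ha, hb, hc]
    | succ k ih =>
      obtain ⟨h, h1, h2, h3⟩ := ih
      simp only [pow_succ, ← mul_assoc]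
      exact ⟨by rw [step _ _ _ h1 h2 h3, h], hqa _ h1, hqa _ h2, hqa _ h3⟩
  have ht : ∀ e : ℝ, Tendsto (fun k : ℕ => e * q ^ k) atTop (𝓝 0) := fun e => by
    simpa using (tendsto_pow_atTop_nhds_zero_of_lt_one hq0.le hq1).const_mul e
  have hle : ∀ (e : ℝ) (k : ℕ), |e * q ^ k| ≤ |e| := fun e k => by
    rw [abs_mul, abs_of_pos (pow_pos hq0 k)]
    exact mul_le_of_le_one_right (abs_nonneg e) (pow_le_one₀ hq0.le hq1.le)
  obtain ⟨C, hC⟩ := exists_uniform_hahnWeight_le hq0 hq1 (max_lt hb hc)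
  have hJ := tendsto_integral_hahnWeight hq0 hq1 (ht a) (ht b) (ht c) (C := C) fun k =>
    hC _ _ _ ((hle a k).trans ha.le) ((hle b k).trans (le_max_left _ _))
      ((hle c k).trans (le_max_right _ _))
  have hE : ∀ e f : ℝ, Tendsto (fun k : ℕ => qPochInf (e * q ^ k * (f * q ^ k)) q) atTop
      (𝓝 1) := fun e f => by
    have := ((continuous_qPochInf hq0 hq1).tendsto (0 * 0)).comp ((ht e).mul (ht f))
    simpa [Function.comp_def] using this
  have hlim := ((((hE a b).mul (hE a c)).mul (hE b c)).mul hJ)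
  rw [integral_hahnWeight_zero hq0 hq1] at hlim
  have hconst : Tendsto (fun k : ℕ => N (a * q ^ k) (b * q ^ k) (c * q ^ k)) atTop
      (𝓝 (N a b c)) := by
    simp only [(hk _).1]
    exact tendsto_const_nhds
  have := tendsto_nhds_unique hconst hlim
  simpa [hN] using this

end

end QSpecial

end

/-! ### The functional with point masses and its behaviour under a ↦ aq. -/

noncomputable section

namespace QSpecial

open Filter Topology Polynomial.Chebyshev

/-- The `k`-th mass point attached to the parameter `a`. -/
def massPoint (q a : ℝ) (k : ℕ) : ℝ := (a * q ^ k + (a * q ^ k)⁻¹) / 2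

/-- The factor of the `k`-th point mass attached to `a` that does not depend on the other
parameters. -/
def massFactor (q a : ℝ) (k : ℕ) : ℝ :=
  qPochInf (a ^ 2)⁻¹ q / qPochInf q q * ((1 - a ^ 2 * q ^ (2 * k)) / (1 - a ^ 2)) *
    (qPoch (a ^ 2) q k / (qPoch q q k * (∏ i ∈ Finset.range k, -(a * q ^ (i + 1))) ^ 3)) *
    (q / a) ^ k

/-- The terms of the discrete part attached to `a`. -/
def massTerm (q : ℝ) (f : ℝ → ℝ) (a b c : ℝ) (k : ℕ) : ℝ :=
  if 1 < |a * q ^ k| then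
    massFactor q a k * f (massPoint q a k) /
      (qPochPairInf b (massPoint q a k) q * qPochPairInf c (massPoint q a k) q)
  else 0

/-- The discrete part attached to `a` of the integral of `f`. -/
def massSum (q : ℝ) (f : ℝ → ℝ) (a b c : ℝ) : ℝ := ∑' k, massTerm q f a b c k

/-- The integral of `f` against the orthogonality measure of the continuous dual `q`-Hahn
polynomials. -/
def hahnIntegral (q : ℝ) (f : ℝ → ℝ) (a b c : ℝ) : ℝ :=
  (2 * Real.pi)⁻¹ * (∫ x, f x * hahnWeight q a b c x ∂measureT) +
    (massSum q f a b c + massSum q f b a c + massSum q f c a b)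

theorem massSum_swap (q : ℝ) (f : ℝ → ℝ) (a b c : ℝ) :
    massSum q f a b c = massSum q f a c b := by
  unfold massSum massTerm
  simp only [mul_comm (qPochPairInf b _ q)]

theorem hahnIntegral_swap (q : ℝ) (f : ℝ → ℝ) (a b c : ℝ) :
    hahnIntegral q f a b c = hahnIntegral q f b a c := by
  unfold hahnIntegral
  simp only [hahnWeight_swap a b c]
  rw [massSum_swap q f c a b]
  ring

theorem hahnIntegral_swap_right (q : ℝ) (f : ℝ → ℝ) (a b c : ℝ) :
    hahnIntegral q f a b c = hahnIntegral q f a c b := by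
  unfold hahnIntegral
  simp only [hahnWeight_swap_right a b c]
  rw [massSum_swap q f a b c]
  ring

/-- The range of parameters for which the orthogonality measure is positive. -/
structure HahnParams (a b c : ℝ) : Prop where
  ab : a * b < 1
  ac : a * c < 1
  bc : b * c < 1

theorem HahnParams.swap {a b c : ℝ} (h : HahnParams a b c) : HahnParams b a c :=
  ⟨by rw [mul_comm]; exact h.ab, h.bc, h.ac⟩

theorem HahnParams.swap_right {a b c : ℝ} (h : HahnParams a b c) : HahnParams a c b :=
  ⟨h.ac, h.ab, by rw [mul_comm]; exact h.bc⟩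

section

variable {q : ℝ} (hq0 : 0 < q) (hq1 : q < 1)

include hq0 hq1

theorem HahnParams.shift {a b c : ℝ} (h : HahnParams a b c) : HahnParams (a * q) b c := by
  have h1 := mul_pow_lt_one hq1 hq0.le h.ab 1
  have h2 := mul_pow_lt_one hq1 hq0.le h.ac 1
  exact ⟨by rwa [mul_right_comm, ← pow_one q], by rwa [mul_right_comm, ← pow_one q], h.bc⟩

theorem finite_massPoints (a : ℝ) : {k : ℕ | 1 < |a * q ^ k|}.Finite := by
  have h : Tendsto (fun k : ℕ => |a * q ^ k|) atTop (𝓝 |a * 0|) :=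
    ((tendsto_pow_atTop_nhds_zero_of_lt_one hq0.le hq1).const_mul a).abs
  simp only [mul_zero, abs_zero] at h
  obtain ⟨N, hN⟩ := eventually_atTop.1 (h.eventually_lt_const one_pos)
  refine (Set.finite_lt_nat N).subset fun k hk => ?_
  by_contra hcon
  exact absurd (hN k (not_lt.1 hcon)) (not_lt.2 (le_of_lt hk))

theorem summable_massTerm (f : ℝ → ℝ) (a b c : ℝ) : Summable (massTerm q f a b c) := by
  refine summable_of_hasFiniteSupport ((finite_massPoints hq0 hq1 a).subset fun k hk => ?_)
  by_contra hcon
  exact hk (if_neg hcon)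

theorem massSum_eq_zero {a : ℝ} (ha : |a| ≤ 1) (f : ℝ → ℝ) (b c : ℝ) :
    massSum q f a b c = 0 := by
  unfold massSum
  convert tsum_zero with k
  refine if_neg (not_lt.2 ?_)
  rw [abs_mul, abs_of_pos (pow_pos hq0 k)]
  exact mul_le_one₀ ha (pow_nonneg hq0.le k) (pow_le_one₀ hq0.le hq1.le)

omit hq0 hq1 in
theorem ne_zero_of_one_lt_abs {A : ℝ} (h : 1 < |A|) : A ≠ 0 := fun h0 => by
  rw [h0, abs_zero] at h
  linarith

omit hq0 hq1 in
theorem div_lt_one_of_mul_lt_one {A b : ℝ} (hA : 1 < |A|) (h : b * A < 1) : b / A < 1 := by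
  have hA2 : 1 < A ^ 2 := by rw [← sq_abs]; nlinarith
  by_contra! hcon
  have h1 : b * A = b / A * A ^ 2 := by field_simp [ne_zero_of_one_lt_abs hA]
  nlinarith

/-- A mass point of one parameter is not a zero of the weight factor of another parameter. -/
theorem mass_denominators {a b : ℝ} (hab : a * b < 1) {k : ℕ} (hk : 1 < |a * q ^ k|) :
    b * (a * q ^ k) < 1 ∧ b / (a * q ^ k) < 1 := by
  have h1 : b * (a * q ^ k) < 1 := by
    have := mul_pow_lt_one hq1 hq0.le hab k
    rwa [show b * (a * q ^ k) = a * b * q ^ k by ring]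
  exact ⟨h1, div_lt_one_of_mul_lt_one hk h1⟩

theorem qPochPairInf_massPoint_pos {a b : ℝ} (hab : a * b < 1) {k : ℕ} (hk : 1 < |a * q ^ k|) :
    0 < qPochPairInf b (massPoint q a k) q := by
  rw [massPoint, qPochPairInf_eq_mul hq0 hq1 b (ne_zero_of_one_lt_abs hk)]
  obtain ⟨h1, h2⟩ := mass_denominators hq0 hq1 hab hk
  exact mul_pos (qPochInf_pos hq0 hq1 h1) (qPochInf_pos hq0 hq1 h2)

omit hq0 hq1 in
theorem factor_massPoint (b : ℝ) {a : ℝ} {k : ℕ} (hk : a * q ^ k ≠ 0) :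
    1 - 2 * b * massPoint q a k + b ^ 2 = (1 - b * (a * q ^ k)) * (1 - b / (a * q ^ k)) := by
  rw [massPoint]
  generalize a * q ^ k = A at hk
  field_simp
  ring

theorem massTerm_mul_factor_other {a b c : ℝ} (hab : a * b < 1) (f : ℝ → ℝ) (k : ℕ) :
    massTerm q (fun x => f x * (1 - 2 * b * x + b ^ 2)) a b c k =
      massTerm q f a (b * q) c k := by
  unfold massTerm
  split_ifs with hk
  · have h0 : 1 - 2 * b * massPoint q a k + b ^ 2 ≠ 0 := by
      rw [factor_massPoint b (ne_zero_of_one_lt_abs hk)]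
      obtain ⟨h1, h2⟩ := mass_denominators hq0 hq1 hab hk
      exact mul_ne_zero (by linarith) (by linarith)
    have h1 := (qPochPairInf_massPoint_pos hq0 hq1 hab hk).ne'
    rw [qPochPairInf_eq hq0 hq1 b] at h1 ⊢
    have h2 := right_ne_zero_of_mul h1
    rw [mul_assoc (1 - 2 * b * massPoint q a k + b ^ 2), ← mul_assoc (massFactor q a k),
      mul_comm (massFactor q a k * f _), mul_div_mul_left _ _ h0]
  · rfl

theorem qPoch_self_pos (k : ℕ) : 0 < qPoch q q k :=
  Finset.prod_pos fun i _ => by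
    have := mul_pow_lt_one hq1 hq0.le hq1 i
    linarith

theorem one_lt_abs_of_mul_pow {a : ℝ} {k : ℕ} (hk : 1 < |a * q ^ k|) {i : ℕ} (hi : i ≤ k) :
    1 < |a * q ^ i| := by
  refine hk.trans_le ?_
  rw [abs_mul, abs_mul, abs_of_pos (pow_pos hq0 k), abs_of_pos (pow_pos hq0 i)]
  exact mul_le_mul_of_nonneg_left (pow_le_pow_of_le_one hq0.le hq1.le hi) (abs_nonneg a)

omit hq0 hq1 in
theorem qPoch_succ (a : ℝ) (k : ℕ) : qPoch a q (k + 1) = qPoch a q k * (1 - a * q ^ k) :=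
  Finset.prod_range_succ _ _

omit hq0 hq1 in
theorem qPoch_succ' (a : ℝ) (k : ℕ) : qPoch a q (k + 1) = (1 - a) * qPoch (a * q) q k := by
  rw [qPoch, qPoch, Finset.prod_range_succ', mul_comm, pow_zero, mul_one]
  congr 1
  exact Finset.prod_congr rfl fun i _ => by ring

/-- The mass points of aq are those of a with the first one removed. At the remaining points
multiplication by 1 - 2ax + a² turns the masses of a into those of aq. -/
theorem massFactor_succ {a : ℝ} {k : ℕ} (hk : 1 < |a * q ^ (k + 1)|) :
    massFactor q a (k + 1) * (1 - 2 * a * massPoint q a (k + 1) + a ^ 2) =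
      massFactor q (a * q) k := by
  have hA := ne_zero_of_one_lt_abs hk
  have ha1 : 1 < |a| := by
    simpa using one_lt_abs_of_mul_pow hq0 hq1 hk (i := 0) (Nat.zero_le _)
  have ha2 : 1 < |a * q| := by
    simpa using one_lt_abs_of_mul_pow hq0 hq1 hk (i := 1) (by omega)
  have ha0 : a ≠ 0 := ne_zero_of_one_lt_abs ha1
  have n1 : 1 - a ^ 2 ≠ 0 := by
    have : 1 < a ^ 2 := by rw [← sq_abs]; nlinarith
    linarith
  have n2 : 1 - a ^ 2 * q ^ 2 ≠ 0 := by
    have : 1 < (a * q) ^ 2 := by rw [← sq_abs]; nlinarith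
    nlinarith
  have n3 : 1 - q * q ^ k ≠ 0 := by
    have := mul_pow_lt_one hq1 hq0.le hq1 k
    linarith
  have hE : qPochInf ((a * q) ^ 2)⁻¹ q =
      (1 - ((a * q) ^ 2)⁻¹) * ((1 - ((a * q) ^ 2)⁻¹ * q) * qPochInf (a ^ 2)⁻¹ q) := by
    rw [qPochInf_eq hq0 hq1, qPochInf_eq hq0 hq1 (((a * q) ^ 2)⁻¹ * q)]
    congr 4
    field_simp
  have hP : qPoch (a ^ 2) q (k + 1) * (1 - a ^ 2 * q ^ (k + 1)) =
      (1 - a ^ 2) * ((1 - a ^ 2 * q) * qPoch ((a * q) ^ 2) q k) := by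
    rw [← qPoch_succ, qPoch_succ', qPoch_succ', show a ^ 2 * q * q = (a * q) ^ 2 by ring]
  have hprod : ∏ i ∈ Finset.range (k + 1), -(a * q ^ (i + 1)) =
      (∏ i ∈ Finset.range k, -(a * q * q ^ (i + 1))) * -(a * q) := by
    rw [Finset.prod_range_succ']
    simp only [zero_add, pow_one]
    congr 1
    exact Finset.prod_congr rfl fun i _ => by ring
  have hprod0 : ∏ i ∈ Finset.range k, -(a * q * q ^ (i + 1)) ≠ 0 :=
    Finset.prod_ne_zero_iff.2 fun i _ => neg_ne_zero.2 (by
      have := hq0.ne'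
      positivity)
  have hqq := (qPoch_self_pos hq0 hq1 k).ne'
  have hEq := qPochInf_ne_zero_of_lt hq0 hq1 hq1
  have hq := hq0.ne'
  rw [factor_massPoint a hA]
  unfold massFactor
  rw [hE, hprod, qPoch_succ q k]
  generalize (∏ i ∈ Finset.range k, -(a * q * q ^ (i + 1))) = D at *
  have e1 : (1 - a * (a * q ^ (k + 1))) * (1 - a / (a * q ^ (k + 1))) =
      (1 - a ^ 2 * q ^ (k + 1)) * (-(1 - q * q ^ k) / (q * q ^ k)) := by
    field_simp
    ring
  rw [e1]
  have e2 : ∀ u v w : ℝ, u * (qPoch (a ^ 2) q (k + 1) / v) * w *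
      ((1 - a ^ 2 * q ^ (k + 1)) * (-(1 - q * q ^ k) / (q * q ^ k))) =
      (1 - a ^ 2) * ((1 - a ^ 2 * q) * qPoch ((a * q) ^ 2) q k) *
      (u / v * w * (-(1 - q * q ^ k) / (q * q ^ k))) := by
    intro u v w
    rw [← hP]
    ring
  rw [e2]
  generalize qPoch ((a * q) ^ 2) q k = X
  generalize qPochInf (a ^ 2)⁻¹ q = Y
  generalize qPochInf q q = Z at *
  generalize qPoch q q k = V at *
  have n2' : 1 - (a * q) ^ 2 ≠ 0 := by rwa [mul_pow]
  rw [show q / (a * q) = 1 / a by field_simp, div_pow, div_pow, one_pow]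
  field_simp
  ring

theorem massSum_mul_factor_self {a b c : ℝ} (f : ℝ → ℝ) :
    massSum q (fun x => f x * (1 - 2 * a * x + a ^ 2)) a b c = massSum q f (a * q) b c := by
  unfold massSum
  rw [(summable_massTerm hq0 hq1 _ a b c).tsum_eq_zero_add]
  -- The factor 1 - 2ax + a² vanishes at the first mass point x = (a + 1/a)/2.
  have h0 : massTerm q (fun x => f x * (1 - 2 * a * x + a ^ 2)) a b c 0 = 0 := by
    unfold massTerm
    split_ifs with hk
    · have hA := ne_zero_of_one_lt_abs hk
      beta_reduce
      rw [factor_massPoint a hA]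
      simp only [pow_zero, mul_one] at hA ⊢
      rw [div_self hA]
      simp
    · rfl
  rw [h0, zero_add]
  congr 1
  ext k
  unfold massTerm
  have hp : a * q * q ^ k = a * q ^ (k + 1) := by ring
  have hp' : massPoint q (a * q) k = massPoint q a (k + 1) := by
    rw [massPoint, massPoint, hp]
  rw [hp, hp']
  split_ifs with hk
  · rw [← massFactor_succ hq0 hq1 hk]
    ring
  · rfl

/-- Multiplying by the first factor for `a` shifts `a` to `a q`. -/
theorem hahnIntegral_mul_factor {a b c : ℝ} (h : HahnParams a b c) (f : ℝ → ℝ) :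
    hahnIntegral q (fun x => f x * (1 - 2 * a * x + a ^ 2)) a b c =
      hahnIntegral q f (a * q) b c := by
  unfold hahnIntegral
  rw [massSum_mul_factor_self hq0 hq1]
  congr 1
  · congr 1
    refine integral_congr_ae ?_
    filter_upwards [ae_measureT_mem_Ioo] with x hx
    rw [mul_assoc, mul_hahnWeight hq0 hq1 a b c hx]
  · congr 1
    · congr 1
      exact tsum_congr fun k =>
        massTerm_mul_factor_other hq0 hq1 (by rw [mul_comm]; exact h.ab) f k
    · exact tsum_congr fun k =>
        massTerm_mul_factor_other hq0 hq1 (by rw [mul_comm]; exact h.ac) f k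

theorem hahnIntegral_add {a b c : ℝ} (h : HahnParams a b c) {f g : ℝ → ℝ} (hf : Continuous f)
    (hg : Continuous g) :
    hahnIntegral q (fun x => f x + g x) a b c = hahnIntegral q f a b c + hahnIntegral q g a b c := by
  have hm : ∀ a b c, massSum q (fun x => f x + g x) a b c =
      massSum q f a b c + massSum q g a b c := by
    intro a b c
    unfold massSum
    rw [← (summable_massTerm hq0 hq1 f a b c).tsum_add (summable_massTerm hq0 hq1 g a b c)]
    refine tsum_congr fun k => ?_
    unfold massTerm
    split_ifs
    · ring
    · simp
  unfold hahnIntegral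
  simp only [hm, add_mul]
  rw [integral_add (integrable_mul_hahnWeight hq0 hq1 h.ab h.ac h.bc hf)
    (integrable_mul_hahnWeight hq0 hq1 h.ab h.ac h.bc hg)]
  ring

omit hq0 hq1 in
theorem hahnIntegral_const_mul (r : ℝ) (f : ℝ → ℝ) (a b c : ℝ) :
    hahnIntegral q (fun x => r * f x) a b c = r * hahnIntegral q f a b c := by
  have hm : ∀ a b c, massSum q (fun x => r * f x) a b c = r * massSum q f a b c := by
    intro a b c
    unfold massSum
    rw [← tsum_mul_left]
    refine tsum_congr fun k => ?_
    unfold massTerm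
    split_ifs
    · ring
    · simp
  unfold hahnIntegral
  simp only [hm, mul_assoc]
  rw [integral_const_mul]
  ring

/-- The total masses for parameters shifted in `a` and in `b` determine the total mass. -/
theorem hahnIntegral_contiguous {a b c : ℝ} (h : HahnParams a b c) :
    (b - a) * (1 - a * b) * hahnIntegral q (fun _ => 1) a b c =
      b * hahnIntegral q (fun _ => 1) (a * q) b c - a * hahnIntegral q (fun _ => 1) a (b * q) c := by
  have h1 := hahnIntegral_mul_factor hq0 hq1 h (fun _ => 1)
  have h2 := hahnIntegral_mul_factor hq0 hq1 h.swap (fun _ => 1)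
  rw [hahnIntegral_swap _ _ b a c, hahnIntegral_swap _ _ (b * q) a c] at h2
  rw [← h1, ← h2, sub_eq_add_neg (b * _), ← neg_mul, ← hahnIntegral_const_mul, ← hahnIntegral_const_mul,
    ← hahnIntegral_const_mul, ← hahnIntegral_add hq0 hq1 h (by fun_prop) (by fun_prop)]
  -- The variable drops out: b(1 - 2ax + a²) - a(1 - 2bx + b²) = (b - a)(1 - ab).
  congr 1
  ext x
  ring

end

end QSpecial

end

/-! ### Total mass for all parameters with pairwise products below one. -/

noncomputable section

namespace QSpecial

open Filter Topology Polynomial.Chebyshev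

/-- The total mass of the orthogonality measure, multiplied by `(ab, ac, bc;q)_∞`. -/
def scaledMass (q a b c : ℝ) : ℝ :=
  qPochInf (a * b) q * qPochInf (a * c) q * qPochInf (b * c) q *
    hahnIntegral q (fun _ => 1) a b c

theorem scaledMass_swap (q a b c : ℝ) : scaledMass q a b c = scaledMass q b a c := by
  unfold scaledMass
  rw [hahnIntegral_swap, mul_comm a b]
  ring

theorem scaledMass_swap_right (q a b c : ℝ) : scaledMass q a b c = scaledMass q a c b := by
  unfold scaledMass
  rw [hahnIntegral_swap_right, mul_comm b c]
  ring

section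

variable {q : ℝ} (hq0 : 0 < q) (hq1 : q < 1)

include hq0 hq1

theorem scaledMass_of_abs_lt {a b c : ℝ} (ha : |a| < 1) (hb : |b| < 1) (hc : |c| < 1) :
    scaledMass q a b c = 1 / qPochInf q q := by
  have h := integral_hahnWeight_of_abs_lt hq0 hq1 ha hb hc
  unfold scaledMass hahnIntegral
  rw [massSum_eq_zero hq0 hq1 ha.le, massSum_eq_zero hq0 hq1 hb.le, massSum_eq_zero hq0 hq1 hc.le]
  simp only [one_mul, add_zero]
  rw [← mul_assoc, mul_right_comm, h]
  have := Real.pi_ne_zero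
  have := qPochInf_ne_zero_of_lt hq0 hq1 hq1
  field_simp

/-- Written for the deviation from the expected value 1/(q;q)_∞, the relation
`hahnIntegral_contiguous` becomes homogeneous as soon as the mass at aq is known. -/
theorem scaledMass_contiguous {a b c : ℝ} (ha : 1 ≤ |a|) (h : HahnParams a b c)
    (hs : scaledMass q (a * q) b c = 1 / qPochInf q q) :
    (1 - b / a) * (scaledMass q a b c - 1 / qPochInf q q) =
      (1 - b * c) * (scaledMass q a (b * q) c - 1 / qPochInf q q) := by
  have ha0 : a ≠ 0 := fun h0 => by rw [h0, abs_zero] at ha; linarith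
  have hc := hahnIntegral_contiguous hq0 hq1 h
  unfold scaledMass at *
  rw [qPochInf_eq hq0 hq1 (b * c), qPochInf_eq hq0 hq1 (a * b),
    qPochInf_eq hq0 hq1 (a * c)]
  rw [mul_right_comm a q b, mul_right_comm a q c, qPochInf_eq hq0 hq1 (b * c)] at hs
  rw [← mul_assoc a b q, mul_right_comm b q c]
  rw [← hs]
  generalize hahnIntegral q (fun _ => 1) a b c = X at *
  generalize hahnIntegral q (fun _ => 1) (a * q) b c = Y at *
  generalize hahnIntegral q (fun _ => 1) a (b * q) c = Z at *
  generalize qPochInf (a * b * q) q = E1 at *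
  generalize qPochInf (a * c * q) q = E2 at *
  generalize qPochInf (b * c * q) q = E3 at *
  field_simp
  linear_combination (-(1 - a * c) * E1 * E2 * (1 - b * c) * E3) * hc

theorem scaledMass_of_shift {a b c : ℝ} (ha : 1 ≤ |a|) (h : HahnParams a b c)
    (hs : scaledMass q (a * q) b c = 1 / qPochInf q q)
    (hb : scaledMass q a (b * q) c = 1 / qPochInf q q) :
    scaledMass q a b c = 1 / qPochInf q q := by
  have ha0 : a ≠ 0 := fun h0 => by rw [h0, abs_zero] at ha; linarith
  have h1 := scaledMass_contiguous hq0 hq1 ha h hs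
  rw [hb, sub_self, mul_zero] at h1
  -- If b = a, then ab < 1 would force a² < 1, against |a| ≥ 1.
  have h2 : 1 - b / a ≠ 0 := by
    intro h0
    have h3 : b = a := by
      field_simp at h0
      linarith
    have h4 := h.ab
    rw [h3, ← sq, ← sq_abs] at h4
    nlinarith
  have := (mul_eq_zero.1 h1).resolve_left h2
  linarith

/-- Here a is arbitrary. The weight for (a,0,0) is bounded, and the products belonging to b and c
are bounded below uniformly because their moduli are at most r < 1. -/
theorem tendsto_integral_hahnWeight_fixed (a : ℝ) {b c : ℕ → ℝ} {b' c' r : ℝ} (hr : r < 1)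
    (hb : Tendsto b atTop (𝓝 b')) (hc : Tendsto c atTop (𝓝 c')) (hbr : ∀ k, |b k| ≤ r)
    (hcr : ∀ k, |c k| ≤ r) :
    Tendsto (fun k => ∫ x, hahnWeight q a (b k) (c k) x ∂measureT) atTop
      (𝓝 (∫ x, hahnWeight q a b' c' x ∂measureT)) := by
  obtain ⟨C, hC⟩ := exists_hahnWeight_le hq0 hq1 (a := a) (b := 0) (c := 0) (by simp) (by simp)
    (by simp)
  obtain ⟨d, hd, hd'⟩ := exists_le_qPochPairInf hq0 hq1 hr
  refine tendsto_integral_hahnWeight hq0 hq1 tendsto_const_nhds hb hc (C := |C| / (d * d))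
    fun k x hx => ?_
  have hx' := Set.Ioo_subset_Icc_self hx
  have h1 : hahnWeight q a (b k) (c k) x =
      hahnWeight q a 0 0 x / (qPochPairInf (b k) x q * qPochPairInf (c k) x q) := by
    simp only [hahnWeight, qPochPairInf_zero, mul_one, mul_assoc, div_div]
  rw [h1]
  have k1 := hd' _ (hbr k) x hx'
  have k2 := hd' _ (hcr k) x hx'
  exact div_le_div₀ (abs_nonneg C) ((hC x hx).trans (le_abs_self C)) (by positivity)
    (mul_le_mul k1 k2 hd.le (hd.le.trans k1))

theorem massSum_eq_sum (f : ℝ → ℝ) (a b c : ℝ) :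
    massSum q f a b c =
      ∑ k ∈ (finite_massPoints hq0 hq1 a).toFinset, massTerm q f a b c k := by
  unfold massSum
  refine tsum_eq_sum fun k hk => if_neg ?_
  simpa using hk

theorem continuous_qPochPairInf_massPoint {A : ℝ} (hA : A ≠ 0) :
    Continuous fun b => qPochPairInf b ((A + A⁻¹) / 2) q := by
  simp only [qPochPairInf_eq_mul hq0 hq1 _ hA]
  have h := continuous_qPochInf hq0 hq1
  exact (h.comp (continuous_mul_const A)).mul (h.comp (continuous_id.div_const A))

theorem tendsto_hahnIntegral_zero (a : ℝ) {b c : ℕ → ℝ} {r : ℝ} (hr : r < 1)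
    (hb : Tendsto b atTop (𝓝 0)) (hc : Tendsto c atTop (𝓝 0)) (hbr : ∀ k, |b k| ≤ r)
    (hcr : ∀ k, |c k| ≤ r) :
    Tendsto (fun k => hahnIntegral q (fun _ => 1) a (b k) (c k)) atTop
      (𝓝 (hahnIntegral q (fun _ => 1) a 0 0)) := by
  have h0 : |(0 : ℝ)| ≤ 1 := by simp
  unfold hahnIntegral
  simp only [massSum_eq_zero hq0 hq1 h0, massSum_eq_zero hq0 hq1 ((hbr _).trans hr.le),
    massSum_eq_zero hq0 hq1 ((hcr _).trans hr.le), add_zero, one_mul]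
  refine ((tendsto_integral_hahnWeight_fixed hq0 hq1 a hr hb hc hbr hcr).const_mul _).add ?_
  simp only [massSum_eq_sum hq0 hq1]
  refine tendsto_finsetSum _ fun k hk => ?_
  have hk' : 1 < |a * q ^ k| := by simpa using hk
  unfold massTerm
  simp only [if_pos hk']
  have hcont := continuous_qPochPairInf_massPoint hq0 hq1 (ne_zero_of_one_lt_abs hk')
  refine tendsto_const_nhds.div
    (((hcont.tendsto 0).comp hb).mul ((hcont.tendsto 0).comp hc)) ?_
  simp

/-- As `b` tends to `1 / a`, only the first point mass attached to `a` survives. -/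
theorem tendsto_scaledMass_inv {a : ℝ} (ha : 1 < |a|) {b : ℕ → ℝ}
    (hb : Tendsto b atTop (𝓝 a⁻¹)) (hbr : ∀ k, |b k| ≤ |a|⁻¹) (hab : ∀ k, a * b k < 1) :
    Tendsto (fun k => scaledMass q a (b k) 0) atTop (𝓝 (1 / qPochInf q q)) := by
  have ha0 := ne_zero_of_one_lt_abs ha
  have h0 : |(0 : ℝ)| ≤ 1 := by simp
  have hr : |a|⁻¹ < 1 := inv_lt_one_of_one_lt₀ ha
  have hcE := continuous_qPochInf hq0 hq1
  -- The prefactor (ab;q)_∞ tends to (1;q)_∞ = 0, which removes the continuous part, whose integral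
  -- converges.
  have hEab : Tendsto (fun k => qPochInf (a * b k) q) atTop (𝓝 0) := by
    have := (hcE.tendsto (a * a⁻¹)).comp (hb.const_mul a)
    rw [mul_inv_cancel₀ ha0, qPochInf_one hq0 hq1] at this
    exact this
  have hAC := (hEab.mul ((tendsto_integral_hahnWeight_fixed hq0 hq1 a hr hb
    (tendsto_const_nhds (x := 0)) hbr (fun _ => by
      rw [abs_zero]; exact inv_nonneg.2 (abs_nonneg a))).const_mul (2 * Real.pi)⁻¹))
  rw [zero_mul] at hAC
  set S := (finite_massPoints hq0 hq1 a).toFinset with hS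
  have hmass : Tendsto (fun n => ∑ k ∈ S, qPochInf (a * b n) q *
      massTerm q (fun _ => 1) a (b n) 0 k) atTop
      (𝓝 (∑ k ∈ S, qPoch 1 q k * massFactor q a k / qPochInf (a⁻¹ / (a * q ^ k)) q)) := by
    refine tendsto_finsetSum _ fun k hk => ?_
    have hk' : 1 < |a * q ^ k| := by simpa [hS] using hk
    have hA := ne_zero_of_one_lt_abs hk'
    -- The k-th mass has (abq^k;q)_∞ in its denominator, so the prefactor leaves only (ab;q)_k. This
    -- tends to (1;q)_k, which is 0 unless k = 0.
    have hterm : ∀ n, qPochInf (a * b n) q * massTerm q (fun _ => 1) a (b n) 0 k =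
        qPoch (a * b n) q k * massFactor q a k / qPochInf (b n / (a * q ^ k)) q := by
      intro n
      obtain ⟨h1, h2⟩ := mass_denominators hq0 hq1 (hab n) hk'
      have n1 := qPochInf_ne_zero_of_lt hq0 hq1 h1
      have n2 := qPochInf_ne_zero_of_lt hq0 hq1 h2
      unfold massTerm
      rw [if_pos hk', massPoint, qPochPairInf_eq_mul hq0 hq1 _ hA,
        qPochInf_eq_qPoch_mul hq0 hq1 (a * b n) k,
        show a * b n * q ^ k = b n * (a * q ^ k) by ring]
      simp only [qPochPairInf_zero, mul_one]
      generalize a * q ^ k = A at *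
      field_simp
    simp only [hterm]
    have hcP : Continuous fun y => qPoch y q k := by
      unfold qPoch
      fun_prop
    have hlim1 := (hcP.tendsto (a * a⁻¹)).comp (hb.const_mul a)
    rw [mul_inv_cancel₀ ha0] at hlim1
    refine (hlim1.mul_const _).div ((hcE.tendsto _).comp (hb.div_const _)) ?_
    refine qPochInf_ne_zero_of_lt hq0 hq1 ?_
    refine (le_abs_self _).trans_lt ?_
    rw [abs_div, abs_inv, div_lt_one (by linarith)]
    linarith
  have hsum : ∑ k ∈ S, qPoch 1 q k * massFactor q a k / qPochInf (a⁻¹ / (a * q ^ k)) q =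
      1 / qPochInf q q := by
    rw [Finset.sum_eq_single 0]
    · have h1 : (a ^ 2)⁻¹ < 1 := inv_lt_one_of_one_lt₀ (by rw [← sq_abs]; nlinarith)
      have n1 := qPochInf_ne_zero_of_lt hq0 hq1 h1
      have n2 : 1 - a ^ 2 ≠ 0 := by
        have : 1 < a ^ 2 := by rw [← sq_abs]; nlinarith
        linarith
      have n3 := qPochInf_ne_zero_of_lt hq0 hq1 hq1
      simp only [massFactor, qPoch, Finset.range_zero, Finset.prod_empty, pow_zero, mul_one,
        one_pow, div_one, mul_zero, one_mul]
      rw [div_self n2, mul_one, show a⁻¹ / a = (a ^ 2)⁻¹ by field_simp]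
      generalize qPochInf (a ^ 2)⁻¹ q = Y at *
      field_simp
    · intro k _ hk
      obtain ⟨j, rfl⟩ := Nat.exists_eq_succ_of_ne_zero hk
      rw [Nat.succ_eq_add_one, qPoch_succ']
      simp
    · intro h
      exact absurd (by simpa [hS] using ha) h
  rw [hsum] at hmass
  have hfin := hAC.add hmass
  rw [zero_add] at hfin
  refine hfin.congr fun n => ?_
  unfold scaledMass hahnIntegral
  rw [massSum_eq_zero hq0 hq1 h0, massSum_eq_zero hq0 hq1 ((hbr n).trans hr.le),
    massSum_eq_sum hq0 hq1, ← Finset.mul_sum]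
  simp only [qPochInf_zero, mul_zero, mul_one, add_zero, one_mul]
  rw [mul_add]

theorem abs_mul_pow_le (e : ℝ) (k : ℕ) : |e * q ^ k| ≤ |e| := by
  rw [abs_mul, abs_of_pos (pow_pos hq0 k)]
  exact mul_le_of_le_one_right (abs_nonneg e) (pow_le_one₀ hq0.le hq1.le)

theorem tendsto_mul_pow (e : ℝ) : Tendsto (fun k : ℕ => e * q ^ k) atTop (𝓝 0) := by
  simpa using (tendsto_pow_atTop_nhds_zero_of_lt_one hq0.le hq1).const_mul e

/-- If the total mass is known after shifting a parameter `a` of modulus greater than one, then the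
dependence on the two small parameters is known. -/
theorem scaledMass_sub_eq {a b c : ℝ} (ha : 1 < |a|) (hab : a * b < 1) (hac : a * c < 1)
    (hb : |b| < 1) (hc : |c| < 1)
    (H : ∀ b c, |b| < 1 → |c| < 1 → a * b < 1 → a * c < 1 →
      scaledMass q (a * q) b c = 1 / qPochInf q q) :
    qPochInf (b / a) q * qPochInf (c / a) q * (scaledMass q a b c - 1 / qPochInf q q) =
      qPochInf (b * c) q * (scaledMass q a 0 0 - 1 / qPochInf q q) := by
  have ha0 := ne_zero_of_one_lt_abs ha
  have hqa : ∀ e : ℝ, |e| < 1 → |e * q| < 1 := fun e he => by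
    rw [abs_mul, abs_of_pos hq0]
    nlinarith [abs_nonneg e]
  have hqb : ∀ e : ℝ, a * e < 1 → a * (e * q) < 1 := fun e he => by
    have := mul_pow_lt_one hq1 hq0.le he 1
    rwa [pow_one, mul_assoc] at this
  -- The deviation is normalised so that `scaledMass_contiguous` becomes invariance under b ↦ bq,
  -- and by symmetry under c ↦ cq. Hence X(b,c) = X(0,0).
  set X : ℝ → ℝ → ℝ := fun b c => qPochInf (b / a) q * qPochInf (c / a) q *
    (scaledMass q a b c - 1 / qPochInf q q) / qPochInf (b * c) q with hX
  have hEne : ∀ b c : ℝ, |b| < 1 → |c| < 1 → qPochInf (b * c) q ≠ 0 := fun b c hb hc =>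
    qPochInf_ne_zero_of_lt hq0 hq1 (mul_lt_one_of_abs_lt hb hc)
  have s1 : ∀ b c, |b| < 1 → |c| < 1 → a * b < 1 → a * c < 1 → X (b * q) c = X b c := by
    intro b c hb hc hab hac
    have h1 := scaledMass_contiguous hq0 hq1 ha.le ⟨hab, hac, mul_lt_one_of_abs_lt hb hc⟩
      (H b c hb hc hab hac)
    have n1 := hEne _ _ hb hc
    have n2 := hEne _ _ (hqa b hb) hc
    simp only [hX]
    rw [div_eq_div_iff n2 n1, qPochInf_eq hq0 hq1 (b * c), qPochInf_eq hq0 hq1 (b / a),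
      mul_right_comm b q c, show b * q / a = b / a * q by ring]
    linear_combination (-(qPochInf (b / a * q) q * qPochInf (c / a) q *
      qPochInf (b * c * q) q)) * h1
  have p1 : ∀ b c, X b c = X c b := fun b c => by
    simp only [hX]
    rw [scaledMass_swap_right, mul_comm b c, mul_comm (qPochInf (b / a) q)]
  have hk : ∀ k : ℕ, X (b * q ^ k) (c * q ^ k) = X b c ∧ |b * q ^ k| < 1 ∧ |c * q ^ k| < 1 ∧
      a * (b * q ^ k) < 1 ∧ a * (c * q ^ k) < 1 := by
    intro k
    induction k with
    | zero => simp [hb, hc, hab, hac]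
    | succ k ih =>
      obtain ⟨h, h1, h2, h3, h4⟩ := ih
      simp only [pow_succ, ← mul_assoc b, ← mul_assoc c]
      refine ⟨?_, hqa _ h1, hqa _ h2, hqb _ h3, hqb _ h4⟩
      rw [s1 _ _ h1 (hqa _ h2) h3 (hqb _ h4), p1, s1 _ _ h2 h1 h4 h3, p1, h]
  have hcE := continuous_qPochInf hq0 hq1
  have tb := tendsto_mul_pow hq0 hq1 b
  have tc := tendsto_mul_pow hq0 hq1 c
  have hI := tendsto_hahnIntegral_zero hq0 hq1 a (max_lt hb hc) tb tc
    (fun k => (abs_mul_pow_le hq0 hq1 b k).trans (le_max_left _ _))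
    (fun k => (abs_mul_pow_le hq0 hq1 c k).trans (le_max_right _ _))
  have hS : Tendsto (fun k : ℕ => scaledMass q a (b * q ^ k) (c * q ^ k)) atTop
      (𝓝 (scaledMass q a 0 0)) := by
    unfold scaledMass
    exact ((((hcE.tendsto _).comp (tb.const_mul a)).mul ((hcE.tendsto _).comp
      (tc.const_mul a))).mul ((hcE.tendsto _).comp (tb.mul tc))).mul hI
  have hXlim : Tendsto (fun k : ℕ => X (b * q ^ k) (c * q ^ k)) atTop (𝓝 (X 0 0)) := by
    refine Tendsto.div ((((hcE.tendsto _).comp (tb.div_const a)).mul ((hcE.tendsto _).comp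
      (tc.div_const a))).mul (hS.sub_const _)) ((hcE.tendsto _).comp (tb.mul tc)) ?_
    simp
  simp only [(hk _).1] at hXlim
  have h := tendsto_nhds_unique hXlim tendsto_const_nhds
  simp only [hX, zero_div, qPochInf_zero, mul_zero, one_mul, div_one] at h
  have n1 := hEne b c hb hc
  rw [h]
  field_simp

/-- By `scaledMass_sub_eq` all deviations are multiples of the one at (a,0,0). Taking c = 0 and b →
1/a there, `tendsto_scaledMass_inv` shows that this one is zero. -/
theorem scaledMass_of_one_lt_abs {a b c : ℝ} (ha : 1 < |a|) (hab : a * b < 1) (hac : a * c < 1)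
    (hb : |b| < 1) (hc : |c| < 1)
    (H : ∀ b c, |b| < 1 → |c| < 1 → a * b < 1 → a * c < 1 →
      scaledMass q (a * q) b c = 1 / qPochInf q q) :
    scaledMass q a b c = 1 / qPochInf q q := by
  have ha0 := ne_zero_of_one_lt_abs ha
  have hzero : scaledMass q a 0 0 - 1 / qPochInf q q = 0 := by
    -- These values approach 1/a while aβ < 1 and |β| ≤ 1/|a|; the offset 2 keeps the coefficient in
    -- [0,1) from n = 0 on.
    set β : ℕ → ℝ := fun n => (1 - 1 / ((n : ℝ) + 2)) * a⁻¹ with hβ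
    have hcoef : ∀ n : ℕ, 0 ≤ 1 - 1 / ((n : ℝ) + 2) ∧ 1 - 1 / ((n : ℝ) + 2) < 1 := by
      intro n
      have h1 : (0 : ℝ) < 1 / ((n : ℝ) + 2) := by positivity
      have h2 : 1 / ((n : ℝ) + 2) ≤ 1 := by
        rw [div_le_one (by positivity)]
        linarith [(Nat.cast_nonneg n : (0 : ℝ) ≤ n)]
      exact ⟨by linarith, by linarith⟩
    have tβ : Tendsto β atTop (𝓝 a⁻¹) := by
      have h1 : Tendsto (fun n : ℕ => 1 / ((n : ℝ) + 2)) atTop (𝓝 0) := by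
        have := (tendsto_natCast_atTop_atTop (R := ℝ)).atTop_add (tendsto_const_nhds (x := (2 : ℝ)))
        simpa [Pi.inv_def] using this.inv_tendsto_atTop
      simpa [hβ] using (h1.const_sub 1).mul_const a⁻¹
    have hβr : ∀ n, |β n| ≤ |a|⁻¹ := fun n => by
      simp only [hβ]
      rw [abs_mul, abs_inv, abs_of_nonneg (hcoef n).1]
      exact mul_le_of_le_one_left (inv_nonneg.2 (abs_nonneg a)) (hcoef n).2.le
    have haβ : ∀ n, a * β n < 1 := fun n => by
      simp only [hβ]
      rw [mul_left_comm, mul_inv_cancel₀ ha0, mul_one]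
      exact (hcoef n).2
    have hlim := tendsto_scaledMass_inv hq0 hq1 ha tβ hβr haβ
    have h1 : ∀ n, qPochInf (β n / a) q * (scaledMass q a (β n) 0 - 1 / qPochInf q q) =
        scaledMass q a 0 0 - 1 / qPochInf q q := fun n => by
      have := scaledMass_sub_eq hq0 hq1 ha (haβ n) (c := 0) (by simp)
        ((hβr n).trans_lt (inv_lt_one_of_one_lt₀ ha)) (by simp) H
      simpa using this
    have h2 := (((continuous_qPochInf hq0 hq1).tendsto _).comp (tβ.div_const a)).mul
      (hlim.sub_const (1 / qPochInf q q))
    rw [sub_self, mul_zero] at h2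
    exact tendsto_nhds_unique (tendsto_const_nhds.congr fun n => (h1 n).symm) h2
  have h := scaledMass_sub_eq hq0 hq1 ha hab hac hb hc H
  rw [hzero, mul_zero] at h
  have n1 : ∀ e : ℝ, |e| < 1 → qPochInf (e / a) q ≠ 0 := fun e he =>
    qPochInf_ne_zero_of_lt hq0 hq1 ((le_abs_self _).trans_lt (by
      rw [abs_div, div_lt_one (by linarith)]
      linarith))
  have := (mul_eq_zero.1 h).resolve_left (mul_ne_zero (n1 b hb) (n1 c hc))
  linarith

/-- A parameter of modulus at most one carries no point masses, so the formula passes to the limit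
along parameters inside the unit disc; `exists_uniform_hahnWeight_le` dominates. -/
theorem scaledMass_of_abs_eq_one {a b c : ℝ} (ha : |a| = 1) (hb : |b| < 1) (hc : |c| < 1) :
    scaledMass q a b c = 1 / qPochInf q q := by
  set α : ℕ → ℝ := fun n => a * (1 - q ^ (n + 1)) with hα
  have hcoef : ∀ n : ℕ, 0 ≤ 1 - q ^ (n + 1) ∧ 1 - q ^ (n + 1) < 1 := fun n => by
    have h1 := pow_pos hq0 (n + 1)
    have h2 := pow_le_one₀ hq0.le hq1.le (n := n + 1)
    exact ⟨by linarith, by linarith⟩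
  have hα1 : ∀ n, |α n| < 1 := fun n => by
    simp only [hα]
    rw [abs_mul, ha, one_mul, abs_of_nonneg (hcoef n).1]
    exact (hcoef n).2
  have tα : Tendsto α atTop (𝓝 a) := by
    have h1 := (tendsto_pow_atTop_nhds_zero_of_lt_one hq0.le hq1).comp (tendsto_add_atTop_nat 1)
    simpa [hα] using (h1.const_sub 1).const_mul a
  obtain ⟨C, hC⟩ := exists_uniform_hahnWeight_le hq0 hq1 (max_lt hb hc)
  have hJ := tendsto_integral_hahnWeight hq0 hq1 tα (tendsto_const_nhds (x := b))
    (tendsto_const_nhds (x := c)) (C := C) fun k =>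
      hC _ _ _ (hα1 k).le (le_max_left _ _) (le_max_right _ _)
  have hcE := continuous_qPochInf hq0 hq1
  have hlim := ((((hcE.tendsto _).comp (tα.mul_const b)).mul ((hcE.tendsto _).comp
    (tα.mul_const c))).mul_const (qPochInf (b * c) q)).mul (hJ.const_mul (2 * Real.pi)⁻¹)
  have h1 : ∀ a, |a| ≤ 1 → scaledMass q a b c = qPochInf (a * b) q * qPochInf (a * c) q *
      qPochInf (b * c) q * ((2 * Real.pi)⁻¹ * ∫ x, hahnWeight q a b c x ∂measureT) := by
    intro a ha
    unfold scaledMass hahnIntegral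
    rw [massSum_eq_zero hq0 hq1 ha, massSum_eq_zero hq0 hq1 hb.le, massSum_eq_zero hq0 hq1 hc.le]
    simp
  rw [h1 a ha.le]
  refine tendsto_nhds_unique hlim (tendsto_const_nhds.congr fun n => ?_)
  rw [← scaledMass_of_abs_lt hq0 hq1 (hα1 n) hb hc, h1 _ (hα1 n).le]
  rfl

/-- The step of the induction over the number of shifts that make the parameters small. -/
theorem scaledMass_of_one_le_abs {a b c : ℝ} {j k : ℕ} (ha : 1 ≤ |a|) (h : HahnParams a b c)
    (hb : |b * q ^ j| < 1) (hc : |c * q ^ k| < 1)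
    (H : ∀ b c, HahnParams (a * q) b c → |b * q ^ j| < 1 → |c * q ^ k| < 1 →
      scaledMass q (a * q) b c = 1 / qPochInf q q) :
    scaledMass q a b c = 1 / qPochInf q q := by
  have hsm : ∀ (e : ℝ) (i : ℕ), |e| < 1 → |e * q ^ i| < 1 := fun e i he =>
    (abs_mul_pow_le hq0 hq1 e i).trans_lt he
  -- Only a is large here. The parameters b and then c are afterwards enlarged one shift at a time
  -- by `scaledMass_of_shift`, the value at aq always being provided by H.
  have hbase : ∀ b c, |b| < 1 → |c| < 1 → a * b < 1 → a * c < 1 →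
      scaledMass q a b c = 1 / qPochInf q q := by
    intro b c hb hc hab hac
    rcases ha.lt_or_eq with ha | ha
    · refine scaledMass_of_one_lt_abs hq0 hq1 ha hab hac hb hc fun b c hb hc hab hac =>
        H b c ?_ (hsm b j hb) (hsm c k hc)
      exact HahnParams.shift hq0 hq1 ⟨hab, hac, mul_lt_one_of_abs_lt hb hc⟩
    · exact scaledMass_of_abs_eq_one hq0 hq1 ha.symm hb hc
  have hmid : ∀ i b c, |b * q ^ i| < 1 → i ≤ j → |c| < 1 → HahnParams a b c →
      scaledMass q a b c = 1 / qPochInf q q := by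
    intro i
    induction i with
    | zero => exact fun b c hb _ hc h => hbase b c (by simpa using hb) hc h.ab h.ac
    | succ i ih =>
      intro b c hbi hi hc h
      have hbj : |b * q ^ j| < 1 := by
        obtain ⟨d, hd⟩ := Nat.exists_eq_add_of_le hi
        rw [hd, pow_add, ← mul_assoc]
        exact hsm _ d hbi
      refine scaledMass_of_shift hq0 hq1 ha h (H b c (h.shift hq0 hq1) hbj (hsm c k hc)) ?_
      exact ih (b * q) c (by rwa [mul_assoc, ← pow_succ']) (by omega) hc
        (h.swap.shift hq0 hq1).swap
  have htop : ∀ i b c, |c * q ^ i| < 1 → i ≤ k → |b * q ^ j| < 1 → HahnParams a b c →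
      scaledMass q a b c = 1 / qPochInf q q := by
    intro i
    induction i with
    | zero => exact fun b c hc _ hb h => hmid j b c hb le_rfl (by simpa using hc) h
    | succ i ih =>
      intro b c hci hi hb h
      have hck : |c * q ^ k| < 1 := by
        obtain ⟨d, hd⟩ := Nat.exists_eq_add_of_le hi
        rw [hd, pow_add, ← mul_assoc]
        exact hsm _ d hci
      rw [scaledMass_swap_right]
      refine scaledMass_of_shift hq0 hq1 ha h.swap_right ?_ ?_
      · rw [scaledMass_swap_right]
        exact H b c (h.shift hq0 hq1) hb hck
      · rw [scaledMass_swap_right]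
        exact ih b (c * q) (by rwa [mul_assoc, ← pow_succ']) (by omega) hb
          ((h.swap_right.swap.shift hq0 hq1).swap.swap_right)
  exact htop k b c hc le_rfl hb h

/-- Induction on the total number i + j + k of shifts after which all three parameters have modulus
below one; replacing a by aq uses up one of them. -/
theorem scaledMass_eq {a b c : ℝ} (h : HahnParams a b c) :
    scaledMass q a b c = 1 / qPochInf q q := by
  have key : ∀ s : ℕ, ∀ a b c : ℝ, ∀ i j k : ℕ, i + j + k = s → HahnParams a b c →
      |a * q ^ i| < 1 → |b * q ^ j| < 1 → |c * q ^ k| < 1 →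
      scaledMass q a b c = 1 / qPochInf q q := by
    intro s
    induction s with
    | zero =>
      intro a b c i j k hs _ ha hb hc
      obtain ⟨⟨rfl, rfl⟩, rfl⟩ : (i = 0 ∧ j = 0) ∧ k = 0 := by omega
      simp only [pow_zero, mul_one] at ha hb hc
      exact scaledMass_of_abs_lt hq0 hq1 ha hb hc
    | succ s ih =>
      -- At least one of the three exponents is positive; by the symmetry of the mass it may be
      -- taken to be that of the first parameter.
      have hpos : ∀ a b c : ℝ, ∀ i j k : ℕ, i + 1 + j + k = s + 1 → HahnParams a b c →
          |a * q ^ (i + 1)| < 1 → |b * q ^ j| < 1 → |c * q ^ k| < 1 →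
          scaledMass q a b c = 1 / qPochInf q q := by
        intro a b c i j k hs h ha hb hc
        rcases lt_or_ge |a| 1 with h1 | h1
        · exact ih a b c i j k (by omega) h ((abs_mul_pow_le hq0 hq1 a i).trans_lt h1) hb hc
        · refine scaledMass_of_one_le_abs hq0 hq1 h1 h hb hc fun b c h hb hc => ?_
          exact ih (a * q) b c i j k (by omega) h (by rwa [mul_assoc, ← pow_succ']) hb hc
      intro a b c i j k hs h ha hb hc
      rcases Nat.eq_zero_or_pos i with hi | hi
      · rcases Nat.eq_zero_or_pos j with hj | hj
        · obtain ⟨k', rfl⟩ : ∃ k', k = k' + 1 := ⟨k - 1, by omega⟩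
          rw [scaledMass_swap_right, scaledMass_swap]
          exact hpos c a b k' i j (by omega) h.swap_right.swap hc ha hb
        · obtain ⟨j', rfl⟩ : ∃ j', j = j' + 1 := ⟨j - 1, by omega⟩
          rw [scaledMass_swap]
          exact hpos b a c j' i k (by omega) h.swap hb ha hc
      · obtain ⟨i', rfl⟩ : ∃ i', i = i' + 1 := ⟨i - 1, by omega⟩
        exact hpos a b c i' j k hs h ha hb hc
  obtain ⟨i, hi⟩ := exists_abs_mul_pow_lt_one hq0.le hq1 a
  obtain ⟨j, hj⟩ := exists_abs_mul_pow_lt_one hq0.le hq1 b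
  obtain ⟨k, hk⟩ := exists_abs_mul_pow_lt_one hq0.le hq1 c
  exact key _ a b c i j k rfl h hi hj hk

theorem hahnIntegral_one_pos {a b c : ℝ} (h : HahnParams a b c) :
    0 < hahnIntegral q (fun _ => 1) a b c := by
  have h1 := scaledMass_eq hq0 hq1 h
  unfold scaledMass at h1
  have h2 : 0 < 1 / qPochInf q q := one_div_pos.2 (qPochInf_pos hq0 hq1 hq1)
  rw [← h1] at h2
  exact pos_of_mul_pos_right h2 (mul_pos (mul_pos (qPochInf_pos hq0 hq1 h.ab)
    (qPochInf_pos hq0 hq1 h.ac)) (qPochInf_pos hq0 hq1 h.bc)).le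

theorem hahnIntegral_one_shift {a b c : ℝ} (h : HahnParams a b c) :
    hahnIntegral q (fun _ => 1) (a * q) b c =
      (1 - a * b) * (1 - a * c) * hahnIntegral q (fun _ => 1) a b c := by
  have h1 := scaledMass_eq hq0 hq1 h
  rw [← scaledMass_eq hq0 hq1 (h.shift hq0 hq1)] at h1
  unfold scaledMass at h1
  rw [qPochInf_eq hq0 hq1 (a * b), qPochInf_eq hq0 hq1 (a * c), mul_right_comm a q b,
    mul_right_comm a q c] at h1
  have h2 := h.shift hq0 hq1
  have n1 := (qPochInf_pos hq0 hq1 h2.ab).ne'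
  have n2 := (qPochInf_pos hq0 hq1 h2.ac).ne'
  have n3 := (qPochInf_pos hq0 hq1 h.bc).ne'
  rw [mul_right_comm a q b] at n1
  rw [mul_right_comm a q c] at n2
  have n : qPochInf (a * b * q) q * qPochInf (a * c * q) q * qPochInf (b * c) q ≠ 0 := by
    positivity
  refine mul_left_cancel₀ n ?_
  linear_combination -h1

/-- The moments of the orthogonality measure with respect to the basis `(a e^{iθ}, a e^{-iθ};q)_k`. -/
theorem hahnIntegral_qPochPair {a b c : ℝ} (h : HahnParams a b c) (k : ℕ) :
    hahnIntegral q (fun x => qPochPair a x q k) a b c =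
      qPoch (a * b) q k * qPoch (a * c) q k * hahnIntegral q (fun _ => 1) a b c := by
  induction k generalizing a with
  | zero => simp [qPochPair, qPoch]
  | succ k ih =>
    have h1 : (fun x => qPochPair a x q (k + 1)) =
        fun x => qPochPair (a * q) x q k * (1 - 2 * a * x + a ^ 2) := by
      ext x
      rw [qPochPair, qPochPair, Finset.prod_range_succ']
      simp only [pow_zero, mul_one]
      congr 1
      exact Finset.prod_congr rfl fun i _ => by ring
    rw [h1, hahnIntegral_mul_factor hq0 hq1 h, ih (h.shift hq0 hq1),
      hahnIntegral_one_shift hq0 hq1 h, qPoch_succ', qPoch_succ', mul_right_comm a q b,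
      mul_right_comm a q c]
    ring

end

end QSpecial

end

/-! ### The functional is integration against the Askey-Wilson measure. -/

noncomputable section

namespace QSpecial

open Filter Topology Polynomial.Chebyshev

section

variable {q : ℝ} (hq0 : 0 < q) (hq1 : q < 1)

include hq0 hq1

/-- Splitting k factors off (b/(aq^k);q)_∞, each one is absorbed by b - aq^{i+1} = -aq^{i+1}(1 -
b/(aq^{i+1})). -/
theorem qPochInf_div_mul_prod {a : ℝ} (ha : a ≠ 0) (b : ℝ) (k : ℕ) :
    qPochInf (b / a) q * ∏ i ∈ Finset.range k, (b - a * q ^ (i + 1)) =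
      qPochInf (b / (a * q ^ k)) q * ∏ i ∈ Finset.range k, -(a * q ^ (i + 1)) := by
  induction k with
  | zero => simp
  | succ k ih =>
    have hq := hq0.ne'
    rw [Finset.prod_range_succ, Finset.prod_range_succ, ← mul_assoc, ih,
      qPochInf_eq hq0 hq1 (b / (a * q ^ (k + 1))),
      show b / (a * q ^ (k + 1)) * q = b / (a * q ^ k) by
        field_simp
        ring]
    field_simp
    ring

/-- All dependence of the mass on b and c is collected in the weight products evaluated at the mass
point. In this form multiplication by a factor acts visibly as a parameter shift. -/
theorem askeyWilsonMass_eq {a b c : ℝ} (hab : a * b < 1) (hac : a * c < 1) {k : ℕ}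
    (hk : 1 < |a * q ^ k|) :
    askeyWilsonMass k a b c 0 q = massFactor q a k /
      (qPochPairInf b (massPoint q a k) q * qPochPairInf c (massPoint q a k) q) := by
  have hA := ne_zero_of_one_lt_abs hk
  have ha0 : a ≠ 0 := left_ne_zero_of_mul hA
  obtain ⟨b1, b2⟩ := mass_denominators hq0 hq1 hab hk
  obtain ⟨c1, c2⟩ := mass_denominators hq0 hq1 hac hk
  have nb1 := qPochInf_ne_zero_of_lt hq0 hq1 b1
  have nb2 := qPochInf_ne_zero_of_lt hq0 hq1 b2
  have nc1 := qPochInf_ne_zero_of_lt hq0 hq1 c1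
  have nc2 := qPochInf_ne_zero_of_lt hq0 hq1 c2
  have eb := qPochInf_div_mul_prod hq0 hq1 ha0 b k
  have ec := qPochInf_div_mul_prod hq0 hq1 ha0 c k
  have fb := qPochInf_eq_qPoch_mul hq0 hq1 (a * b) k
  have fc := qPochInf_eq_qPoch_mul hq0 hq1 (a * c) k
  have gb := qPochInf_ne_zero_of_lt hq0 hq1 hab
  have gc := qPochInf_ne_zero_of_lt hq0 hq1 hac
  rw [show a * b * q ^ k = b * (a * q ^ k) by ring] at fb
  rw [show a * c * q ^ k = c * (a * q ^ k) by ring] at fc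
  have hprod0 : ∏ i ∈ Finset.range k, -(a * q ^ (i + 1)) ≠ 0 :=
    Finset.prod_ne_zero_iff.2 fun i _ => neg_ne_zero.2 (by
      have := hq0.ne'
      positivity)
  have hz : qPoch 0 q k = 1 := by simp [qPoch]
  have hp0 : ∏ i ∈ Finset.range k, (0 - a * q ^ (i + 1)) =
      ∏ i ∈ Finset.range k, -(a * q ^ (i + 1)) := by simp only [zero_sub]
  unfold askeyWilsonMass massFactor
  rw [massPoint, qPochPairInf_eq_mul hq0 hq1 b hA, qPochPairInf_eq_mul hq0 hq1 c hA,
    Finset.prod_mul_distrib, Finset.prod_mul_distrib, hp0]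
  simp only [mul_zero, zero_div, qPochInf_zero, mul_one, hz]
  rw [fb] at gb ⊢
  rw [fc] at gc ⊢
  have pb := left_ne_zero_of_mul gb
  have pc := left_ne_zero_of_mul gc
  have eb' := eb ▸ mul_ne_zero nb2 hprod0
  have ec' := ec ▸ mul_ne_zero nc2 hprod0
  have mb := left_ne_zero_of_mul eb'
  have mb' := right_ne_zero_of_mul eb'
  have mc := left_ne_zero_of_mul ec'
  have mc' := right_ne_zero_of_mul ec'
  generalize (∏ i ∈ Finset.range k, (b - a * q ^ (i + 1))) = Db at *
  generalize (∏ i ∈ Finset.range k, (c - a * q ^ (i + 1))) = Dc at *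
  generalize (∏ i ∈ Finset.range k, -(a * q ^ (i + 1))) = Da at *
  generalize qPochInf (b / (a * q ^ k)) q = B2 at *
  generalize qPochInf (c / (a * q ^ k)) q = C2 at *
  generalize qPochInf (b / a) q = B1 at *
  generalize qPochInf (c / a) q = C1 at *
  generalize qPochInf (b * (a * q ^ k)) q = B3 at *
  generalize qPochInf (c * (a * q ^ k)) q = C3 at *
  generalize qPoch (a * b) q k = B4 at *
  generalize qPoch (a * c) q k = C4 at *
  have hB : B2 = B1 * Db / Da := by field_simp; linear_combination -eb
  have hC : C2 = C1 * Dc / Da := by field_simp; linear_combination -ec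
  rw [hB, hC]
  have hqq := (qPoch_self_pos hq0 hq1 k).ne'
  have hEq := qPochInf_ne_zero_of_lt hq0 hq1 hq1
  generalize qPoch q q k = V at *
  generalize qPochInf q q = E at *
  generalize (1 - a ^ 2 * q ^ (2 * k)) / (1 - a ^ 2) = R
  field_simp

/-- `ENNReal.ofReal` would replace a negative weight by 0, so signs matter. Grouped by i, the signs
of (a²;q)_k, of the cubed product and of (q/a)^k combine to factors (a²q^i - 1) q / (a⁴ q^{3(i+1)}),
which are positive because a²q^i > 1. -/
theorem massFactor_nonneg {a : ℝ} {k : ℕ} (hk : 1 < |a * q ^ k|) : 0 ≤ massFactor q a k := by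
  have ha : 1 < |a| := by
    simpa using one_lt_abs_of_mul_pow hq0 hq1 hk (i := 0) (Nat.zero_le _)
  have ha0 := ne_zero_of_one_lt_abs ha
  have hsq : ∀ i, i ≤ 2 * k → a ^ 2 * q ^ i > 1 := fun i hi => by
    have h1 : 1 < (a * q ^ k) ^ 2 := by rw [← sq_abs]; nlinarith
    have h2 : q ^ (2 * k) ≤ q ^ i := pow_le_pow_of_le_one hq0.le hq1.le hi
    have h3 : (a * q ^ k) ^ 2 = a ^ 2 * q ^ (2 * k) := by ring
    nlinarith [sq_nonneg a]
  have h1 : 0 ≤ qPochInf (a ^ 2)⁻¹ q / qPochInf q q := by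
    have : (a ^ 2)⁻¹ < 1 := inv_lt_one_of_one_lt₀ (by simpa using hsq 0 (by omega))
    exact (div_pos (qPochInf_pos hq0 hq1 this) (qPochInf_pos hq0 hq1 hq1)).le
  have h2 : 0 ≤ (1 - a ^ 2 * q ^ (2 * k)) / (1 - a ^ 2) := by
    have e1 := hsq (2 * k) le_rfl
    have e2 := hsq 0 (by omega)
    simp only [pow_zero, mul_one] at e2
    exact div_nonneg_of_nonpos (by linarith) (by linarith)
  have h3 : qPoch (a ^ 2) q k / (qPoch q q k *
      (∏ i ∈ Finset.range k, -(a * q ^ (i + 1))) ^ 3) * (q / a) ^ k =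
      (∏ i ∈ Finset.range k, (a ^ 2 * q ^ i - 1) * q / (a ^ 4 * (q ^ (i + 1)) ^ 3)) /
        qPoch q q k := by
    have e1 : qPoch (a ^ 2) q k * (q / a) ^ k /
        (∏ i ∈ Finset.range k, -(a * q ^ (i + 1))) ^ 3 =
        ∏ i ∈ Finset.range k, (a ^ 2 * q ^ i - 1) * q / (a ^ 4 * (q ^ (i + 1)) ^ 3) := by
      rw [qPoch, ← Finset.prod_pow, show (q / a) ^ k = ∏ i ∈ Finset.range k, (q / a) by
          rw [Finset.prod_const, Finset.card_range],
        ← Finset.prod_mul_distrib, ← Finset.prod_div_distrib]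
      refine Finset.prod_congr rfl fun i _ => ?_
      have := hq0.ne'
      field_simp
      ring
    rw [← e1]
    have := (qPoch_self_pos hq0 hq1 k).ne'
    rw [div_mul_eq_mul_div, div_div, mul_comm (qPoch q q k)]
  unfold massFactor
  rw [mul_assoc, h3]
  refine mul_nonneg (mul_nonneg h1 h2) (div_nonneg (Finset.prod_nonneg fun i hi => ?_)
    (qPoch_self_pos hq0 hq1 k).le)
  have := hsq i (by have := Finset.mem_range.1 hi; omega)
  exact div_nonneg (mul_nonneg (by linarith) hq0.le) (by positivity)

theorem askeyWilsonDiscrete_integral {a b c : ℝ} (hab : a * b < 1) (hac : a * c < 1)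
    {f : ℝ → ℝ} (hf : Continuous f) :
    Integrable f (askeyWilsonDiscrete a b c 0 q) ∧
      ∫ x, f x ∂(askeyWilsonDiscrete a b c 0 q) = massSum q f a b c := by
  have hterm : ∀ g : ℝ → ℝ, Continuous g → ∀ k : ℕ, ∫ x, g x ∂(if 1 < |a * q ^ k| then
      ENNReal.ofReal (askeyWilsonMass k a b c 0 q) •
        Measure.dirac ((a * q ^ k + (a * q ^ k)⁻¹) / 2) else 0) = massTerm q g a b c k := by
    intro g hg k
    unfold massTerm
    split_ifs with hk
    · have hpos : 0 ≤ massFactor q a k / (qPochPairInf b (massPoint q a k) q *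
          qPochPairInf c (massPoint q a k) q) :=
        div_nonneg (massFactor_nonneg hq0 hq1 hk)
          (mul_pos (qPochPairInf_massPoint_pos hq0 hq1 hab hk)
            (qPochPairInf_massPoint_pos hq0 hq1 hac hk)).le
      rw [integral_smul_measure, integral_dirac, askeyWilsonMass_eq hq0 hq1 hab hac hk,
        ENNReal.toReal_ofReal hpos, smul_eq_mul]
      simp only [massPoint]
      ring
    · simp
  have hint : Integrable f (askeyWilsonDiscrete a b c 0 q) := by
    unfold askeyWilsonDiscrete
    refine integrable_sum_measure (fun k => ?_) ?_
    · split_ifs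
      · refine Integrable.smul_measure ?_ ENNReal.ofReal_ne_top
        exact integrable_dirac (by simp)
      · exact integrable_zero_measure
    · simp only [hterm _ hf.norm]
      exact summable_massTerm hq0 hq1 _ a b c
  refine ⟨hint, ?_⟩
  unfold askeyWilsonDiscrete at hint ⊢
  rw [integral_sum_measure hint]
  simp only [hterm _ hf]
  rfl

omit hq0 hq1 in
theorem askeyWilsonDiscrete_zero (a b c : ℝ) : askeyWilsonDiscrete 0 a b c q = 0 := by
  simp [askeyWilsonDiscrete]

/-- The factor (1 - x²)^{-1/2} is moved into the Chebyshev measure, leaving a bounded density under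
the product conditions. The endpoint -1, absent from the half-open interval used by `measureT`, is a
null set. -/
theorem askeyWilson_continuous_part (a b c : ℝ) :
    (volume.restrict (Set.Icc (-1) 1)).withDensity
      (fun x => ENNReal.ofReal (askeyWilsonDensity x a b c 0 q)) =
    measureT.withDensity (fun x => ENNReal.ofReal ((2 * Real.pi)⁻¹ * hahnWeight q a b c x)) := by
  have hm : ∀ {f : ℝ → ℝ}, ContinuousOn f (Set.Icc (-1) 1) →
      AEMeasurable f (volume.restrict (Set.Ioc (-1) 1)) := fun hf =>
    (hf.mono Set.Ioc_subset_Icc_self).aemeasurable measurableSet_Ioc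
  have hw : AEMeasurable (hahnWeight q a b c) (volume.restrict (Set.Ioc (-1) 1)) :=
    (hm (continuousOn_qPochPairInf_double hq0 hq1 1)).div
      (((hm (continuousOn_qPochPairInf_right hq0 hq1 a)).mul
        (hm (continuousOn_qPochPairInf_right hq0 hq1 b))).mul
        (hm (continuousOn_qPochPairInf_right hq0 hq1 c)))
  unfold measureT
  rw [restrict_withDensity measurableSet_Ioc, ← withDensity_mul₀ (by fun_prop)
    (hw.const_mul _).ennreal_ofReal, Measure.restrict_congr_set Ioc_ae_eq_Icc.symm]
  refine withDensity_congr_ae ?_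
  filter_upwards [ae_restrict_mem measurableSet_Ioc] with x hx
  have hx' := Set.Ioc_subset_Icc_self hx
  have h0 : 0 ≤ (2 * Real.pi)⁻¹ * hahnWeight q a b c x :=
    mul_nonneg (by positivity) (hahnWeight_nonneg hq0 hq1 a b c hx')
  have hd : askeyWilsonDensity x a b c 0 q =
      √(1 - x ^ 2)⁻¹ * ((2 * Real.pi)⁻¹ * hahnWeight q a b c x) := by
    unfold askeyWilsonDensity hahnWeight
    rw [qPochPairInf_zero, Real.sqrt_inv]
    ring
  rw [hd, ENNReal.ofReal_mul (Real.sqrt_nonneg _), Pi.mul_apply]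
  congr 1
  rw [← ENNReal.ofReal_coe_nnreal]
  rfl

/-- The orthogonality measure integrates continuous functions as `hahnIntegral` says. -/
theorem askeyWilsonMeasure_integral {a b c : ℝ} (h : HahnParams a b c) {f : ℝ → ℝ}
    (hf : Continuous f) :
    Integrable f (askeyWilsonMeasure a b c 0 q) ∧
      ∫ x, f x ∂(askeyWilsonMeasure a b c 0 q) = hahnIntegral q f a b c := by
  obtain ⟨ia, ea⟩ := askeyWilsonDiscrete_integral hq0 hq1 h.ab h.ac hf
  obtain ⟨ib, eb⟩ := askeyWilsonDiscrete_integral hq0 hq1 h.swap.ab h.swap.ac hf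
  obtain ⟨ic, ec⟩ := askeyWilsonDiscrete_integral hq0 hq1 h.swap_right.swap.ab
    h.swap_right.swap.ac hf
  have hmeas : AEMeasurable (fun x => ENNReal.ofReal ((2 * Real.pi)⁻¹ * hahnWeight q a b c x))
      measureT := ((aemeasurable_hahnWeight hq0 hq1 a b c).const_mul _).ennreal_ofReal
  have hfin : ∀ᵐ x ∂measureT, ENNReal.ofReal ((2 * Real.pi)⁻¹ * hahnWeight q a b c x) < ⊤ :=
    Eventually.of_forall fun x => ENNReal.ofReal_lt_top
  have hcongr : (fun x => (2 * Real.pi)⁻¹ * (f x * hahnWeight q a b c x)) =ᵐ[measureT]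
      fun x => (ENNReal.ofReal ((2 * Real.pi)⁻¹ * hahnWeight q a b c x)).toReal • f x := by
    filter_upwards [ae_measureT_mem_Ioo] with x hx
    rw [ENNReal.toReal_ofReal (mul_nonneg (by positivity)
      (hahnWeight_nonneg hq0 hq1 a b c (Set.Ioo_subset_Icc_self hx))), smul_eq_mul]
    ring
  have i0 : Integrable f (measureT.withDensity
      (fun x => ENNReal.ofReal ((2 * Real.pi)⁻¹ * hahnWeight q a b c x))) := by
    rw [integrable_withDensity_iff_integrable_smul₀' hmeas hfin]
    exact ((integrable_mul_hahnWeight hq0 hq1 h.ab h.ac h.bc hf).const_mul _).congr hcongr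
  have e0 : ∫ x, f x ∂(measureT.withDensity
      (fun x => ENNReal.ofReal ((2 * Real.pi)⁻¹ * hahnWeight q a b c x))) =
      (2 * Real.pi)⁻¹ * ∫ x, f x * hahnWeight q a b c x ∂measureT := by
    rw [integral_withDensity_eq_integral_toReal_smul₀ hmeas hfin, ← integral_congr_ae hcongr,
      integral_const_mul]
  unfold askeyWilsonMeasure hahnIntegral
  rw [askeyWilson_continuous_part hq0 hq1, askeyWilsonDiscrete_zero, add_zero]
  refine ⟨i0.add_measure ((ia.add_measure ib).add_measure ic), ?_⟩
  rw [integral_add_measure i0 ((ia.add_measure ib).add_measure ic),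
    integral_add_measure (ia.add_measure ib) ic, integral_add_measure ia ib, e0, ea, eb, ec]

end

end QSpecial

end

/-! ### Terms of the big q-Jacobi sums and of their neighbours. -/

noncomputable section

namespace QSpecial

/-- The reciprocal of `(q;q)_{s-j}`, and zero if `s < j`. -/
def qFactInv (q : ℝ) (s j : ℕ) : ℝ := if j ≤ s then (qPoch q q (s - j))⁻¹ else 0

/-- The product `∏_{i<k} (-q^{i+1}/M)`. -/
def signedPow (q M : ℝ) (k : ℕ) : ℝ := ∏ i ∈ Finset.range k, -(q ^ (i + 1) / M)

/-- The `k`-th term of `bigJacobiSum`. -/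
def bigJacobiTerm (q : ℝ) (l n : ℕ) (Y Z : ℝ) (k : ℕ) : ℝ :=
  signedPow q (q ^ l / q ^ n) k * qPoch q q (l + n + k) * qFactInv q l (n + k) /
    (qPoch q q k * qPoch q q (n + k)) * (qPoch Y q k / qPoch (Z * q) q (n + k))

/-- A big `q`-Jacobi polynomial of degree `l - n`, normalised such that its contiguous relations are
simple and that it vanishes for `l < n`. -/
def bigJacobiSum (q : ℝ) (l n : ℕ) (Y Z : ℝ) : ℝ :=
  ∑ k ∈ Finset.range (l + 1), bigJacobiTerm q l n Y Z k

/-- The common factor of the terms of contiguous sums. -/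
def contigTerm (q : ℝ) (l n : ℕ) (Y Z : ℝ) (k : ℕ) : ℝ :=
  signedPow q (q ^ (l + 1) / q ^ n) k * qPoch q q (l + n + k) * qFactInv q (l + 2) (n + k) /
    (qPoch q q k * qPoch q q (n + k)) * (qPoch Y q k / qPoch (Z * q) q (n + k))

theorem signedPow_succ (q M : ℝ) (k : ℕ) :
    signedPow q M (k + 1) = signedPow q M k * -(q ^ (k + 1) / M) :=
  Finset.prod_range_succ _ _

theorem signedPow_mul (q M r : ℝ) (k : ℕ) :
    signedPow q (M * r) k = signedPow q M k / r ^ k := by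
  induction k with
  | zero => simp [signedPow]
  | succ k ih =>
    rw [signedPow_succ, signedPow_succ, ih, pow_succ]
    simp only [div_eq_mul_inv, mul_inv]
    ring

theorem qFactInv_of_lt (q : ℝ) {s j : ℕ} (h : s < j) : qFactInv q s j = 0 :=
  if_neg (not_le.2 h)

section

variable {q : ℝ} (hq0 : 0 < q) (hq1 : q < 1)

include hq0 hq1

theorem one_sub_pow_ne_zero {n : ℕ} (hn : n ≠ 0) : 1 - q ^ n ≠ 0 := by
  have := pow_lt_one₀ hq0.le hq1 hn
  linarith

/-- The convention that 1/(q;q)_{s-j} is zero for s < j makes this hold for all s and j: at j = s +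
1 the factor in front vanishes. Boundary terms of the sums thus need no separate care. -/
theorem qFactInv_succ_left (s j : ℕ) :
    qFactInv q s j = (1 - q ^ (s + 1) / q ^ j) * qFactInv q (s + 1) j := by
  unfold qFactInv
  have hj : q ^ j ≠ 0 := pow_ne_zero _ hq0.ne'
  rcases lt_trichotomy j (s + 1) with h | h | h
  · rw [if_pos (by omega), if_pos h.le, show s + 1 - j = (s - j) + 1 by omega, qPoch_succ]
    have h1 : q ^ (s + 1) / q ^ j = q * q ^ (s - j) := by
      rw [show s + 1 = (s - j) + 1 + j by omega, pow_add, pow_succ]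
      field_simp
    rw [h1]
    have h2 : 1 - q * q ^ (s - j) ≠ 0 := by
      rw [← pow_succ']
      exact one_sub_pow_ne_zero hq0 hq1 (by omega)
    have h3 := (qPoch_self_pos hq0 hq1 (s - j)).ne'
    field_simp
  · rw [if_neg (by omega), h, div_self (by rwa [h] at hj), sub_self, zero_mul]
  · rw [if_neg (by omega), if_neg (by omega), mul_zero]

theorem qFactInv_succ_right (s j : ℕ) :
    qFactInv q s (j + 1) = (1 - q ^ s / q ^ j) * qFactInv q s j := by
  have hq := hq0.ne'
  have h : qFactInv q s (j + 1) = qFactInv q (s - 1) j ∨ s = 0 := by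
    rcases Nat.eq_zero_or_pos s with h | h
    · exact Or.inr h
    · left
      unfold qFactInv
      by_cases hj : j + 1 ≤ s
      · rw [if_pos hj, if_pos (by omega), show s - (j + 1) = s - 1 - j by omega]
      · rw [if_neg hj, if_neg (by omega)]
  rcases h with h | h
  · rcases Nat.eq_zero_or_pos s with h0 | h0
    · subst h0
      rw [qFactInv_of_lt q (by omega : 0 < j + 1)]
      rcases Nat.eq_zero_or_pos j with h1 | h1
      · simp [h1]
      · rw [qFactInv_of_lt q h1, mul_zero]
    · rw [h, qFactInv_succ_left hq0 hq1 (s - 1) j, show s - 1 + 1 = s by omega]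
  · subst h
    rw [qFactInv_of_lt q (by omega : 0 < j + 1)]
    rcases Nat.eq_zero_or_pos j with h1 | h1
    · simp [h1]
    · rw [qFactInv_of_lt q h1, mul_zero]

omit hq0 hq1 in
theorem bigJacobiTerm_eq_zero {l n k : ℕ} (h : l < n + k) (Y Z : ℝ) :
    bigJacobiTerm q l n Y Z k = 0 := by
  simp [bigJacobiTerm, qFactInv_of_lt q h]

omit hq0 hq1 in
theorem bigJacobiSum_eq_sum {l n M : ℕ} (h : l < M) (Y Z : ℝ) :
    bigJacobiSum q l n Y Z = ∑ k ∈ Finset.range M, bigJacobiTerm q l n Y Z k := by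
  unfold bigJacobiSum
  refine Finset.sum_subset (Finset.range_subset_range.2 (by omega)) fun k _ hk => ?_
  rw [Finset.mem_range, not_lt] at hk
  exact bigJacobiTerm_eq_zero (by omega) Y Z

omit hq0 hq1 in
theorem bigJacobiSum_eq_zero {l n : ℕ} (h : l < n) (Y Z : ℝ) : bigJacobiSum q l n Y Z = 0 :=
  Finset.sum_eq_zero fun _ _ => bigJacobiTerm_eq_zero (by omega) Y Z

theorem qPoch_pos {a : ℝ} (ha : a < 1) (k : ℕ) : 0 < qPoch a q k :=
  Finset.prod_pos fun i _ => by
    have := mul_pow_lt_one hq1 hq0.le ha i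
    linarith

omit hq0 hq1 in
theorem contigTerm_eq_zero {l n k : ℕ} (h : l + 2 < n + k) (Y Z : ℝ) :
    contigTerm q l n Y Z k = 0 := by
  simp [contigTerm, qFactInv_of_lt q h]

/-- This and the next four lemmas express the terms of the five sums in the contiguous relations as
`contigTerm` times a rational function of q^{l+1}, q^n, q^k and Z. Linear relations between the sums
then become identities of rational functions. -/
theorem bigJacobiTerm_eq (l n k : ℕ) (Y Z : ℝ) :
    bigJacobiTerm q (l + 1) n Y Z k = contigTerm q l n Y Z k *
      ((1 - q ^ (l + 1) * (q ^ n * q ^ k)) * (1 - q * q ^ (l + 1) / (q ^ n * q ^ k))) := by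
  unfold bigJacobiTerm contigTerm
  rw [show l + 1 + n + k = (l + n + k) + 1 by ring, qPoch_succ,
    qFactInv_succ_left hq0 hq1 (l + 1) (n + k)]
  rw [show q * q ^ (l + n + k) = q ^ (l + 1) * (q ^ n * q ^ k) by ring,
    show q ^ (l + 1 + 1) = q * q ^ (l + 1) by ring, pow_add q n k]
  ring_nf

omit hq0 hq1 in
theorem bigJacobiTerm_up (l n k : ℕ) (Y Z : ℝ) :
    bigJacobiTerm q (l + 2) n Y Z k = contigTerm q l n Y Z k *
      ((1 - q ^ (l + 1) * (q ^ n * q ^ k)) * (1 - q * q ^ (l + 1) * (q ^ n * q ^ k)) / q ^ k) := by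
  unfold bigJacobiTerm contigTerm
  rw [show l + 2 + n + k = (l + n + k) + 1 + 1 by ring, qPoch_succ, qPoch_succ,
    show q ^ (l + 2) / q ^ n = q ^ (l + 1) / q ^ n * q by ring, signedPow_mul]
  rw [show q * q ^ (l + n + k) = q ^ (l + 1) * (q ^ n * q ^ k) by ring,
    show q * q ^ (l + n + k + 1) = q * q ^ (l + 1) * (q ^ n * q ^ k) by ring]
  ring

theorem bigJacobiTerm_down (l n k : ℕ) (Y Z : ℝ) :
    bigJacobiTerm q l n Y Z k = contigTerm q l n Y Z k *
      (q ^ k * (1 - q * q ^ (l + 1) / (q ^ n * q ^ k)) *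
        (1 - q ^ (l + 1) / (q ^ n * q ^ k))) := by
  have hq := hq0.ne'
  have hs : signedPow q (q ^ l / q ^ n) k = signedPow q (q ^ (l + 1) / q ^ n) k * q ^ k := by
    rw [show q ^ (l + 1) / q ^ n = q ^ l / q ^ n * q by ring, signedPow_mul]
    field_simp
  unfold bigJacobiTerm contigTerm
  rw [hs, qFactInv_succ_left hq0 hq1 l (n + k), qFactInv_succ_left hq0 hq1 (l + 1) (n + k),
    show q ^ (l + 1 + 1) = q * q ^ (l + 1) by ring, pow_add q n k]
  ring_nf

theorem bigJacobiTerm_right (l n k : ℕ) (Y Z : ℝ) :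
    bigJacobiTerm q (l + 1) (n + 1) Y Z k = contigTerm q l n Y Z k *
      (q ^ k * (1 - q ^ (l + 1) * (q ^ n * q ^ k)) * (1 - q * q ^ (l + 1) * (q ^ n * q ^ k)) *
        (1 - q * q ^ (l + 1) / (q ^ n * q ^ k)) * (1 - q ^ (l + 1) / (q ^ n * q ^ k)) /
        ((1 - q * (q ^ n * q ^ k)) * (1 - q * Z * (q ^ n * q ^ k)))) := by
  have hq := hq0.ne'
  have hs : signedPow q (q ^ (l + 1) / q ^ (n + 1)) k =
      signedPow q (q ^ (l + 1) / q ^ n) k * q ^ k := by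
    rw [show q ^ (l + 1) / q ^ n = q ^ (l + 1) / q ^ (n + 1) * q by
      rw [pow_succ q n]; field_simp, signedPow_mul]
    field_simp
  unfold bigJacobiTerm contigTerm
  rw [hs, show l + 1 + (n + 1) + k = (l + n + k) + 1 + 1 by ring, qPoch_succ, qPoch_succ,
    show n + 1 + k = (n + k) + 1 by ring, qPoch_succ, qPoch_succ (Z * q),
    qFactInv_succ_right hq0 hq1, qFactInv_succ_left hq0 hq1 (l + 1) (n + k)]
  rw [show q * q ^ (l + n + k) = q ^ (l + 1) * (q ^ n * q ^ k) by ring,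
    show q * q ^ (l + n + k + 1) = q * q ^ (l + 1) * (q ^ n * q ^ k) by ring,
    show q ^ (l + 1 + 1) = q * q ^ (l + 1) by ring,
    show Z * q * q ^ (n + k) = q * Z * (q ^ n * q ^ k) by ring, pow_add q n k]
  simp only [div_eq_mul_inv, mul_inv]
  ring

theorem bigJacobiTerm_left (l n k : ℕ) (Y : ℝ) {Z : ℝ} (hZ : Z < 0) :
    bigJacobiTerm q (l + 1) n Y Z k = contigTerm q l (n + 1) Y Z k *
      ((1 - q ^ (n + 1) * q ^ k) * (1 - Z * (q ^ (n + 1) * q ^ k)) / q ^ k) := by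
  have hq := hq0.ne'
  have hs : signedPow q (q ^ (l + 1) / q ^ (n + 1)) k =
      signedPow q (q ^ (l + 1) / q ^ n) k * q ^ k := by
    rw [show q ^ (l + 1) / q ^ n = q ^ (l + 1) / q ^ (n + 1) * q by
      rw [pow_succ q n]; field_simp, signedPow_mul]
    field_simp
  have hf : qFactInv q (l + 2) (n + 1 + k) = qFactInv q (l + 1) (n + k) := by
    unfold qFactInv
    rw [show n + 1 + k = (n + k) + 1 by ring]
    by_cases h : n + k ≤ l + 1
    · rw [if_pos h, if_pos (by omega), show l + 2 - (n + k + 1) = l + 1 - (n + k) by omega]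
    · rw [if_neg h, if_neg (by omega)]
  have h1 : 1 - q ^ (n + 1) * q ^ k ≠ 0 := by
    rw [← pow_add]
    exact one_sub_pow_ne_zero hq0 hq1 (by omega)
  have h2 : 1 - Z * (q ^ (n + 1) * q ^ k) ≠ 0 := by
    have : Z * (q ^ (n + 1) * q ^ k) < 0 := mul_neg_of_neg_of_pos hZ (by positivity)
    linarith
  unfold bigJacobiTerm contigTerm
  rw [hs, hf, show l + (n + 1) + k = l + 1 + n + k by ring, show n + 1 + k = (n + k) + 1 by ring,
    qPoch_succ, qPoch_succ (Z * q), show q * q ^ (n + k) = q ^ (n + 1) * q ^ k by ring,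
    show Z * q * q ^ (n + k) = Z * (q ^ (n + 1) * q ^ k) by ring]
  have h3 := (qPoch_self_pos hq0 hq1 (n + k)).ne'
  have h4 := (qPoch_self_pos hq0 hq1 k).ne'
  have h5 := (qPoch_pos hq0 hq1 (by nlinarith : Z * q < 1) (n + k)).ne'
  have h6 : q ^ k ≠ 0 := pow_ne_zero _ hq
  generalize 1 - q ^ (n + 1) * q ^ k = A at *
  generalize 1 - Z * (q ^ (n + 1) * q ^ k) = B at *
  field_simp

/-- The ratio of consecutive terms, needed for telescoping; its factor 1 - Y q^k is the only place
where Y enters. -/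
theorem contigTerm_succ (l n k : ℕ) (Y Z : ℝ) :
    contigTerm q l n Y Z (k + 1) = contigTerm q l n Y Z k *
      (-(q * q ^ k * q ^ n / q ^ (l + 1)) * (1 - q ^ (l + 1) * (q ^ n * q ^ k)) *
        (1 - q * q ^ (l + 1) / (q ^ n * q ^ k)) * (1 - Y * q ^ k) /
        ((1 - q * q ^ k) * (1 - q * (q ^ n * q ^ k)) * (1 - q * Z * (q ^ n * q ^ k)))) := by
  unfold contigTerm
  rw [signedPow_succ, show l + n + (k + 1) = (l + n + k) + 1 by ring, qPoch_succ q, qPoch_succ q,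
    show n + (k + 1) = (n + k) + 1 by ring, qPoch_succ q, qPoch_succ (Z * q), qPoch_succ Y,
    qFactInv_succ_right hq0 hq1]
  rw [show q * q ^ (l + n + k) = q ^ (l + 1) * (q ^ n * q ^ k) by ring,
    show q ^ (l + 2) = q * q ^ (l + 1) by ring,
    show Z * q * q ^ (n + k) = q * Z * (q ^ n * q ^ k) by ring, pow_add q n k]
  simp only [div_eq_mul_inv, mul_inv, inv_inv]
  ring

omit hq0 hq1 in
/-- A sum of differences `T (k+1) - T k` vanishes if `T` vanishes at both ends. -/
theorem sum_eq_zero_of_telescope {f T : ℕ → ℝ} {M : ℕ} (h : ∀ k, f k = T (k + 1) - T k)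
    (h0 : T 0 = 0) (hM : T M = 0) : ∑ k ∈ Finset.range M, f k = 0 := by
  rw [Finset.sum_congr rfl fun k _ => h k, Finset.sum_range_sub, h0, hM, sub_zero]

end

end QSpecial

end

/-! ### Contiguous relations of the big q-Jacobi sums. -/

noncomputable section

namespace QSpecial

/-- Coefficient of the contiguous function of higher degree. -/
def contigUp (q L Z : ℝ) : ℝ := (1 - Z * q * L) / ((1 - q * L ^ 2) * (1 + q * L))

/-- Coefficient of the contiguous function of the same degree. -/
def contigMid (q L Z : ℝ) : ℝ := (1 + Z) / ((1 + q * L) * (1 + L))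

/-- Coefficient of the contiguous function of lower degree. -/
def contigDown (q L Z : ℝ) : ℝ := (L - Z) / ((1 - q * L ^ 2) * (1 + L))

section

variable {q : ℝ} (hq0 : 0 < q) (hq1 : q < 1)

include hq0 hq1

theorem one_sub_mul_pow_sq_pos (l : ℕ) : 0 < 1 - q * (q ^ l) ^ 2 := by
  have h : q * (q ^ l) ^ 2 = q ^ (2 * l + 1) := by ring
  rw [h]
  have := pow_lt_one₀ hq0.le hq1 (by omega : 2 * l + 1 ≠ 0)
  linarith

/-- The expansion of `G_{l,n}` in the functions with second index `n + 1`. -/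
theorem bigJacobiSum_left (l n : ℕ) (Y : ℝ) {Z : ℝ} (hZ : Z < 0) :
    bigJacobiSum q (l + 1) n Y Z =
      contigUp q (q ^ (l + 1)) Z * bigJacobiSum q (l + 2) (n + 1) Y Z -
        q ^ (n + 1) * contigMid q (q ^ (l + 1)) Z * bigJacobiSum q (l + 1) (n + 1) Y Z -
        (q ^ (n + 1)) ^ 2 * contigDown q (q ^ (l + 1)) Z * bigJacobiSum q l (n + 1) Y Z := by
  rw [bigJacobiSum_eq_sum (by omega : l + 1 < l + 3), bigJacobiSum_eq_sum (by omega : l + 2 < l + 3),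
    bigJacobiSum_eq_sum (by omega : l + 1 < l + 3), bigJacobiSum_eq_sum (by omega : l < l + 3),
    Finset.mul_sum, Finset.mul_sum, Finset.mul_sum, ← Finset.sum_sub_distrib,
    ← Finset.sum_sub_distrib]
  -- This relation does not involve Y in its coefficients and holds term by term, without
  -- telescoping.
  refine Finset.sum_congr rfl fun k _ => ?_
  rw [bigJacobiTerm_left hq0 hq1 l n k Y hZ, bigJacobiTerm_up l,
    bigJacobiTerm_eq hq0 hq1 l, bigJacobiTerm_down hq0 hq1 l]
  have h1 := (one_sub_mul_pow_sq_pos hq0 hq1 (l + 1)).ne'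
  have hL : 0 < q ^ (l + 1) := by positivity
  have hN : 0 < q ^ (n + 1) := by positivity
  have hx : 0 < q ^ k := by positivity
  generalize contigTerm q l (n + 1) Y Z k = b at *
  unfold contigUp contigMid contigDown
  generalize q ^ (l + 1) = L at *
  generalize q ^ (n + 1) = N at *
  generalize q ^ k = x at *
  have h2 : 1 + q * L ≠ 0 := by positivity
  have h3 : 1 + L ≠ 0 := by positivity
  field_simp
  ring

/-- Multiplication by the argument, in terms of functions with the same second index. -/
theorem bigJacobiSum_mul_arg (l n : ℕ) (Y : ℝ) {Z : ℝ} (hZ : Z < 0) :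
    (Y / (q * q ^ n * Z) - (1 + 1 / Z) / (1 + q)) * bigJacobiSum q (l + 1) n Y Z =
      (1 - q * q ^ (l + 1) / q ^ n) / (q * q ^ n * Z) * contigUp q (q ^ (l + 1)) Z *
          bigJacobiSum q (l + 2) n Y Z +
        ((1 + q) * q ^ (l + 1) / q ^ n - 1 - q * (q ^ (l + 1)) ^ 2) / (Z * (1 + q)) *
          contigMid q (q ^ (l + 1)) Z * bigJacobiSum q (l + 1) n Y Z +
        q ^ (l + 1) * (1 - q ^ (l + 1) * q ^ n) / Z * contigDown q (q ^ (l + 1)) Z *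
          bigJacobiSum q l n Y Z := by
  rw [← sub_eq_zero]
  rw [bigJacobiSum_eq_sum (by omega : l + 1 < l + 3), bigJacobiSum_eq_sum (by omega : l + 2 < l + 3),
    bigJacobiSum_eq_sum (by omega : l < l + 3),
    Finset.mul_sum, Finset.mul_sum, Finset.mul_sum, Finset.mul_sum, ← Finset.sum_add_distrib,
    ← Finset.sum_add_distrib, ← Finset.sum_sub_distrib]
  -- T vanishes at k = 0 through 1 - q^k and at k = l + 3 through `contigTerm`. Its remaining
  -- factors are the denominators of `contigTerm_succ` shifted back by one, so that T(k+1) has no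
  -- denominators depending on k except powers of q.
  refine sum_eq_zero_of_telescope (T := fun k => contigTerm q l n Y Z k *
    (q ^ (l + 1) * (1 - q ^ k) * (1 - q ^ n * q ^ k) * (1 - Z * (q ^ n * q ^ k)) /
      ((q ^ n) ^ 2 * Z * (q ^ k) ^ 2))) (fun k => ?_) (by simp)
    (by simp [contigTerm_eq_zero (by omega : l + 2 < n + (l + 3))])
  rw [bigJacobiTerm_up l, bigJacobiTerm_eq hq0 hq1 l, bigJacobiTerm_down hq0 hq1 l,
    contigTerm_succ hq0 hq1, pow_succ' q k]
  have h1 := (one_sub_mul_pow_sq_pos hq0 hq1 (l + 1)).ne'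
  have hL : 0 < q ^ (l + 1) := by positivity
  have hN : 0 < q ^ n := by positivity
  have hx : 0 < q ^ k := by positivity
  have h4 : 1 - q * q ^ k ≠ 0 := by
    rw [← pow_succ']; exact one_sub_pow_ne_zero hq0 hq1 (by omega)
  have h5 : 1 - q * (q ^ n * q ^ k) ≠ 0 := by
    rw [← pow_add, ← pow_succ']; exact one_sub_pow_ne_zero hq0 hq1 (by omega)
  have h6 : 1 - q * Z * (q ^ n * q ^ k) ≠ 0 := by
    have : Z * (q * (q ^ n * q ^ k)) < 0 := mul_neg_of_neg_of_pos hZ (by positivity)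
    linarith
  generalize contigTerm q l n Y Z k = b at *
  unfold contigUp contigMid contigDown
  generalize q ^ (l + 1) = L at *
  generalize q ^ n = N at *
  generalize q ^ k = x at *
  have h2 : 1 + q * L ≠ 0 := by positivity
  have h3 : 1 + L ≠ 0 := by positivity
  have h7 : 1 + q ≠ 0 := by positivity
  have hZ' := hZ.ne
  have e1 : b * (-(q * x * N / L) * (1 - L * (N * x)) * (1 - q * L / (N * x)) * (1 - Y * x) /
      ((1 - q * x) * (1 - q * (N * x)) * (1 - q * Z * (N * x)))) *
      (L * (1 - q * x) * (1 - N * (q * x)) * (1 - Z * (N * (q * x))) / (N ^ 2 * Z * (q * x) ^ 2)) =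
      b * (-(1 - L * (N * x)) * (1 - q * L / (N * x)) * (1 - Y * x) / (q * N * Z * x)) := by
    have h5' : 1 - N * (q * x) = 1 - q * (N * x) := by ring
    have h6' : 1 - Z * (N * (q * x)) = 1 - q * Z * (N * x) := by ring
    rw [h5', h6']
    generalize 1 - q * (N * x) = A at *
    generalize 1 - q * Z * (N * x) = A' at *
    generalize 1 - q * x = A'' at *
    field_simp
  rw [e1]
  clear e1 h4 h5 h6
  field_simp
  ring

set_option maxRecDepth 4000 in
/-- The expansion of `G_{l,n+1}`, times a quadratic factor, in the functions with second index
`n`. -/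
theorem bigJacobiSum_right (l n : ℕ) (Y : ℝ) {Z : ℝ} (hZ : Z < 0) :
    (1 - Y / (q * q ^ n * Z)) * (1 - Y / (q * q ^ n)) * bigJacobiSum q (l + 1) (n + 1) Y Z =
      (1 - q * q ^ (l + 1) / q ^ n) * (1 - q ^ (l + 1) / q ^ n) / (q ^ 2 * (q ^ n) ^ 2 * Z) *
          contigUp q (q ^ (l + 1)) Z * bigJacobiSum q (l + 2) n Y Z +
        q ^ (l + 1) * (1 - q ^ (l + 1) / q ^ n) * (1 - q * q ^ (l + 1) * q ^ n) /
          (q * (q ^ n) ^ 2 * Z) *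
          contigMid q (q ^ (l + 1)) Z * bigJacobiSum q (l + 1) n Y Z -
        (q ^ (l + 1)) ^ 2 * (1 - q ^ (l + 1) * q ^ n) * (1 - q * q ^ (l + 1) * q ^ n) /
          (q * (q ^ n) ^ 2 * Z) * contigDown q (q ^ (l + 1)) Z *
          bigJacobiSum q l n Y Z := by
  rw [← sub_eq_zero]
  rw [bigJacobiSum_eq_sum (by omega : l + 1 < l + 3), bigJacobiSum_eq_sum (by omega : l + 2 < l + 3),
    bigJacobiSum_eq_sum (by omega : l + 1 < l + 3), bigJacobiSum_eq_sum (by omega : l < l + 3),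
    Finset.mul_sum, Finset.mul_sum, Finset.mul_sum, Finset.mul_sum, ← Finset.sum_add_distrib,
    ← Finset.sum_sub_distrib, ← Finset.sum_sub_distrib]
  refine sum_eq_zero_of_telescope (T := fun k => contigTerm q l n Y Z k *
    (-(q ^ (l + 1) / (q * q ^ n)) * (1 - q ^ (l + 1) * (q ^ n * q ^ k)) *
        (1 - q * q ^ (l + 1) / (q ^ n * q ^ k)) * (1 - q ^ k) *
        ((1 - 1 / (q ^ n * q ^ k)) / (q ^ n * q ^ k * Z) +
          (1 - 1 / (q * (q ^ n * q ^ k) * Z)) / (q ^ n * q ^ k) +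
          (1 - Y * q ^ k) / (q * Z * (q ^ n * q ^ k) ^ 2)) +
      (q ^ (l + 1)) ^ 2 * (1 - q ^ k) * (1 - q ^ k / q) * (1 - q ^ n * q ^ k) *
        (1 - Z * (q ^ n * q ^ k)) / ((q ^ n) ^ 2 * q ^ k * (q ^ n * q ^ k) ^ 2 * Z)))
    (fun k => ?_) (by simp)
    (by simp [contigTerm_eq_zero (by omega : l + 2 < n + (l + 3))])
  rw [bigJacobiTerm_right hq0 hq1 l, bigJacobiTerm_up l, bigJacobiTerm_eq hq0 hq1 l,
    bigJacobiTerm_down hq0 hq1 l, contigTerm_succ hq0 hq1, pow_succ' q k]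
  have h1 := (one_sub_mul_pow_sq_pos hq0 hq1 (l + 1)).ne'
  have hL : 0 < q ^ (l + 1) := by positivity
  have hN : 0 < q ^ n := by positivity
  have hx : 0 < q ^ k := by positivity
  have h4 : 1 - q * q ^ k ≠ 0 := by
    rw [← pow_succ']; exact one_sub_pow_ne_zero hq0 hq1 (by omega)
  have h5 : 1 - q * (q ^ n * q ^ k) ≠ 0 := by
    rw [← pow_add, ← pow_succ']; exact one_sub_pow_ne_zero hq0 hq1 (by omega)
  have h6 : 1 - q * Z * (q ^ n * q ^ k) ≠ 0 := by
    have : Z * (q * (q ^ n * q ^ k)) < 0 := mul_neg_of_neg_of_pos hZ (by positivity)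
    linarith
  generalize contigTerm q l n Y Z k = b at *
  unfold contigUp contigMid contigDown
  generalize q ^ (l + 1) = L at *
  generalize q ^ n = N at *
  generalize q ^ k = x at *
  have h2 : 1 + q * L ≠ 0 := by positivity
  have h3 : 1 + L ≠ 0 := by positivity
  have hZ' := hZ.ne
  have hq := hq0.ne'
  have hL' := hL.ne'
  have hN' := hN.ne'
  have hx' := hx.ne'
  have hD : 1 - N * (q * x) = 1 - q * (N * x) := by ring
  have hD' : 1 - Z * (N * (q * x)) = 1 - q * Z * (N * x) := by ring
  -- Division with remainder of the quadratic in Y by 1 - Yx. The remainder, its value at Y = 1/x,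
  -- contains precisely the two denominators of `bigJacobiTerm_right`, while the multiple of 1 - Yx
  -- is absorbed by T(k+1).
  have e0 : (1 - Y / (q * N * Z)) * (1 - Y / (q * N)) =
      (1 - Y * x) * ((1 - 1 / (N * (q * x))) / (N * (q * x) * Z) +
          (1 - 1 / (q * (N * (q * x)) * Z)) / (N * (q * x)) +
          (1 - Y * (q * x)) / (q * Z * (N * (q * x)) ^ 2)) +
        (1 - q * (N * x)) * (1 - q * Z * (N * x)) / (q ^ 2 * (N * x) ^ 2 * Z) := by
    field_simp
    ring
  rw [e0, hD, hD']
  have e1 : b * (-(q * x * N / L) * (1 - L * (N * x)) * (1 - q * L / (N * x)) * (1 - Y * x) /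
      ((1 - q * x) * (1 - q * (N * x)) * (1 - q * Z * (N * x)))) *
      (-(L / (q * N)) * (1 - L * (N * (q * x))) * (1 - q * L / (N * (q * x))) * (1 - q * x) *
        ((1 - 1 / (N * (q * x))) / (N * (q * x) * Z) +
          (1 - 1 / (q * (N * (q * x)) * Z)) / (N * (q * x)) +
          (1 - Y * (q * x)) / (q * Z * (N * (q * x)) ^ 2)) +
      L ^ 2 * (1 - q * x) * (1 - q * x / q) * (1 - q * (N * x)) * (1 - q * Z * (N * x)) /
        (N ^ 2 * (q * x) * (N * (q * x)) ^ 2 * Z)) =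
      (1 - Y * x) * ((1 - 1 / (N * (q * x))) / (N * (q * x) * Z) +
          (1 - 1 / (q * (N * (q * x)) * Z)) / (N * (q * x)) +
          (1 - Y * (q * x)) / (q * Z * (N * (q * x)) ^ 2)) *
        (b * (x * (1 - L * (N * x)) * (1 - q * L * (N * x)) * (1 - q * L / (N * x)) *
          (1 - L / (N * x)) / ((1 - q * (N * x)) * (1 - q * Z * (N * x))))) -
      b * (L * (1 - L * (N * x)) * (1 - q * L / (N * x)) * (1 - Y * x) * (1 - x) /
        (N * q ^ 2 * (N * x) ^ 2 * Z)) := by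
    rw [show 1 - L * (N * (q * x)) = 1 - q * L * (N * x) by ring,
      show q * L / (N * (q * x)) = L / (N * x) by field_simp,
      show q * x / q = x by field_simp]
    generalize (1 - 1 / (N * (q * x))) / (N * (q * x) * Z) +
          (1 - 1 / (q * (N * (q * x)) * Z)) / (N * (q * x)) +
          (1 - Y * (q * x)) / (q * Z * (N * (q * x)) ^ 2) = R
    generalize 1 - q * (N * x) = A at *
    generalize 1 - q * Z * (N * x) = A' at *
    generalize 1 - q * x = A'' at *
    generalize 1 - L * (N * x) = B
    generalize 1 - q * L * (N * x) = B'
    generalize 1 - q * L / (N * x) = C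
    generalize 1 - L / (N * x) = C'
    generalize 1 - Y * x = y
    field_simp
    ring
  rw [e1]
  generalize (1 - Y * x) * ((1 - 1 / (N * (q * x))) / (N * (q * x) * Z) +
          (1 - 1 / (q * (N * (q * x)) * Z)) / (N * (q * x)) +
          (1 - Y * (q * x)) / (q * Z * (N * (q * x)) ^ 2)) = R
  have e2 : (R + (1 - q * (N * x)) * (1 - q * Z * (N * x)) / (q ^ 2 * (N * x) ^ 2 * Z)) *
      (b * (x * (1 - L * (N * x)) * (1 - q * L * (N * x)) * (1 - q * L / (N * x)) *
          (1 - L / (N * x)) / ((1 - q * (N * x)) * (1 - q * Z * (N * x))))) =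
      R * (b * (x * (1 - L * (N * x)) * (1 - q * L * (N * x)) * (1 - q * L / (N * x)) *
          (1 - L / (N * x)) / ((1 - q * (N * x)) * (1 - q * Z * (N * x))))) +
      b * (x * (1 - L * (N * x)) * (1 - q * L * (N * x)) * (1 - q * L / (N * x)) *
          (1 - L / (N * x)) / (q ^ 2 * (N * x) ^ 2 * Z)) := by
    generalize 1 - q * (N * x) = A at *
    generalize 1 - q * Z * (N * x) = A' at *
    generalize 1 - L * (N * x) = B
    generalize 1 - q * L * (N * x) = B'
    generalize 1 - q * L / (N * x) = C
    generalize 1 - L / (N * x) = C'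
    field_simp
  rw [e2]
  generalize R * (b * (x * (1 - L * (N * x)) * (1 - q * L * (N * x)) * (1 - q * L / (N * x)) *
          (1 - L / (N * x)) / ((1 - q * (N * x)) * (1 - q * Z * (N * x))))) = S
  clear e0 e1 e2 h4 h5 h6 hD hD'
  have key : x * (1 - L * (N * x)) * (1 - q * L * (N * x)) * (1 - q * L / (N * x)) *
          (1 - L / (N * x)) / (q ^ 2 * (N * x) ^ 2 * Z) +
      L * (1 - L * (N * x)) * (1 - q * L / (N * x)) * (1 - Y * x) * (1 - x) /
        (N * q ^ 2 * (N * x) ^ 2 * Z) +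
      (-(L / (q * N)) * (1 - L * (N * x)) * (1 - q * L / (N * x)) * (1 - x) *
        ((1 - 1 / (N * x)) / (N * x * Z) + (1 - 1 / (q * (N * x) * Z)) / (N * x) +
          (1 - Y * x) / (q * Z * (N * x) ^ 2)) +
      L ^ 2 * (1 - x) * (1 - x / q) * (1 - N * x) * (1 - Z * (N * x)) /
        (N ^ 2 * x * (N * x) ^ 2 * Z)) =
      (1 - q * L / N) * (1 - L / N) / (q ^ 2 * N ^ 2 * Z) *
        ((1 - Z * q * L) / ((1 - q * L ^ 2) * (1 + q * L))) *
        ((1 - L * (N * x)) * (1 - q * L * (N * x)) / x) +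
      L * (1 - L / N) * (1 - q * L * N) / (q * N ^ 2 * Z) * ((1 + Z) / ((1 + q * L) * (1 + L))) *
        ((1 - L * (N * x)) * (1 - q * L / (N * x))) -
      L ^ 2 * (1 - L * N) * (1 - q * L * N) / (q * N ^ 2 * Z) *
        ((L - Z) / ((1 - q * L ^ 2) * (1 + L))) *
        (x * (1 - q * L / (N * x)) * (1 - L / (N * x))) := by
    obtain ⟨δ, hδ⟩ : ∃ δ, δ = 1 - q * L ^ 2 := ⟨_, rfl⟩
    rw [← hδ] at h1 ⊢
    field_simp
    rw [hδ]
    ring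
  linear_combination b * key

omit hq0 hq1 in
theorem one_sub_mul_bigJacobiTerm (l n k : ℕ) (Y Z : ℝ) :
    (1 - Y) * bigJacobiTerm q l n (q * Y) Z k = (1 - Y * q ^ k) * bigJacobiTerm q l n Y Z k := by
  have h : (1 - Y) * qPoch (q * Y) q k = (1 - Y * q ^ k) * qPoch Y q k := by
    rw [mul_comm q Y, ← qPoch_succ', qPoch_succ, mul_comm]
  unfold bigJacobiTerm
  linear_combination (signedPow q (q ^ l / q ^ n) k * qPoch q q (l + n + k) * qFactInv q l (n + k) /
    (qPoch q q k * qPoch q q (n + k)) / qPoch (Z * q) q (n + k)) * h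

/-- The analogue of `bigJacobiSum_left` for second index `-1`. -/
theorem bigJacobiSum_left_zero (l : ℕ) (Y : ℝ) {Z : ℝ} (hZ : Z < 0) :
    q * Z / (q ^ (l + 1) * (1 - q ^ (l + 1)) * (1 - q * q ^ (l + 1))) * ((1 - Y / Z) * (1 - Y)) *
        bigJacobiSum q (l + 1) 1 (q * Y) Z =
      contigUp q (q ^ (l + 1)) Z * bigJacobiSum q (l + 2) 0 Y Z -
        contigMid q (q ^ (l + 1)) Z * bigJacobiSum q (l + 1) 0 Y Z -
        contigDown q (q ^ (l + 1)) Z * bigJacobiSum q l 0 Y Z := by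
  rw [← sub_eq_zero]
  rw [bigJacobiSum_eq_sum (by omega : l + 1 < l + 3), bigJacobiSum_eq_sum (by omega : l + 2 < l + 3),
    bigJacobiSum_eq_sum (by omega : l + 1 < l + 3), bigJacobiSum_eq_sum (by omega : l < l + 3),
    Finset.mul_sum, Finset.mul_sum, Finset.mul_sum, Finset.mul_sum, ← Finset.sum_sub_distrib,
    ← Finset.sum_sub_distrib, ← Finset.sum_sub_distrib]
  refine sum_eq_zero_of_telescope (T := fun k => contigTerm q l 0 Y Z k *
    (q * Z / (q ^ (l + 1) * (1 - q ^ (l + 1)) * (1 - q * q ^ (l + 1))) *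
      ((1 - Y / Z) * (-(q ^ (l + 1) / q) * (1 - q ^ (l + 1) * q ^ k) *
        (1 - q * q ^ (l + 1) / q ^ k) * (1 - q ^ k)) +
      (q ^ (l + 1)) ^ 2 / (q ^ k * q ^ k * Z) * (1 - q ^ k) ^ 2 * (1 - q ^ k / q) *
        (1 - Z * q ^ k))))
    (fun k => ?_) (by simp)
    (by simp [contigTerm_eq_zero (by omega : l + 2 < 0 + (l + 3))])
  -- The factor 1 - Y exchanges the argument qY for Y at the price of 1 - Y q^k, after which all
  -- terms are multiples of the same `contigTerm`.
  have h0 := one_sub_mul_bigJacobiTerm (q := q) (l + 1) 1 k Y Z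
  rw [mul_assoc _ _ (bigJacobiTerm q (l + 1) 1 (q * Y) Z k), mul_assoc (1 - Y / Z), h0]
  rw [bigJacobiTerm_right hq0 hq1 l 0, bigJacobiTerm_up l, bigJacobiTerm_eq hq0 hq1 l,
    bigJacobiTerm_down hq0 hq1 l, contigTerm_succ hq0 hq1, pow_succ' q k]
  simp only [pow_zero, one_mul, mul_one]
  have h1 := (one_sub_mul_pow_sq_pos hq0 hq1 (l + 1)).ne'
  have hL : 0 < q ^ (l + 1) := by positivity
  have hx : 0 < q ^ k := by positivity
  have h4 : 1 - q * q ^ k ≠ 0 := by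
    rw [← pow_succ']; exact one_sub_pow_ne_zero hq0 hq1 (by omega)
  have h6 : 1 - q * Z * q ^ k ≠ 0 := by
    have : Z * (q * q ^ k) < 0 := mul_neg_of_neg_of_pos hZ (by positivity)
    linarith
  have h7 : 1 - q * q ^ (l + 1) ≠ 0 := by
    rw [← pow_succ']; exact one_sub_pow_ne_zero hq0 hq1 (by omega)
  have h8 : 1 - q ^ (l + 1) ≠ 0 := one_sub_pow_ne_zero hq0 hq1 (by omega)
  generalize contigTerm q l 0 Y Z k = b at *
  unfold contigUp contigMid contigDown
  clear h0
  generalize q ^ (l + 1) = L at *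
  generalize q ^ k = x at *
  have h2 : 1 + q * L ≠ 0 := by positivity
  have h3 : 1 + L ≠ 0 := by positivity
  have hZ' := hZ.ne
  have hq := hq0.ne'
  have hL' := hL.ne'
  have hx' := hx.ne'
  obtain ⟨ζ, hζ⟩ : ∃ ζ, ζ = q * Z / (L * (1 - L) * (1 - q * L)) := ⟨_, rfl⟩
  rw [← hζ]
  have e1 : b * (-(q * x / L) * (1 - L * x) * (1 - q * L / x) * (1 - Y * x) /
      ((1 - q * x) * (1 - q * x) * (1 - q * Z * x))) *
      (ζ * ((1 - Y / Z) * (-(L / q) * (1 - L * (q * x)) * (1 - q * L / (q * x)) * (1 - q * x)) +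
        L ^ 2 / (q * x * (q * x) * Z) * (1 - q * x) ^ 2 * (1 - q * x / q) * (1 - Z * (q * x)))) =
      ζ * ((1 - Y / Z) * ((1 - Y * x) * (b * (x * (1 - L * x) * (1 - q * L * x) *
        (1 - q * L / x) * (1 - L / x) / ((1 - q * x) * (1 - q * Z * x)))))) -
      b * (ζ * (L * (1 - L * x) * (1 - q * L / x) * (1 - Y * x) * (1 - x) / (q * x * Z))) := by
    rw [show 1 - L * (q * x) = 1 - q * L * x by ring,
      show q * L / (q * x) = L / x by field_simp,
      show q * x / q = x by field_simp, show 1 - Z * (q * x) = 1 - q * Z * x by ring]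
    generalize 1 - q * Z * x = A' at *
    generalize 1 - q * x = A'' at *
    generalize 1 - L * x = B
    generalize 1 - q * L * x = B'
    generalize 1 - q * L / x = C
    generalize 1 - L / x = C'
    generalize 1 - Y * x = y
    generalize 1 - Y / Z = y'
    field_simp
    ring
  rw [e1]
  clear e1 h4 h6
  have key : ζ * (L * (1 - L * x) * (1 - q * L / x) * (1 - Y * x) * (1 - x) / (q * x * Z)) +
      ζ * ((1 - Y / Z) * (-(L / q) * (1 - L * x) * (1 - q * L / x) * (1 - x)) +
        L ^ 2 / (x * x * Z) * (1 - x) ^ 2 * (1 - x / q) * (1 - Z * x)) =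
      (1 - Z * q * L) / ((1 - q * L ^ 2) * (1 + q * L)) *
        ((1 - L * x) * (1 - q * L * x) / x) -
      (1 + Z) / ((1 + q * L) * (1 + L)) * ((1 - L * x) * (1 - q * L / x)) -
      (L - Z) / ((1 - q * L ^ 2) * (1 + L)) * (x * (1 - q * L / x) * (1 - L / x)) := by
    rw [hζ]
    obtain ⟨δ, hδ⟩ : ∃ δ, δ = 1 - q * L ^ 2 := ⟨_, rfl⟩
    rw [← hδ] at h1 ⊢
    field_simp
    rw [hδ]
    ring
  linear_combination b * key

end

end QSpecial

end

/-! ### Three-term recurrence of the continuous dual q-Hahn polynomials. -/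

noncomputable section

namespace QSpecial

theorem qPoch_zero_left (q : ℝ) (k : ℕ) : qPoch 0 q k = 1 := by simp [qPoch]

theorem qPochPair_succ (a x q : ℝ) (k : ℕ) :
    qPochPair a x q (k + 1) = qPochPair a x q k * (1 - 2 * (a * q ^ k) * x + (a * q ^ k) ^ 2) :=
  Finset.prod_range_succ _ _

section

variable {q : ℝ} (hq0 : 0 < q) (hq1 : q < 1)

include hq0 hq1

/-- Rewrites the terminating factor of a basic hypergeometric series so that the degree enters
through quantities with simple shift rules in m. -/
theorem qPoch_neg_pow (m k : ℕ) :
    qPoch (q ^ (-(m : ℤ))) q k * q ^ k = signedPow q (q ^ m) k * qPoch q q m * qFactInv q m k := by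
  have hq := hq0.ne'
  induction k with
  | zero =>
    have := (qPoch_self_pos hq0 hq1 m).ne'
    simp [qPoch, signedPow, qFactInv] at this ⊢
    field_simp
  | succ k ih =>
    rw [qPoch_succ, signedPow_succ, qFactInv_succ_right hq0 hq1]
    have h : q ^ (-(m : ℤ)) = (q ^ m)⁻¹ := by rw [zpow_neg, zpow_natCast]
    have hm : q ^ m ≠ 0 := pow_ne_zero _ hq
    have hk : q ^ k ≠ 0 := pow_ne_zero _ hq
    have e : signedPow q (q ^ m) k * -(q ^ (k + 1) / q ^ m) * qPoch q q m *
        ((1 - q ^ m / q ^ k) * qFactInv q m k) =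
        (signedPow q (q ^ m) k * qPoch q q m * qFactInv q m k) *
          (-(q ^ (k + 1) / q ^ m) * (1 - q ^ m / q ^ k)) := by ring
    rw [e, ← ih, h]
    field_simp
    ring

theorem qPoch_pow_succ (l k : ℕ) :
    qPoch (q ^ (l + 1)) q k = qPoch q q (l + k) / qPoch q q l := by
  have := (qPoch_self_pos hq0 hq1 l).ne'
  induction k with
  | zero => simp [qPoch] at this ⊢; field_simp
  | succ k ih =>
    rw [qPoch_succ, ih, ← add_assoc, qPoch_succ]
    ring

/-- The continuous dual `q`-Hahn polynomial, divided by its value `(q;q)_m` at `e^{iθ} = a`. -/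
def dualHahnSum (q a b c X : ℝ) (m : ℕ) : ℝ :=
  ∑ k ∈ Finset.range (m + 1), signedPow q (q ^ m) k * qFactInv q m k / qPoch q q k *
    (qPochPair a X q k / (qPoch (a * b) q k * qPoch (a * c) q k))

theorem askeyWilson_zero_right (m : ℕ) (X a b c : ℝ) :
    askeyWilson m X a b c 0 q =
      (a ^ m)⁻¹ * (qPoch (a * b) q m * qPoch (a * c) q m) * qPoch q q m *
        dualHahnSum q a b c X m := by
  unfold askeyWilson dualHahnSum
  simp only [mul_zero, zero_mul, qPoch_zero_left, mul_one]
  rw [mul_assoc _ (qPoch q q m), Finset.mul_sum (a := qPoch q q m)]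
  refine congrArg _ ?_
  refine Finset.sum_congr rfl fun k _ => ?_
  have h := qPoch_neg_pow hq0 hq1 m k
  simp only [div_eq_mul_inv, mul_inv]
  linear_combination (qPochPair a X q k * ((qPoch q q k)⁻¹ * (qPoch (a * b) q k)⁻¹ *
    (qPoch (a * c) q k)⁻¹)) * h

omit hq0 hq1 in
theorem dualHahnSum_eq_sum {m M : ℕ} (h : m < M) (a b c X : ℝ) :
    dualHahnSum q a b c X m =
      ∑ k ∈ Finset.range M, signedPow q (q ^ m) k * qFactInv q m k / qPoch q q k *
        (qPochPair a X q k / (qPoch (a * b) q k * qPoch (a * c) q k)) := by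
  unfold dualHahnSum
  refine Finset.sum_subset (Finset.range_subset_range.2 (by omega)) fun k _ hk => ?_
  rw [Finset.mem_range, not_lt] at hk
  simp [qFactInv_of_lt q (by omega : m < k)]

/-- Multiplication by X raises k in the basis (a e^{iθ}, a e^{-iθ};q)_k, because the next basis
element is the present one times 1 - 2aq^kX + a²q^{2k}. Hence the difference of the two sides
telescopes. -/
theorem dualHahnSum_recurrence (m : ℕ) {a b c : ℝ} (ha : a ≠ 0) (hab : a * b < 1)
    (hac : a * c < 1) (X : ℝ) :
    2 * X * dualHahnSum q a b c X (m + 1) =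
      (1 - a * b * q ^ (m + 1)) * (1 - a * c * q ^ (m + 1)) / a * (1 - q * q ^ (m + 1)) *
          dualHahnSum q a b c X (m + 2) +
        (a + 1 / a - (1 - a * b * q ^ (m + 1)) * (1 - a * c * q ^ (m + 1)) / a -
          a * (1 - q ^ (m + 1)) * (1 - b * c * q ^ (m + 1) / q)) * dualHahnSum q a b c X (m + 1) +
        a * (1 - b * c * q ^ (m + 1) / q) * dualHahnSum q a b c X m := by
  have hq := hq0.ne'
  rw [← sub_eq_zero]
  rw [dualHahnSum_eq_sum (by omega : m + 1 < m + 3), dualHahnSum_eq_sum (by omega : m + 2 < m + 3),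
    dualHahnSum_eq_sum (by omega : m < m + 3),
    Finset.mul_sum, Finset.mul_sum, Finset.mul_sum, Finset.mul_sum, ← Finset.sum_add_distrib,
    ← Finset.sum_add_distrib, ← Finset.sum_sub_distrib]
  refine sum_eq_zero_of_telescope (T := fun k =>
    signedPow q (q ^ (m + 1)) k * qFactInv q (m + 2) k / qPoch q q k *
      (qPochPair a X q k / (qPoch (a * b) q k * qPoch (a * c) q k)) *
    (q * q ^ (m + 1) / (a * (q ^ k) ^ 2) * (1 - q ^ k) * (1 - a * b * q ^ k / q) *
      (1 - a * c * q ^ k / q)))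
    (fun k => ?_) (by simp) (by simp [qFactInv_of_lt q (by omega : m + 2 < m + 3)])
  have h4 : 1 - q * q ^ k ≠ 0 := by
    rw [← pow_succ']; exact one_sub_pow_ne_zero hq0 hq1 (by omega)
  have h5 : 1 - a * b * q ^ k ≠ 0 := by have := mul_pow_lt_one hq1 hq0.le hab k; linarith
  have h6 : 1 - a * c * q ^ k ≠ 0 := by have := mul_pow_lt_one hq1 hq0.le hac k; linarith
  have hL : q ^ (m + 1) ≠ 0 := pow_ne_zero _ hq
  have hx : q ^ k ≠ 0 := pow_ne_zero _ hq
  have s1 : signedPow q (q ^ (m + 2)) k = signedPow q (q ^ (m + 1)) k / q ^ k := by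
    rw [pow_succ q (m + 1), signedPow_mul]
  have s2 : signedPow q (q ^ m) k = signedPow q (q ^ (m + 1)) k * q ^ k := by
    rw [pow_succ q m, signedPow_mul]
    field_simp
  rw [s1, s2, qFactInv_succ_left hq0 hq1 m, qFactInv_succ_left hq0 hq1 (m + 1), signedPow_succ,
    qFactInv_succ_right hq0 hq1 (m + 2) k, qPoch_succ q, qPoch_succ (a * b), qPoch_succ (a * c),
    qPochPair_succ, pow_succ' q k, show q ^ (m + 1 + 1) = q * q ^ (m + 1) by ring,
    show m + 1 + 1 = m + 2 by ring]
  obtain ⟨b', hb'⟩ : ∃ b', b' = signedPow q (q ^ (m + 1)) k * qFactInv q (m + 2) k / qPoch q q k *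
    (qPochPair a X q k / (qPoch (a * b) q k * qPoch (a * c) q k)) := ⟨_, rfl⟩
  have e1 : signedPow q (q ^ (m + 1)) k * -(q * q ^ k / q ^ (m + 1)) *
      ((1 - q * q ^ (m + 1) / q ^ k) * qFactInv q (m + 2) k) /
      (qPoch q q k * (1 - q * q ^ k)) *
      (qPochPair a X q k * (1 - 2 * (a * q ^ k) * X + (a * q ^ k) ^ 2) /
        (qPoch (a * b) q k * (1 - a * b * q ^ k) * (qPoch (a * c) q k * (1 - a * c * q ^ k)))) *
      (q * q ^ (m + 1) / (a * (q * q ^ k) ^ 2) * (1 - q * q ^ k) * (1 - a * b * (q * q ^ k) / q) *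
      (1 - a * c * (q * q ^ k) / q)) =
      b' * (-(1 - q * q ^ (m + 1) / q ^ k) * (1 - 2 * (a * q ^ k) * X + (a * q ^ k) ^ 2) /
        (a * q ^ k)) := by
    rw [hb', show a * b * (q * q ^ k) / q = a * b * q ^ k by field_simp,
      show a * c * (q * q ^ k) / q = a * c * q ^ k by field_simp]
    generalize 1 - a * b * q ^ k = A at *
    generalize 1 - a * c * q ^ k = A' at *
    generalize 1 - q * q ^ k = A'' at *
    generalize 1 - q * q ^ (m + 1) / q ^ k = B
    generalize 1 - 2 * (a * q ^ k) * X + (a * q ^ k) ^ 2 = B'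
    have e2 : A * A⁻¹ = 1 := mul_inv_cancel₀ h5
    have e3 : A' * A'⁻¹ = 1 := mul_inv_cancel₀ h6
    have e4 : A'' * A''⁻¹ = 1 := mul_inv_cancel₀ h4
    have e5 : q ^ (m + 1) * (q ^ (m + 1))⁻¹ = 1 := mul_inv_cancel₀ hL
    have e6 : q ^ k * (q ^ k)⁻¹ = 1 := mul_inv_cancel₀ hx
    have e7 : q * q⁻¹ = 1 := mul_inv_cancel₀ hq
    calc _ = signedPow q (q ^ (m + 1)) k * qFactInv q (m + 2) k / qPoch q q k *
          (qPochPair a X q k / (qPoch (a * b) q k * qPoch (a * c) q k)) *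
          (-B * B' / (a * q ^ k)) * (A * A⁻¹) * (A' * A'⁻¹) * (A'' * A''⁻¹) *
          (q ^ (m + 1) * (q ^ (m + 1))⁻¹) * (q ^ k * (q ^ k)⁻¹) * (q * q⁻¹) ^ 2 := by
          simp only [div_eq_mul_inv, mul_inv, mul_pow]
          ring
      _ = _ := by rw [e2, e3, e4, e5, e6, e7]; ring
  rw [e1]
  have key : (2 * X - (a + 1 / a - (1 - a * b * q ^ (m + 1)) * (1 - a * c * q ^ (m + 1)) / a -
        a * (1 - q ^ (m + 1)) * (1 - b * c * q ^ (m + 1) / q))) * (1 - q * q ^ (m + 1) / q ^ k) -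
      (1 - a * b * q ^ (m + 1)) * (1 - a * c * q ^ (m + 1)) / a * (1 - q * q ^ (m + 1)) / q ^ k -
      a * (1 - b * c * q ^ (m + 1) / q) * (q ^ k * (1 - q * q ^ (m + 1) / q ^ k) *
        (1 - q ^ (m + 1) / q ^ k)) =
      -(1 - q * q ^ (m + 1) / q ^ k) * (1 - 2 * (a * q ^ k) * X + (a * q ^ k) ^ 2) /
        (a * q ^ k) -
      q * q ^ (m + 1) / (a * (q ^ k) ^ 2) * (1 - q ^ k) * (1 - a * b * q ^ k / q) *
      (1 - a * c * q ^ k / q) := by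
    generalize q ^ (m + 1) = M at *
    generalize q ^ k = x at *
    field_simp
    ring
  rw [hb']
  linear_combination (signedPow q (q ^ (m + 1)) k * qFactInv q (m + 2) k / qPoch q q k *
    (qPochPair a X q k / (qPoch (a * b) q k * qPoch (a * c) q k))) * key

end

end QSpecial

end

/-! ### Three-term recurrences in polynomial normalisation; the case ab = cd = q. -/

noncomputable section

namespace QSpecial

section

variable {q : ℝ} (hq0 : 0 < q) (hq1 : q < 1)

include hq0 hq1

/-- The three-term recurrence of the continuous dual `q`-Hahn polynomials. -/
theorem askeyWilson_zero_right_recurrence (m : ℕ) {a b c : ℝ} (ha : a ≠ 0) (hab : a * b < 1)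
    (hac : a * c < 1) (X : ℝ) :
    2 * X * askeyWilson m X a b c 0 q =
      askeyWilson (m + 1) X a b c 0 q +
        (a + 1 / a - (1 - a * b * q ^ m) * (1 - a * c * q ^ m) / a -
          a * (1 - q ^ m) * (1 - b * c * q ^ m / q)) * askeyWilson m X a b c 0 q +
        (1 - q ^ m) * (1 - b * c * q ^ m / q) * (1 - a * b * q ^ m / q) *
          (1 - a * c * q ^ m / q) * askeyWilson (m - 1) X a b c 0 q := by
  have hq := hq0.ne'
  cases m with
  -- For m = 0 the truncated index m - 1 is 0, which is harmless since its coefficient contains 1 -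
  -- q^0.
  | zero =>
    have h1 : 1 - q ≠ 0 := by linarith
    have h2 : 1 - a * b ≠ 0 := by linarith
    have h3 : 1 - a * c ≠ 0 := by linarith
    simp [askeyWilson, qPoch, qPochPair, Finset.sum_range_succ]
    field_simp
    ring
  | succ m =>
    have h := dualHahnSum_recurrence hq0 hq1 m ha hab hac X
    simp only [askeyWilson_zero_right hq0 hq1, Nat.add_sub_cancel]
    rw [qPoch_succ (a * b) (m + 1), qPoch_succ (a * c) (m + 1), qPoch_succ q (m + 1),
      qPoch_succ (a * b) m, qPoch_succ (a * c) m, qPoch_succ q m, pow_succ a (m + 1),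
      pow_succ a m, show m + 1 + 1 = m + 2 by ring]
    have e1 : a * b * q ^ (m + 1) / q = a * b * q ^ m := by rw [pow_succ]; field_simp
    have e2 : a * c * q ^ (m + 1) / q = a * c * q ^ m := by rw [pow_succ]; field_simp
    have e3 : q * q ^ m = q ^ (m + 1) := by ring
    rw [e1, e2, e3]
    have hA : a ^ m ≠ 0 := pow_ne_zero _ ha
    have e4 : a * a⁻¹ = 1 := mul_inv_cancel₀ ha
    simp only [mul_inv]
    linear_combination ((a ^ m)⁻¹ * a⁻¹ * (qPoch (a * b) q m * (1 - a * b * q ^ m) *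
      (qPoch (a * c) q m * (1 - a * c * q ^ m))) * (qPoch q q m * (1 - q ^ (m + 1)))) * h +
      ((a ^ m)⁻¹ * (qPoch (a * b) q m * (1 - a * b * q ^ m) *
      (qPoch (a * c) q m * (1 - a * c * q ^ m))) * (qPoch q q m * (1 - q ^ (m + 1))) *
        (1 - b * c * q ^ (m + 1) / q) * dualHahnSum q a b c X m) * e4

/-- The Askey-Wilson polynomial for `a b = c d = q`, normalised to be `1` at `e^{iθ} = a`. -/
def jacobiSum (q a c d X : ℝ) (l : ℕ) : ℝ :=
  ∑ k ∈ Finset.range (l + 1), bigJacobiTerm q l 0 0 0 k *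
    (qPochPair a X q k / (qPoch (a * c) q k * qPoch (a * d) q k))

/-- For ab = cd = q one has abcd q^{l-1} = q^{l+1}, so the coefficients are those of a big q-Jacobi
sum with n = Y = Z = 0. The shift rules for `bigJacobiTerm` can then be reused for the recurrence in
l. -/
theorem askeyWilson_eq_jacobiSum (l : ℕ) (X : ℝ) {a b c d : ℝ} (hab : a * b = q)
    (hcd : c * d = q) :
    askeyWilson l X a b c d q =
      (a ^ l)⁻¹ * (qPoch q q l * qPoch (a * c) q l * qPoch (a * d) q l) *
        jacobiSum q a c d X l := by
  have hq := hq0.ne'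
  have e : a * b * c * d * q ^ ((l : ℤ) - 1) = q ^ (l + 1) := by
    rw [show a * b * c * d = (a * b) * (c * d) by ring, hab, hcd, zpow_sub₀ hq, zpow_natCast,
      zpow_one]
    field_simp
    ring
  unfold askeyWilson jacobiSum
  rw [e, hab]
  refine congrArg _ (Finset.sum_congr rfl fun k _ => ?_)
  have h := qPoch_neg_pow hq0 hq1 l k
  have h1 := (qPoch_self_pos hq0 hq1 l).ne'
  rw [qPoch_pow_succ hq0 hq1]
  simp only [bigJacobiTerm, zero_mul, qPoch_zero_left, pow_zero, div_one, add_zero, zero_add,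
    mul_one]
  have h2 : qPoch q q l * (qPoch q q l)⁻¹ = 1 := mul_inv_cancel₀ h1
  simp only [div_eq_mul_inv, mul_inv]
  linear_combination (qPochPair a X q k * qPoch q q (l + k) * (qPoch q q l)⁻¹ *
      ((qPoch q q k)⁻¹ * (qPoch q q k)⁻¹ * (qPoch (a * c) q k)⁻¹ * (qPoch (a * d) q k)⁻¹)) * h +
    (signedPow q (q ^ l) k * qFactInv q l k * qPochPair a X q k * qPoch q q (l + k) *
      ((qPoch q q k)⁻¹ * (qPoch q q k)⁻¹ * (qPoch (a * c) q k)⁻¹ * (qPoch (a * d) q k)⁻¹)) * h2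

omit hq0 hq1 in
theorem jacobiSum_eq_sum {l M : ℕ} (h : l < M) (a c d X : ℝ) :
    jacobiSum q a c d X l =
      ∑ k ∈ Finset.range M, bigJacobiTerm q l 0 0 0 k *
        (qPochPair a X q k / (qPoch (a * c) q k * qPoch (a * d) q k)) := by
  unfold jacobiSum
  refine Finset.sum_subset (Finset.range_subset_range.2 (by omega)) fun k _ hk => ?_
  rw [Finset.mem_range, not_lt] at hk
  rw [bigJacobiTerm_eq_zero (by omega), zero_mul]

theorem jacobiSum_recurrence (l : ℕ) {a b c d : ℝ} (hab : a * b = q) (hcd : c * d = q)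
    (hac : a * c < 1) (had : a * d < 1) (X : ℝ) :
    2 * X * jacobiSum q a c d X (l + 1) =
      (1 - q * q ^ (l + 1)) * (1 - a * c * q ^ (l + 1)) * (1 - a * d * q ^ (l + 1)) /
          (a * ((1 - q * (q ^ (l + 1)) ^ 2) * (1 + q * q ^ (l + 1)))) *
          jacobiSum q a c d X (l + 2) +
        (a + 1 / a - (1 - q * q ^ (l + 1)) * (1 - a * c * q ^ (l + 1)) * (1 - a * d * q ^ (l + 1)) /
          (a * ((1 - q * (q ^ (l + 1)) ^ 2) * (1 + q * q ^ (l + 1)))) -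
          a * (1 - q ^ (l + 1)) * (1 - b * c * q ^ (l + 1) / q) * (1 - b * d * q ^ (l + 1) / q) /
            ((1 + q ^ (l + 1)) * (1 - q * (q ^ (l + 1)) ^ 2))) * jacobiSum q a c d X (l + 1) +
        a * (1 - q ^ (l + 1)) * (1 - b * c * q ^ (l + 1) / q) * (1 - b * d * q ^ (l + 1) / q) /
            ((1 + q ^ (l + 1)) * (1 - q * (q ^ (l + 1)) ^ 2)) * jacobiSum q a c d X l := by
  have hq := hq0.ne'
  have ha : a ≠ 0 := by rintro rfl; exact hq (by simpa using hab.symm)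
  have hc : c ≠ 0 := by rintro rfl; exact hq (by simpa using hcd.symm)
  have hb : b = q / a := by rw [← hab]; field_simp
  have hd : d = q / c := by rw [← hcd]; field_simp
  rw [← sub_eq_zero]
  rw [jacobiSum_eq_sum (by omega : l + 1 < l + 3), jacobiSum_eq_sum (by omega : l + 2 < l + 3),
    jacobiSum_eq_sum (by omega : l < l + 3),
    Finset.mul_sum, Finset.mul_sum, Finset.mul_sum, Finset.mul_sum, ← Finset.sum_add_distrib,
    ← Finset.sum_add_distrib, ← Finset.sum_sub_distrib]
  refine sum_eq_zero_of_telescope (T := fun k => contigTerm q l 0 0 0 k *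
      (qPochPair a X q k / (qPoch (a * c) q k * qPoch (a * d) q k)) *
      (q * q ^ (l + 1) / (a * (q ^ k) ^ 2) * (1 - q ^ k) ^ 2 * (1 - a * c * q ^ k / q) *
        (1 - a * d * q ^ k / q)))
    (fun k => ?_) (by simp) (by simp [contigTerm_eq_zero (by omega : l + 2 < 0 + (l + 3))])
  have h4 : 1 - q * q ^ k ≠ 0 := by
    rw [← pow_succ']; exact one_sub_pow_ne_zero hq0 hq1 (by omega)
  have h5 : 1 - a * c * q ^ k ≠ 0 := by have := mul_pow_lt_one hq1 hq0.le hac k; linarith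
  have h6 : 1 - a * d * q ^ k ≠ 0 := by have := mul_pow_lt_one hq1 hq0.le had k; linarith
  rw [bigJacobiTerm_up l, bigJacobiTerm_eq hq0 hq1 l, bigJacobiTerm_down hq0 hq1 l,
    contigTerm_succ hq0 hq1, qPoch_succ (a * c), qPoch_succ (a * d), qPochPair_succ, pow_succ' q k]
  simp only [pow_zero, one_mul, mul_one, mul_zero, zero_mul, sub_zero]
  have h1 := (one_sub_mul_pow_sq_pos hq0 hq1 (l + 1)).ne'
  have hL : 0 < q ^ (l + 1) := by positivity
  have hx : 0 < q ^ k := by positivity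
  generalize contigTerm q l 0 0 0 k = b₀ at *
  generalize qPochPair a X q k = φ at *
  generalize qPoch (a * c) q k = r at *
  generalize qPoch (a * d) q k = r' at *
  generalize q ^ (l + 1) = L at *
  generalize q ^ k = x at *
  have h2 : 1 + q * L ≠ 0 := by positivity
  have h3 : 1 + L ≠ 0 := by positivity
  have hL' := hL.ne'
  have hx' := hx.ne'
  have e1 : b₀ * (-(q * x / L) * (1 - L * x) * (1 - q * L / x) /
      ((1 - q * x) * (1 - q * x))) * (φ * (1 - 2 * (a * x) * X + (a * x) ^ 2) /
        (r * (1 - a * c * x) * (r' * (1 - a * d * x)))) *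
      (q * L / (a * (q * x) ^ 2) * (1 - q * x) ^ 2 * (1 - a * c * (q * x) / q) *
        (1 - a * d * (q * x) / q)) =
      b₀ * (φ / (r * r')) * (-(1 - L * x) * (1 - q * L / x) *
        (1 - 2 * (a * x) * X + (a * x) ^ 2) / (a * x)) := by
    rw [show a * c * (q * x) / q = a * c * x by field_simp,
      show a * d * (q * x) / q = a * d * x by field_simp]
    generalize 1 - a * c * x = A at *
    generalize 1 - a * d * x = A' at *
    generalize 1 - q * x = A'' at *
    generalize 1 - q * L / x = B
    generalize 1 - 2 * (a * x) * X + (a * x) ^ 2 = B'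
    generalize 1 - L * x = B''
    field_simp
  rw [e1]
  have key : (2 * X - (a + 1 / a - (1 - q * L) * (1 - a * c * L) * (1 - a * d * L) /
          (a * ((1 - q * L ^ 2) * (1 + q * L))) -
          a * (1 - L) * (1 - b * c * L / q) * (1 - b * d * L / q) /
            ((1 + L) * (1 - q * L ^ 2)))) * ((1 - L * x) * (1 - q * L / x)) -
      (1 - q * L) * (1 - a * c * L) * (1 - a * d * L) / (a * ((1 - q * L ^ 2) * (1 + q * L))) *
        ((1 - L * x) * (1 - q * L * x) / x) -
      a * (1 - L) * (1 - b * c * L / q) * (1 - b * d * L / q) / ((1 + L) * (1 - q * L ^ 2)) *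
        (x * (1 - q * L / x) * (1 - L / x)) =
      -(1 - L * x) * (1 - q * L / x) * (1 - 2 * (a * x) * X + (a * x) ^ 2) / (a * x) -
      q * L / (a * x ^ 2) * (1 - x) ^ 2 * (1 - a * c * x / q) * (1 - a * d * x / q) := by
    clear e1 hac had hab hcd h4 h5 h6
    subst hb hd
    obtain ⟨δ, hδ⟩ : ∃ δ, δ = 1 - q * L ^ 2 := ⟨_, rfl⟩
    rw [← hδ] at h1 ⊢
    field_simp
    rw [hδ]
    ring
  linear_combination (b₀ * (φ / (r * r'))) * key

/-- The three-term recurrence of the Askey-Wilson polynomials for `a b = c d = q`. -/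
theorem askeyWilson_recurrence (l : ℕ) {a b c d : ℝ} (hab : a * b = q) (hcd : c * d = q)
    (hac : a * c < 1) (had : a * d < 1) (X : ℝ) :
    2 * X * askeyWilson l X a b c d q =
      1 / ((1 - q * (q ^ l) ^ 2) * (1 + q * q ^ l)) * askeyWilson (l + 1) X a b c d q +
        (a + 1 / a - (1 - q * q ^ l) * (1 - a * c * q ^ l) * (1 - a * d * q ^ l) /
          (a * ((1 - q * (q ^ l) ^ 2) * (1 + q * q ^ l))) -
          a * (1 - q ^ l) * (1 - b * c * q ^ l / q) * (1 - b * d * q ^ l / q) /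
            ((1 + q ^ l) * (1 - q * (q ^ l) ^ 2))) * askeyWilson l X a b c d q +
        (1 - q ^ l) ^ 2 * (1 - b * c * q ^ l / q) * (1 - b * d * q ^ l / q) *
          (1 - a * c * q ^ l / q) * (1 - a * d * q ^ l / q) /
            ((1 + q ^ l) * (1 - q * (q ^ l) ^ 2)) * askeyWilson (l - 1) X a b c d q := by
  have hq := hq0.ne'
  have ha : a ≠ 0 := by rintro rfl; exact hq (by simpa using hab.symm)
  have h1 := (one_sub_mul_pow_sq_pos hq0 hq1 l).ne'
  have hL : 0 < q ^ l := by positivity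
  have h2 : 1 + q * q ^ l ≠ 0 := by positivity
  have h3 : 1 + q ^ l ≠ 0 := by positivity
  cases l with
  | zero =>
    have h1 : 1 - q ≠ 0 := by linarith
    have h5 : 1 - a * c ≠ 0 := by linarith
    have h6 : 1 - a * d ≠ 0 := by linarith
    have h2 : 1 + q ≠ 0 := by positivity
    have h7 : q * c * d = q * q := by rw [mul_assoc, hcd]
    simp [askeyWilson, qPoch, qPochPair, Finset.sum_range_succ, h7, hab]
    field_simp
    ring
  | succ l =>
    have h := jacobiSum_recurrence hq0 hq1 l hab hcd hac had X
    simp only [askeyWilson_eq_jacobiSum hq0 hq1 _ X hab hcd, Nat.add_sub_cancel]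
    rw [qPoch_succ (a * c) (l + 1), qPoch_succ (a * d) (l + 1), qPoch_succ q (l + 1),
      qPoch_succ (a * c) l, qPoch_succ (a * d) l, qPoch_succ q l, pow_succ a (l + 1),
      pow_succ a l, show l + 1 + 1 = l + 2 by ring]
    have e1 : a * d * q ^ (l + 1) / q = a * d * q ^ l := by rw [pow_succ]; field_simp
    have e2 : a * c * q ^ (l + 1) / q = a * c * q ^ l := by rw [pow_succ]; field_simp
    have e3 : q * q ^ l = q ^ (l + 1) := by ring
    rw [e1, e2, e3]
    have e4 : a * a⁻¹ = 1 := mul_inv_cancel₀ ha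
    simp only [mul_inv, div_eq_mul_inv] at h ⊢
    linear_combination ((a ^ l)⁻¹ * a⁻¹ * (qPoch (a * c) q l * (1 - a * c * q ^ l) *
      (qPoch (a * d) q l * (1 - a * d * q ^ l))) * (qPoch q q l * (1 - q ^ (l + 1)))) * h +
      ((a ^ l)⁻¹ * (qPoch (a * c) q l * (1 - a * c * q ^ l) *
      (qPoch (a * d) q l * (1 - a * d * q ^ l))) * (qPoch q q l * (1 - q ^ (l + 1))) *
        ((1 - q ^ (l + 1)) * (1 - b * c * q ^ (l + 1) * q⁻¹) * (1 - b * d * q ^ (l + 1) * q⁻¹) *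
        ((1 + q ^ (l + 1))⁻¹ * (1 - q * (q ^ (l + 1)) ^ 2)⁻¹)) * jacobiSum q a c d X l) * e4

end

end QSpecial

end

/-! ### Normalisation of the products and the diagonal quadratic form. -/

noncomputable section

namespace QSpecial

/-- The constant relating the linearisation coefficients to products of two `bigJacobiSum`s. -/
def linConst (q h u : ℝ) (l n : ℕ) : ℝ :=
  u ^ (l - n) / h ^ ((l - n) * (l + 3 * n + 2)) *
    (qPoch q q l * qPoch q q (l - n) / qPoch q q (l + n))

/-- The product of two big `q`-Jacobi functions, suitably normalised. -/
def bigJacobiProd (q h u Z Z' : ℝ) (l n : ℕ) (Y Y' : ℝ) : ℝ :=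
  linConst q h u l n * (qPoch (Z * q) q l * qPoch (Z' * q) q l) *
    (bigJacobiSum q l n Y Z * bigJacobiSum q l n Y' Z')

theorem bigJacobiProd_eq_zero {l n : ℕ} (h' : l < n) (q h u Z Z' Y Y' : ℝ) :
    bigJacobiProd q h u Z Z' l n Y Y' = 0 := by
  simp [bigJacobiProd, bigJacobiSum_eq_zero h']

section

variable {q : ℝ} (hq0 : 0 < q) (hq1 : q < 1)

include hq0 hq1

/-- The constant is chosen so that its quotients for neighbouring l and n supply the weights with
which the squares enter `contig_form_diag`. -/
theorem linConst_succ_right {h u : ℝ} (hh : h ^ 2 = q) (hu : u ≠ 0) {l n : ℕ} (hn : n < l) :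
    linConst q h u l n = linConst q h u l (n + 1) *
      (u * h * q ^ l / (q ^ (n + 1)) ^ 3 * (1 - q * q ^ l / q ^ (n + 1)) *
        (1 - q ^ l * q ^ (n + 1))) := by
  obtain ⟨j, rfl⟩ : ∃ j, l = n + 1 + j := ⟨l - (n + 1), by omega⟩
  have hq := hq0.ne'
  have hh0 : h ≠ 0 := by rintro rfl; exact hq (by simpa using hh.symm)
  have e1 : q * q ^ (n + 1 + j) / q ^ (n + 1) = q * q ^ j := by
    rw [pow_add]; field_simp
  have e2 : q ^ (n + 1 + j) * q ^ (n + 1) = q * q ^ (n + 1 + j + n) := by ring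
  have e3 : q ^ (n + 1 + j) / (q ^ (n + 1)) ^ 3 = h ^ (2 * j) / h ^ (4 * n + 4) := by
    have : q ^ (n + 1 + j) / (q ^ (n + 1)) ^ 3 = q ^ j / (q ^ (n + 1)) ^ 2 := by
      rw [pow_add]; field_simp
    rw [this, ← hh]
    ring_nf
  have h2 : 1 - q * q ^ (n + 1 + j + n) ≠ 0 := by
    rw [← pow_succ']; exact one_sub_pow_ne_zero hq0 hq1 (by omega)
  have h3 := (qPoch_self_pos hq0 hq1 (n + 1 + j + n)).ne'
  unfold linConst
  rw [show n + 1 + j - n = j + 1 by omega, show n + 1 + j - (n + 1) = j by omega,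
    show n + 1 + j + (n + 1) = n + 1 + j + n + 1 by ring, qPoch_succ q j,
    qPoch_succ q (n + 1 + j + n), mul_div_assoc (u * h), e1, e2, e3]
  have e4 : h ^ ((j + 1) * (n + 1 + j + 3 * n + 2)) =
      h ^ (j * (n + 1 + j + 3 * (n + 1) + 2)) * h ^ (4 * n + 4) / (h ^ (2 * j) * h) := by
    field_simp
    rw [← pow_add, ← pow_add, ← pow_succ]
    congr 1
    ring
  rw [e4, pow_succ u]
  field_simp

omit hq1 in
theorem linConst_succ_left {h u : ℝ} (hh : h ^ 2 = q) {l n : ℕ} (hn : n ≤ l) :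
    linConst q h u (l + 1) n = linConst q h u l n *
      (u / (h ^ 3 * q ^ l * q ^ n) * ((1 - q * q ^ l) * (1 - q * q ^ l / q ^ n) /
        (1 - q * q ^ l * q ^ n))) := by
  obtain ⟨j, rfl⟩ : ∃ j, l = n + j := ⟨l - n, by omega⟩
  have hq := hq0.ne'
  have hh0 : h ≠ 0 := by rintro rfl; exact hq (by simpa using hh.symm)
  have e1 : q * q ^ (n + j) / q ^ n = q * q ^ j := by
    rw [pow_add]; field_simp
  have e2 : q * q ^ (n + j) * q ^ n = q * q ^ (n + j + n) := by ring
  have e3 : h ^ 3 * q ^ (n + j) * q ^ n = h ^ (2 * j + 4 * n + 3) := by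
    rw [← hh]
    ring
  unfold linConst
  rw [show n + j + 1 - n = j + 1 by omega, show n + j - n = j by omega,
    show n + j + 1 + n = n + j + n + 1 by ring, qPoch_succ q j,
    qPoch_succ q (n + j + n), qPoch_succ q (n + j), e1, e2, e3]
  have e4 : h ^ ((j + 1) * (n + j + 1 + 3 * n + 2)) =
      h ^ (j * (n + j + 3 * n + 2)) * h ^ (2 * j + 4 * n + 3) := by
    rw [← pow_add]
    congr 1
    ring
  rw [e4, pow_succ u]
  simp only [div_eq_mul_inv, mul_inv]
  ring

theorem linConst_diag (h u : ℝ) (l : ℕ) :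
    linConst q h u (l + 1) (l + 1) = linConst q h u l l *
      (1 / ((1 - q * (q ^ l) ^ 2) * (1 + q * q ^ l))) := by
  have h1 := (one_sub_mul_pow_sq_pos hq0 hq1 l).ne'
  have h2 : 1 + q * q ^ l ≠ 0 := by positivity
  have h3 : 1 - q * q ^ l ≠ 0 := by
    rw [← pow_succ']; exact one_sub_pow_ne_zero hq0 hq1 (by omega)
  have h4 := (qPoch_self_pos hq0 hq1 (l + l)).ne'
  unfold linConst
  rw [show l + 1 + (l + 1) = l + l + 1 + 1 by ring, qPoch_succ q (l + l + 1), qPoch_succ q (l + l),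
    qPoch_succ q l, show q * q ^ (l + l) = q * (q ^ l) ^ 2 by ring,
    show 1 - q * q ^ (l + l + 1) = (1 - q * q ^ l) * (1 + q * q ^ l) by ring]
  simp only [Nat.sub_self, pow_zero, zero_mul]
  generalize 1 - q * (q ^ l) ^ 2 = A at *
  generalize 1 - q * q ^ l = A at *
  generalize 1 + q * q ^ l = A at *
  field_simp

end

/-- The quadratic form that diagonalises in the contiguous functions. -/
theorem contig_form_diag {q L N : ℝ} (hq : q ≠ 0) (hL : L ≠ 0) (hN : N ≠ 0) (hq1 : 1 + q ≠ 0)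
    (h1 : N - L ≠ 0) (h2 : 1 - q * L * N ≠ 0) (x y z x' y' z' : ℝ) :
    L / N ^ 3 * (1 - q * L / N) * (1 - L * N) *
          ((x - N * y - N ^ 2 * z) * (x' - N * y' - N ^ 2 * z')) +
        (1 + q) * (((1 - q * L / N) / (q * N) * x + ((1 + q) * L / N - 1 - q * L ^ 2) / (1 + q) * y +
            L * (1 - L * N) * z) *
          ((1 - q * L / N) / (q * N) * x' + ((1 + q) * L / N - 1 - q * L ^ 2) / (1 + q) * y' +
            L * (1 - L * N) * z')) +
        q ^ 2 * N ^ 3 / (L * (1 - L / N) * (1 - q * L * N)) *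
          (((1 - q * L / N) * (1 - L / N) / (q ^ 2 * N ^ 2) * x +
            L * (1 - L / N) * (1 - q * L * N) / (q * N ^ 2) * y -
            L ^ 2 * (1 - L * N) * (1 - q * L * N) / (q * N ^ 2) * z) *
          ((1 - q * L / N) * (1 - L / N) / (q ^ 2 * N ^ 2) * x' +
            L * (1 - L / N) * (1 - q * L * N) / (q * N ^ 2) * y' -
            L ^ 2 * (1 - L * N) * (1 - q * L * N) / (q * N ^ 2) * z')) =
      (1 - q * L) * (1 - q * L / N) * (1 - q * L ^ 2) * (1 + q * L) /
          (q ^ 2 * L * N * (1 - q * L * N)) * (x * x') +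
        (1 - L) * (1 - q * L) * (1 + L) * (1 + q * L) / (1 + q) * (y * y') +
        (1 - q * L ^ 2) * (1 + L) * (1 - L) * L * N * (1 - L * N) / (1 - L / N) * (z * z') := by
  have h3 : 1 - L / N ≠ 0 := by
    rw [one_sub_div hN]
    exact div_ne_zero h1 hN
  obtain ⟨δ, hδ⟩ : ∃ δ, δ = 1 - q * L * N := ⟨_, rfl⟩
  rw [← hδ] at h2 ⊢
  -- The six coefficients of the symmetric form are computed one by one; the mixed ones e12, e13 and
  -- e23 vanish.
  have e11 : L / N ^ 3 * (1 - q * L / N) * (1 - L * N) + (1 + q) * ((1 - q * L / N) / (q * N)) ^ 2 +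
      q ^ 2 * N ^ 3 / (L * (1 - L / N) * δ) *
        ((1 - q * L / N) * (1 - L / N) / (q ^ 2 * N ^ 2)) ^ 2 =
      (1 - q * L) * (1 - q * L / N) * (1 - q * L ^ 2) * (1 + q * L) /
          (q ^ 2 * L * N * δ) := by
    field_simp
    rw [hδ]
    ring
  have e12 : L / N ^ 3 * (1 - q * L / N) * (1 - L * N) * (-N) +
      (1 - q * L / N) / (q * N) * ((1 + q) * L / N - 1 - q * L ^ 2) +
      q ^ 2 * N ^ 3 / (L * (1 - L / N) * δ) *
        ((1 - q * L / N) * (1 - L / N) / (q ^ 2 * N ^ 2)) *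
        (L * (1 - L / N) * δ / (q * N ^ 2)) = 0 := by
    field_simp
    ring
  have e13 : L / N ^ 3 * (1 - q * L / N) * (1 - L * N) * (-N ^ 2) +
      (1 + q) * ((1 - q * L / N) / (q * N)) * (L * (1 - L * N)) -
      q ^ 2 * N ^ 3 / (L * (1 - L / N) * δ) *
        ((1 - q * L / N) * (1 - L / N) / (q ^ 2 * N ^ 2)) *
        (L ^ 2 * (1 - L * N) * δ / (q * N ^ 2)) = 0 := by
    field_simp
    ring
  have e22 : L / N ^ 3 * (1 - q * L / N) * (1 - L * N) * N ^ 2 +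
      (1 + q) * (((1 + q) * L / N - 1 - q * L ^ 2) / (1 + q)) ^ 2 +
      q ^ 2 * N ^ 3 / (L * (1 - L / N) * δ) *
        (L * (1 - L / N) * δ / (q * N ^ 2)) ^ 2 =
      (1 - L) * (1 - q * L) * (1 + L) * (1 + q * L) / (1 + q) := by
    field_simp
    rw [hδ]
    ring
  have e23 : L / N ^ 3 * (1 - q * L / N) * (1 - L * N) * N ^ 3 +
      ((1 + q) * L / N - 1 - q * L ^ 2) * (L * (1 - L * N)) -
      q ^ 2 * N ^ 3 / (L * (1 - L / N) * δ) *
        (L * (1 - L / N) * δ / (q * N ^ 2)) *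
        (L ^ 2 * (1 - L * N) * δ / (q * N ^ 2)) = 0 := by
    field_simp
    rw [hδ]
    ring
  have e33 : L / N ^ 3 * (1 - q * L / N) * (1 - L * N) * N ^ 4 +
      (1 + q) * (L * (1 - L * N)) ^ 2 +
      q ^ 2 * N ^ 3 / (L * (1 - L / N) * δ) *
        (L ^ 2 * (1 - L * N) * δ / (q * N ^ 2)) ^ 2 =
      (1 - q * L ^ 2) * (1 + L) * (1 - L) * L * N * (1 - L * N) / (1 - L / N) := by
    field_simp
    rw [hδ]
    ring
  have e4 : (1 + q) * (((1 + q) * L / N - 1 - q * L ^ 2) / (1 + q)) =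
    (1 + q) * L / N - 1 - q * L ^ 2 := by field_simp
  linear_combination e11 * (x * x') + e12 * (x * y' + x' * y) + e13 * (x * z' + x' * z) +
    e22 * (y * y') + e23 * (y * z' + y' * z) + e33 * (z * z') +
    e4 * ((1 - q * L / N) / (q * N) * (x * y' + x' * y) + L * (1 - L * N) * (y * z' + y' * z))

end QSpecial

end

/-! ### The recurrence for products of two big q-Jacobi functions. -/

noncomputable section

namespace QSpecial

/-- Leading coefficient of the three-term recurrence of `qJacobi l 0 0`. -/
def jacobiUp (q : ℝ) (l : ℕ) : ℝ := 1 / ((1 - q * (q ^ l) ^ 2) * (1 + q * q ^ l))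

/-- Middle coefficient of the three-term recurrence of `qJacobi l 0 0`. -/
def jacobiMid (q h u Z Z' : ℝ) (l : ℕ) : ℝ :=
  -(2 * h * u * q ^ l * (1 + Z) * (1 + Z') / ((1 + q ^ l) * (1 + q * q ^ l)))

/-- Last coefficient of the three-term recurrence of `qJacobi l 0 0`. -/
def jacobiDown (q Z Z' : ℝ) (l : ℕ) : ℝ :=
  (1 - q ^ l) ^ 2 * (1 - Z * q ^ l) * (1 - Z' * q ^ l) * (1 - q ^ l / Z) * (1 - q ^ l / Z') /
    ((1 + q ^ l) * (1 - q * (q ^ l) ^ 2))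

/-- Middle coefficient of the three-term recurrence of `qLaguerre m p`, with `y = q^m` and
`y' = q^{m+p}`. -/
def laguerreMid (q h u Z Z' y y' : ℝ) : ℝ :=
  h / u * ((1 + q) * y * y' - (1 + 1 / Z) * y' - (1 + 1 / Z') * y)

/-- Last coefficient of the three-term recurrence of `qLaguerre m p`. -/
def laguerreDown (Z Z' y y' : ℝ) : ℝ := (1 - y) * (1 - Z * y) * ((1 - y') * (1 - Z' * y'))

/-- Completing the product: up to a constant, the bilinear polynomial in y and y' is (y - y₀)(y' -
y₀'), where y₀ and y₀' are the centres occurring in `bigJacobiSum_mul_arg`. The relation u²ZZ' = 1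
brings the constant into a form comparable with `jacobiMid`. -/
theorem laguerreMid_mul {q h u Z Z' : ℝ} (hq : 1 + q ≠ 0) (hu : u ≠ 0) (hZ : Z ≠ 0) (hZ' : Z' ≠ 0)
    (huZ : u ^ 2 * (Z * Z') = 1) (y y' g g' w : ℝ) :
    laguerreMid q h u Z Z' y y' * (w * (g * g')) =
      w * (h / u * (1 + q) * ((y - (1 + 1 / Z) / (1 + q)) * g * ((y' - (1 + 1 / Z') / (1 + q)) * g')) -
        h * u * (1 + Z) * (1 + Z') / (1 + q) * (g * g')) := by
  have hZe : Z' = 1 / (u ^ 2 * Z) := by field_simp; linarith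
  subst hZe
  unfold laguerreMid
  field_simp
  ring

set_option maxHeartbeats 1000000 in
/-- The step of the recurrence for products of contiguous functions, with all data abstracted. -/
theorem contig_step {q h u Z Z' L N : ℝ} (hh : h ^ 2 = q) (hq : q ≠ 0) (hu : u ≠ 0) (hZ : Z ≠ 0)
    (hZ' : Z' ≠ 0) (huZ : u ^ 2 * (Z * Z') = 1) (hL : L ≠ 0) (hN : N ≠ 0) (h1 : N - L ≠ 0)
    (h2 : 1 - q * L * N ≠ 0) (h3 : 1 + L ≠ 0) (h4 : 1 + q * L ≠ 0) (h5 : 1 - q * L ^ 2 ≠ 0)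
    (h6 : 1 + q ≠ 0) (h7 : 1 - L ≠ 0)
    {w wu wm wp wd y y' G G' Gu Gu' Gm Gm' Gp Gp' Gd Gd' : ℝ}
    (hwm : wm = w * (u * h * L / N ^ 3 * (1 - q * L / N) * (1 - L * N)))
    (hwp : wp = w * (h ^ 5 * N ^ 3 / (u * L * (1 - L / N) * (1 - q * L * N))))
    (hwu : wu = w * (u / (h ^ 3 * L * N) * ((1 - q * L) * (1 - q * L / N) /
        (1 - q * L * N))) * ((1 - Z * q * L) * (1 - Z' * q * L)))
    (hwd : wd * ((1 - Z * L) * (1 - Z' * L)) =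
      w * (h * L * N / u * ((1 - L * N) / ((1 - L) * (1 - L / N)))))
    (hm : Gm = contigUp q L Z * Gu - N * contigMid q L Z * G - N ^ 2 * contigDown q L Z * Gd)
    (hm' : Gm' = contigUp q L Z' * Gu' - N * contigMid q L Z' * G' -
      N ^ 2 * contigDown q L Z' * Gd')
    (h0 : (y - (1 + 1 / Z) / (1 + q)) * G =
      (1 - q * L / N) / (q * N * Z) * contigUp q L Z * Gu +
        ((1 + q) * L / N - 1 - q * L ^ 2) / (Z * (1 + q)) * contigMid q L Z * G +
        L * (1 - L * N) / Z * contigDown q L Z * Gd)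
    (h0' : (y' - (1 + 1 / Z') / (1 + q)) * G' =
      (1 - q * L / N) / (q * N * Z') * contigUp q L Z' * Gu' +
        ((1 + q) * L / N - 1 - q * L ^ 2) / (Z' * (1 + q)) * contigMid q L Z' * G' +
        L * (1 - L * N) / Z' * contigDown q L Z' * Gd')
    (hp : (1 - y) * (1 - Z * y) * Gp =
      (1 - q * L / N) * (1 - L / N) / (q ^ 2 * N ^ 2 * Z) * contigUp q L Z * Gu +
        L * (1 - L / N) * (1 - q * L * N) / (q * N ^ 2 * Z) * contigMid q L Z * G -
        L ^ 2 * (1 - L * N) * (1 - q * L * N) / (q * N ^ 2 * Z) * contigDown q L Z * Gd)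
    (hp' : (1 - y') * (1 - Z' * y') * Gp' =
      (1 - q * L / N) * (1 - L / N) / (q ^ 2 * N ^ 2 * Z') * contigUp q L Z' * Gu' +
        L * (1 - L / N) * (1 - q * L * N) / (q * N ^ 2 * Z') * contigMid q L Z' * G' -
        L ^ 2 * (1 - L * N) * (1 - q * L * N) / (q * N ^ 2 * Z') * contigDown q L Z' * Gd') :
    1 / ((1 - q * L ^ 2) * (1 + q * L)) * (wu * (Gu * Gu')) =
      wm * (Gm * Gm') +
        (laguerreMid q h u Z Z' y y' -
          -(2 * h * u * L * (1 + Z) * (1 + Z') / ((1 + L) * (1 + q * L)))) * (w * (G * G')) +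
        laguerreDown Z Z' y y' * (wp * (Gp * Gp')) -
        (1 - L) ^ 2 * (1 - Z * L) * (1 - Z' * L) * (1 - L / Z) * (1 - L / Z') /
          ((1 + L) * (1 - q * L ^ 2)) * (wd * (Gd * Gd')) := by
  have hform := contig_form_diag hq hL hN h6 h1 h2 (contigUp q L Z * Gu) (contigMid q L Z * G)
    (contigDown q L Z * Gd) (contigUp q L Z' * Gu') (contigMid q L Z' * G') (contigDown q L Z' * Gd')
  have h8 : 1 - L / N ≠ 0 := by
    rw [one_sub_div hN]
    exact div_ne_zero h1 hN
  have hh0 : h ≠ 0 := by rintro rfl; exact hq (by simpa using hh.symm)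
  have hZe : h / u * (1 / (Z * Z')) = h * u := by
    field_simp
    linarith
  have t2 : laguerreMid q h u Z Z' y y' * (w * (G * G')) =
      w * (h * u * (1 + q) *
        (((1 - q * L / N) / (q * N) * (contigUp q L Z * Gu) +
            ((1 + q) * L / N - 1 - q * L ^ 2) / (1 + q) * (contigMid q L Z * G) +
            L * (1 - L * N) * (contigDown q L Z * Gd)) *
          ((1 - q * L / N) / (q * N) * (contigUp q L Z' * Gu') +
            ((1 + q) * L / N - 1 - q * L ^ 2) / (1 + q) * (contigMid q L Z' * G') +
            L * (1 - L * N) * (contigDown q L Z' * Gd'))) -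
        h * u * (1 + Z) * (1 + Z') / (1 + q) * (G * G')) := by
    rw [laguerreMid_mul h6 hu hZ hZ' huZ, h0, h0', ← hZe]
    simp only [div_eq_mul_inv, mul_inv]
    ring
  have t3 : laguerreDown Z Z' y y' * (wp * (Gp * Gp')) =
      w * (h * u * (q ^ 2 * N ^ 3 / (L * (1 - L / N) * (1 - q * L * N)) *
          (((1 - q * L / N) * (1 - L / N) / (q ^ 2 * N ^ 2) * (contigUp q L Z * Gu) +
            L * (1 - L / N) * (1 - q * L * N) / (q * N ^ 2) * (contigMid q L Z * G) -
            L ^ 2 * (1 - L * N) * (1 - q * L * N) / (q * N ^ 2) * (contigDown q L Z * Gd)) *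
          ((1 - q * L / N) * (1 - L / N) / (q ^ 2 * N ^ 2) * (contigUp q L Z' * Gu') +
            L * (1 - L / N) * (1 - q * L * N) / (q * N ^ 2) * (contigMid q L Z' * G') -
            L ^ 2 * (1 - L * N) * (1 - q * L * N) / (q * N ^ 2) * (contigDown q L Z' * Gd'))))) := by
    have : laguerreDown Z Z' y y' * (wp * (Gp * Gp')) =
        wp * (((1 - y) * (1 - Z * y) * Gp) * ((1 - y') * (1 - Z' * y') * Gp')) := by
      unfold laguerreDown; ring
    rw [this, hp, hp', hwp, ← hZe, ← hh]
    simp only [div_eq_mul_inv, mul_inv]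
    ring
  have t4 : 1 / ((1 - q * L ^ 2) * (1 + q * L)) * (wu * (Gu * Gu')) =
      w * (h * u * ((1 - q * L) * (1 - q * L / N) * (1 - q * L ^ 2) * (1 + q * L) /
          (q ^ 2 * L * N * (1 - q * L * N)) * (contigUp q L Z * Gu * (contigUp q L Z' * Gu')))) := by
    have e : h * (q ^ 2)⁻¹ = (h ^ 3)⁻¹ := by rw [← hh]; field_simp
    have e' : h * u * ((1 - q * L) * (1 - q * L / N) * (1 - q * L ^ 2) * (1 + q * L) /
        (q ^ 2 * L * N * (1 - q * L * N))) = u * ((1 - q * L) * (1 - q * L / N) * (1 - q * L ^ 2) *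
          (1 + q * L) / (h ^ 3 * L * N * (1 - q * L * N))) := by
      simp only [div_eq_mul_inv, mul_inv]
      linear_combination (u * ((1 - q * L) * (1 - q * L * N⁻¹) * (1 - q * L ^ 2) *
          (1 + q * L) * (L⁻¹ * N⁻¹ * (1 - q * L * N)⁻¹))) * e
    rw [← mul_assoc (h * u), e', hwu]
    clear t2 t3 e e' hform hm hm' h0 h0' hp hp' hwm hwp hwu hwd
    unfold contigUp
    generalize 1 - q * L ^ 2 = δ at *
    generalize 1 - q * L * N = δ' at *
    generalize 1 - q * L / N = δ''
    field_simp
  have t5 : (1 - L) ^ 2 * (1 - Z * L) * (1 - Z' * L) * (1 - L / Z) * (1 - L / Z') /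
          ((1 + L) * (1 - q * L ^ 2)) * (wd * (Gd * Gd')) =
      w * (h * u * ((1 - q * L ^ 2) * (1 + L) * (1 - L) * L * N * (1 - L * N) / (1 - L / N) *
        (contigDown q L Z * Gd * (contigDown q L Z' * Gd')))) := by
    have e : (1 - L) ^ 2 * (1 - Z * L) * (1 - Z' * L) * (1 - L / Z) * (1 - L / Z') /
          ((1 + L) * (1 - q * L ^ 2)) * (wd * (Gd * Gd')) =
        (1 - L) ^ 2 * ((1 - L / Z) * (1 - L / Z')) / ((1 + L) * (1 - q * L ^ 2)) *
          (wd * ((1 - Z * L) * (1 - Z' * L))) * (Gd * Gd') := by ring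
    have e' : (1 - L / Z) * (1 - L / Z') = u ^ 2 * ((L - Z) * (L - Z')) := by
      have : Z' = 1 / (u ^ 2 * Z) := by field_simp; linarith
      rw [this]
      field_simp
      ring
    rw [e, hwd, e']
    clear t2 t3 t4 e e' hform hm hm' h0 h0' hp hp' hwm hwp hwu hwd
    unfold contigDown
    generalize 1 - q * L ^ 2 = δ at *
    generalize 1 - L / N = δ' at *
    generalize 1 - L = δ'' at *
    field_simp
  -- `jacobiMid` and the constant left over in t2 combine to the middle diagonal entry, because
  -- 2L(1+q) - (1+L)(1+qL) = -(1-L)(1-qL).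
  have t6 : 2 * h * u * L * (1 + Z) * (1 + Z') / ((1 + L) * (1 + q * L)) * (w * (G * G')) -
      w * (h * u * (1 + Z) * (1 + Z') / (1 + q) * (G * G')) =
      -(w * (h * u * ((1 - L) * (1 - q * L) * (1 + L) * (1 + q * L) / (1 + q) *
        (contigMid q L Z * G * (contigMid q L Z' * G'))))) := by
    clear t2 t3 t4 t5 hform hm hm' h0 h0' hp hp' hwm hwp hwu hwd
    unfold contigMid
    obtain ⟨δ, hδ⟩ : ∃ δ, δ = 1 + q * L := ⟨_, rfl⟩
    rw [← hδ] at h4 ⊢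
    field_simp
    rw [hδ]
    ring
  rw [sub_mul (laguerreMid q h u Z Z' y y'), t2, t3, t4, t5, hwm, hm, hm']
  linear_combination (-(w * (h * u))) * hform - t6

end QSpecial

end

noncomputable section

namespace QSpecial

set_option maxHeartbeats 1000000 in
/-- The case `N = L` of `contig_step`. -/
theorem contig_step_top {q h u Z Z' L : ℝ} (hh : h ^ 2 = q) (hq : q ≠ 0) (hu : u ≠ 0) (hZ : Z ≠ 0)
    (hZ' : Z' ≠ 0) (huZ : u ^ 2 * (Z * Z') = 1) (hL : L ≠ 0)
    (h3 : 1 + L ≠ 0) (h4 : 1 + q * L ≠ 0) (h6 : 1 + q ≠ 0)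
    {w wu wm y y' G G' Gu Gu' Gm Gm' : ℝ}
    (hwm : wm = w * (u * h * L / L ^ 3 * (1 - q * L / L) * (1 - L * L)))
    (hwu : wu = w * (u / (h ^ 3 * L * L) * ((1 - q * L) * (1 - q * L / L) /
        (1 - q * L * L))) * ((1 - Z * q * L) * (1 - Z' * q * L)))
    (hm : Gm = contigUp q L Z * Gu - L * contigMid q L Z * G)
    (hm' : Gm' = contigUp q L Z' * Gu' - L * contigMid q L Z' * G')
    (h0 : (y - (1 + 1 / Z) / (1 + q)) * G =
      (1 - q * L / L) / (q * L * Z) * contigUp q L Z * Gu +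
        ((1 + q) * L / L - 1 - q * L ^ 2) / (Z * (1 + q)) * contigMid q L Z * G)
    (h0' : (y' - (1 + 1 / Z') / (1 + q)) * G' =
      (1 - q * L / L) / (q * L * Z') * contigUp q L Z' * Gu' +
        ((1 + q) * L / L - 1 - q * L ^ 2) / (Z' * (1 + q)) * contigMid q L Z' * G') :
    1 / ((1 - q * L ^ 2) * (1 + q * L)) * (wu * (Gu * Gu')) =
      wm * (Gm * Gm') +
        (laguerreMid q h u Z Z' y y' -
          -(2 * h * u * L * (1 + Z) * (1 + Z') / ((1 + L) * (1 + q * L)))) * (w * (G * G')) := by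
  have hh0 : h ≠ 0 := by rintro rfl; exact hq (by simpa using hh.symm)
  have hZe : h / u * (1 / (Z * Z')) = h * u := by
    field_simp
    linarith
  have t2 : laguerreMid q h u Z Z' y y' * (w * (G * G')) =
      w * (h * u * (1 + q) *
        (((1 - q) / (q * L) * (contigUp q L Z * Gu) +
            (q - q * L ^ 2) / (1 + q) * (contigMid q L Z * G)) *
          ((1 - q) / (q * L) * (contigUp q L Z' * Gu') +
            (q - q * L ^ 2) / (1 + q) * (contigMid q L Z' * G'))) -
        h * u * (1 + Z) * (1 + Z') / (1 + q) * (G * G')) := by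
    rw [laguerreMid_mul h6 hu hZ hZ' huZ, h0, h0', ← hZe, mul_div_cancel_right₀ _ hL,
      mul_div_cancel_right₀ _ hL]
    simp only [div_eq_mul_inv, mul_inv]
    ring
  have t4 : 1 / ((1 - q * L ^ 2) * (1 + q * L)) * (wu * (Gu * Gu')) =
      w * (h * u * ((1 - q * L) * (1 - q) * (1 + q * L) / (q ^ 2 * L ^ 2) *
        (contigUp q L Z * Gu * (contigUp q L Z' * Gu')))) := by
    have e : (h ^ 3)⁻¹ = h * (q ^ 2)⁻¹ := by rw [← hh]; field_simp
    rw [hwu, mul_div_cancel_right₀ _ hL, show 1 - q * L * L = 1 - q * L ^ 2 by ring]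
    unfold contigUp
    simp only [div_eq_mul_inv, mul_inv, e]
    have e2 : (1 + q * L) * (1 + q * L)⁻¹ = 1 := mul_inv_cancel₀ h4
    linear_combination (-(w * (h * u * ((1 - q * L) * (1 - q) * ((q ^ 2)⁻¹ * (L ^ 2)⁻¹) *
      ((1 - Z * q * L) * (1 - Z' * q * L) * ((1 - q * L ^ 2)⁻¹) ^ 2 * (1 + q * L)⁻¹ *
        Gu * Gu'))))) * e2
  have t6 : 2 * h * u * L * (1 + Z) * (1 + Z') / ((1 + L) * (1 + q * L)) * (w * (G * G')) -
      w * (h * u * (1 + Z) * (1 + Z') / (1 + q) * (G * G')) =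
      -(w * (h * u * ((1 - L) * (1 - q * L) * (1 + L) * (1 + q * L) / (1 + q) *
        (contigMid q L Z * G * (contigMid q L Z' * G'))))) := by
    clear t2 t4 hm hm' h0 h0' hwm hwu
    unfold contigMid
    obtain ⟨δ, hδ⟩ : ∃ δ, δ = 1 + q * L := ⟨_, rfl⟩
    rw [← hδ] at h4 ⊢
    field_simp
    rw [hδ]
    ring
  rw [sub_mul (laguerreMid q h u Z Z' y y'), t2, t4, hwm, hm, hm', mul_div_cancel_right₀ _ hL]
  have e11 : u * h * L / L ^ 3 * (1 - q) * (1 - L * L) +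
      h * u * (1 + q) * ((1 - q) / (q * L)) ^ 2 =
      h * u * ((1 - q * L) * (1 - q) * (1 + q * L) / (q ^ 2 * L ^ 2)) := by
    field_simp
    ring
  have e12 : -(u * h * L / L ^ 3 * (1 - q) * (1 - L * L) * L) +
      h * u * (1 + q) * ((1 - q) / (q * L)) * ((q - q * L ^ 2) / (1 + q)) = 0 := by
    field_simp
    ring
  have e22 : u * h * L / L ^ 3 * (1 - q) * (1 - L * L) * L ^ 2 +
      h * u * (1 + q) * ((q - q * L ^ 2) / (1 + q)) ^ 2 =
      h * u * ((1 - L) * (1 - q * L) * (1 + L) * (1 + q * L) / (1 + q)) := by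
    field_simp
    ring
  linear_combination (-(w * (contigUp q L Z * Gu * (contigUp q L Z' * Gu')))) * e11 -
    (w * (contigUp q L Z * Gu * (contigMid q L Z' * G') +
      contigUp q L Z' * Gu' * (contigMid q L Z * G))) * e12 -
    (w * (contigMid q L Z * G * (contigMid q L Z' * G'))) * e22 - t6

section

variable {q : ℝ} (hq0 : 0 < q) (hq1 : q < 1)

include hq0 hq1

theorem pow_sub_pow_ne_zero {l n : ℕ} (hn : n ≤ l) : q ^ n - q ^ (l + 1) ≠ 0 := by
  have := pow_lt_pow_right_of_lt_one₀ hq0 hq1 (by omega : n < l + 1)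
  linarith

theorem one_sub_mul_pow_mul_pow_ne_zero (l n : ℕ) : 1 - q * q ^ (l + 1) * q ^ n ≠ 0 := by
  rw [← pow_succ', ← pow_add]
  exact one_sub_pow_ne_zero hq0 hq1 (by omega)

theorem linConst_right {h u : ℝ} (hh : h ^ 2 = q) (hu : u ≠ 0) {l n : ℕ} (hn : n ≤ l) :
    linConst q h u (l + 1) (n + 1) = linConst q h u (l + 1) n *
      (h ^ 5 * (q ^ n) ^ 3 / (u * q ^ (l + 1) * (1 - q ^ (l + 1) / q ^ n) *
        (1 - q * q ^ (l + 1) * q ^ n))) := by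
  have hq := hq0.ne'
  have hh0 : h ≠ 0 := by rintro rfl; exact hq (by simpa using hh.symm)
  have h1 : 1 - q ^ (l + 1) / q ^ n ≠ 0 := by
    rw [one_sub_div (pow_ne_zero _ hq)]
    exact div_ne_zero (pow_sub_pow_ne_zero hq0 hq1 hn) (pow_ne_zero _ hq)
  have h2 := one_sub_mul_pow_mul_pow_ne_zero hq0 hq1 l n
  rw [linConst_succ_right hq0 hq1 hh hu (by omega : n < l + 1)]
  have e1 : q * q ^ (l + 1) / q ^ (n + 1) = q ^ (l + 1) / q ^ n := by
    rw [pow_succ' q n]; field_simp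
  have e2 : q ^ (l + 1) * q ^ (n + 1) = q * q ^ (l + 1) * q ^ n := by ring
  rw [e1, e2, pow_succ' q n]
  have hN : q ^ n ≠ 0 := pow_ne_zero _ hq
  have hL : q ^ (l + 1) ≠ 0 := pow_ne_zero _ hq
  generalize 1 - q ^ (l + 1) / q ^ n = A at *
  generalize 1 - q * q ^ (l + 1) * q ^ n = A' at *
  generalize q ^ (l + 1) = L at *
  generalize q ^ n = N at *
  rw [← hh]
  field_simp

theorem linConst_down {h u : ℝ} (hh : h ^ 2 = q) (hu : u ≠ 0) {l n : ℕ} (hn : n ≤ l) :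
    linConst q h u l n = linConst q h u (l + 1) n *
      (h * q ^ (l + 1) * q ^ n / u * ((1 - q ^ (l + 1) * q ^ n) /
        ((1 - q ^ (l + 1)) * (1 - q ^ (l + 1) / q ^ n)))) := by
  have hq := hq0.ne'
  have hh0 : h ≠ 0 := by rintro rfl; exact hq (by simpa using hh.symm)
  have h1 : 1 - q ^ (l + 1) / q ^ n ≠ 0 := by
    rw [one_sub_div (pow_ne_zero _ hq)]
    exact div_ne_zero (pow_sub_pow_ne_zero hq0 hq1 hn) (pow_ne_zero _ hq)
  have h2 : 1 - q ^ (l + 1) * q ^ n ≠ 0 := by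
    rw [← pow_add]
    exact one_sub_pow_ne_zero hq0 hq1 (by omega)
  have h3 : 1 - q ^ (l + 1) ≠ 0 := one_sub_pow_ne_zero hq0 hq1 (by omega)
  have hN : q ^ n ≠ 0 := pow_ne_zero _ hq
  have hL : q ^ l ≠ 0 := pow_ne_zero _ hq
  rw [linConst_succ_left hq0 hh hn, ← pow_succ' q l]
  generalize 1 - q ^ (l + 1) / q ^ n = A at *
  generalize 1 - q ^ (l + 1) * q ^ n = A' at *
  generalize 1 - q ^ (l + 1) = A'' at *
  rw [pow_succ' q l]
  generalize q ^ l = L at *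
  generalize q ^ n = N at *
  rw [← hh]
  field_simp

/-- This is the recurrence of the triple integral with second index k - m and k fixed: raising m
lowers the index, and Y, Y' stay the same. -/
theorem bigJacobiProd_recurrence {h u Z Z' : ℝ} (hh : h ^ 2 = q) (hu : u ≠ 0) (hZ : Z < 0)
    (hZ' : Z' < 0) (huZ : u ^ 2 * (Z * Z') = 1) (l n : ℕ) (Y Y' : ℝ) :
    jacobiUp q (l + 1) * bigJacobiProd q h u Z Z' (l + 2) (n + 1) Y Y' =
      bigJacobiProd q h u Z Z' (l + 1) n Y Y' +
        (laguerreMid q h u Z Z' (Y / (q * q ^ (n + 1) * Z)) (Y' / (q * q ^ (n + 1) * Z')) -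
          jacobiMid q h u Z Z' (l + 1)) * bigJacobiProd q h u Z Z' (l + 1) (n + 1) Y Y' +
        laguerreDown Z Z' (Y / (q * q ^ (n + 1) * Z)) (Y' / (q * q ^ (n + 1) * Z')) *
          bigJacobiProd q h u Z Z' (l + 1) (n + 2) Y Y' -
        jacobiDown q Z Z' (l + 1) * bigJacobiProd q h u Z Z' l (n + 1) Y Y' := by
  have hq := hq0.ne'
  have hL : 0 < q ^ (l + 1) := by positivity
  have hN : 0 < q ^ (n + 1) := by positivity
  have h5 := (one_sub_mul_pow_sq_pos hq0 hq1 (l + 1)).ne'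
  have h3 : 1 + q ^ (l + 1) ≠ 0 := by positivity
  have h4 : 1 + q * q ^ (l + 1) ≠ 0 := by positivity
  have h6 : 1 + q ≠ 0 := by positivity
  have h7 : 1 - q ^ (l + 1) ≠ 0 := one_sub_pow_ne_zero hq0 hq1 (by omega)
  have hm := bigJacobiSum_left hq0 hq1 l n Y hZ
  have hm' := bigJacobiSum_left hq0 hq1 l n Y' hZ'
  have h0 := bigJacobiSum_mul_arg hq0 hq1 l (n + 1) Y hZ
  have h0' := bigJacobiSum_mul_arg hq0 hq1 l (n + 1) Y' hZ'
  have hPZ : qPoch (Z * q) q (l + 2) = qPoch (Z * q) q (l + 1) * (1 - Z * q * q ^ (l + 1)) :=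
    qPoch_succ _ _
  have hPZ' : qPoch (Z' * q) q (l + 2) = qPoch (Z' * q) q (l + 1) * (1 - Z' * q * q ^ (l + 1)) :=
    qPoch_succ _ _
  -- For n < l all sums may occur. For n = l one has N = L, where the weight of index n + 2 would
  -- have a zero denominator, but the functions involved vanish. For n = l + 1 only the sums of
  -- index (l+2, n+1) and (l+1, n) remain, and beyond that everything is zero.
  rcases lt_trichotomy n l with hn | hn | hn
  · have hp := bigJacobiSum_right hq0 hq1 l (n + 1) Y hZ
    have hp' := bigJacobiSum_right hq0 hq1 l (n + 1) Y' hZ'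
    have hwm := linConst_succ_right hq0 hq1 hh hu (by omega : n < l + 1)
    have hwu := linConst_succ_left (u := u) hq0 hh (by omega : n + 1 ≤ l + 1)
    have := contig_step hh hq hu hZ.ne hZ'.ne huZ hL.ne' hN.ne' (pow_sub_pow_ne_zero hq0 hq1 hn)
      (one_sub_mul_pow_mul_pow_ne_zero hq0 hq1 l (n + 1)) h3 h4 h5 h6 h7
      (w := linConst q h u (l + 1) (n + 1) * (qPoch (Z * q) q (l + 1) * qPoch (Z' * q) q (l + 1)))
      (wu := linConst q h u (l + 2) (n + 1) * (qPoch (Z * q) q (l + 2) * qPoch (Z' * q) q (l + 2)))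
      (wm := linConst q h u (l + 1) n * (qPoch (Z * q) q (l + 1) * qPoch (Z' * q) q (l + 1)))
      (wp := linConst q h u (l + 1) (n + 2) * (qPoch (Z * q) q (l + 1) * qPoch (Z' * q) q (l + 1)))
      (wd := linConst q h u l (n + 1) * (qPoch (Z * q) q l * qPoch (Z' * q) q l))
      (by rw [hwm]; ring) (by rw [linConst_right hq0 hq1 hh hu (by omega : n + 1 ≤ l)]; ring)
      (by rw [hwu, hPZ, hPZ']; ring)
      (by
        rw [linConst_down hq0 hq1 hh hu (by omega : n + 1 ≤ l), qPoch_succ (Z * q) l, qPoch_succ (Z' * q) l]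
        rw [show Z * q * q ^ l = Z * q ^ (l + 1) by ring,
          show Z' * q * q ^ l = Z' * q ^ (l + 1) by ring]
        ring)
      hm hm' h0 h0'
      (by rw [← hp, show Z * (Y / (q * q ^ (n + 1) * Z)) = Y / (q * q ^ (n + 1)) by
        have := hZ.ne; field_simp])
      (by rw [← hp', show Z' * (Y' / (q * q ^ (n + 1) * Z')) = Y' / (q * q ^ (n + 1)) by
        have := hZ'.ne; field_simp])
    exact this
  · subst hn
    rw [bigJacobiProd_eq_zero (by omega : n < n + 1), bigJacobiProd_eq_zero (by omega : n + 1 < n + 2)]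
    rw [bigJacobiSum_eq_zero (by omega : n < n + 1)] at hm hm' h0 h0'
    have hwm := linConst_succ_right hq0 hq1 hh hu (by omega : n < n + 1)
    have hwu := linConst_succ_left (u := u) hq0 hh (le_refl (n + 1))
    have := contig_step_top hh hq hu hZ.ne hZ'.ne huZ hL.ne' h3 h4 h6
      (w := linConst q h u (n + 1) (n + 1) * (qPoch (Z * q) q (n + 1) * qPoch (Z' * q) q (n + 1)))
      (wu := linConst q h u (n + 2) (n + 1) * (qPoch (Z * q) q (n + 2) * qPoch (Z' * q) q (n + 2)))
      (wm := linConst q h u (n + 1) n * (qPoch (Z * q) q (n + 1) * qPoch (Z' * q) q (n + 1)))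
      (by rw [hwm]; ring) (by rw [hwu, hPZ, hPZ']; ring)
      (by simpa using hm) (by simpa using hm') (by simpa using h0) (by simpa using h0')
    simp only [bigJacobiProd, jacobiUp, jacobiMid, mul_zero, sub_zero, add_zero]
    exact this
  · rcases eq_or_ne n (l + 1) with hn' | hn'
    · subst hn'
      rw [bigJacobiProd_eq_zero (by omega : l + 1 < l + 1 + 1),
        bigJacobiProd_eq_zero (by omega : l + 1 < l + 1 + 2),
        bigJacobiProd_eq_zero (by omega : l < l + 1 + 1)]
      rw [bigJacobiSum_eq_zero (by omega : l < l + 1 + 1),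
        bigJacobiSum_eq_zero (by omega : l + 1 < l + 1 + 1)] at hm hm'
      simp only [bigJacobiProd]
      rw [hm, hm', hPZ, hPZ', linConst_diag hq0 hq1 h u (l + 1)]
      unfold jacobiUp contigUp
      simp only [div_eq_mul_inv, mul_inv]
      ring
    · simp [bigJacobiProd_eq_zero (by omega : l + 2 < n + 1),
        bigJacobiProd_eq_zero (by omega : l + 1 < n + 1), bigJacobiProd_eq_zero (by omega : l + 1 < n),
        bigJacobiProd_eq_zero (by omega : l + 1 < n + 2), bigJacobiProd_eq_zero (by omega : l < n + 1)]

/-- In place of index -1 there is index 1 with Y, Y' multiplied by q: for k = m the integral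
S(l,m+1,m) equals S(l,m,m+1), whose largest index is k + 1. -/
theorem bigJacobiProd_recurrence_zero {h u Z Z' : ℝ} (hh : h ^ 2 = q) (hu : u ≠ 0) (hZ : Z < 0)
    (hZ' : Z' < 0) (huZ : u ^ 2 * (Z * Z') = 1) (l : ℕ) (Y Y' : ℝ) :
    jacobiUp q (l + 1) * bigJacobiProd q h u Z Z' (l + 2) 0 Y Y' =
      (1 - Y / Z) * (1 - Y) * ((1 - Y' / Z') * (1 - Y')) *
          bigJacobiProd q h u Z Z' (l + 1) 1 (q * Y) (q * Y') +
        (laguerreMid q h u Z Z' (Y / (q * Z)) (Y' / (q * Z')) -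
          jacobiMid q h u Z Z' (l + 1)) * bigJacobiProd q h u Z Z' (l + 1) 0 Y Y' +
        laguerreDown Z Z' (Y / (q * Z)) (Y' / (q * Z')) *
          bigJacobiProd q h u Z Z' (l + 1) 1 Y Y' -
        jacobiDown q Z Z' (l + 1) * bigJacobiProd q h u Z Z' l 0 Y Y' := by
  have hq := hq0.ne'
  have hL : 0 < q ^ (l + 1) := by positivity
  have h5 := (one_sub_mul_pow_sq_pos hq0 hq1 (l + 1)).ne'
  have h3 : 1 + q ^ (l + 1) ≠ 0 := by positivity
  have h4 : 1 + q * q ^ (l + 1) ≠ 0 := by positivity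
  have h6 : 1 + q ≠ 0 := by positivity
  have h7 : 1 - q ^ (l + 1) ≠ 0 := one_sub_pow_ne_zero hq0 hq1 (by omega)
  have h8 : 1 - q * q ^ (l + 1) ≠ 0 := by
    rw [← pow_succ']; exact one_sub_pow_ne_zero hq0 hq1 (by omega)
  have hm := bigJacobiSum_left_zero hq0 hq1 l Y hZ
  have hm' := bigJacobiSum_left_zero hq0 hq1 l Y' hZ'
  have h0 := bigJacobiSum_mul_arg hq0 hq1 l 0 Y hZ
  have h0' := bigJacobiSum_mul_arg hq0 hq1 l 0 Y' hZ'
  have hp := bigJacobiSum_right hq0 hq1 l 0 Y hZ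
  have hp' := bigJacobiSum_right hq0 hq1 l 0 Y' hZ'
  have hwu := linConst_succ_left (u := u) hq0 hh (Nat.zero_le (l + 1))
  have hwp := linConst_right hq0 hq1 hh hu (Nat.zero_le l)
  have hwd := linConst_down hq0 hq1 hh hu (Nat.zero_le l)
  have hPZ : qPoch (Z * q) q (l + 2) = qPoch (Z * q) q (l + 1) * (1 - Z * q * q ^ (l + 1)) :=
    qPoch_succ _ _
  have hPZ' : qPoch (Z' * q) q (l + 2) = qPoch (Z' * q) q (l + 1) * (1 - Z' * q * q ^ (l + 1)) :=
    qPoch_succ _ _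
  simp only [pow_zero, mul_one, one_pow, div_one, zero_add] at hwu hwp hwd h0 h0' hp hp'
  -- Here N = 1, and the role of the function of lower index is played by the left side of
  -- `bigJacobiSum_left_zero`; wm is what the weight formula for that index gives at N = 1.
  have := contig_step hh hq hu hZ.ne hZ'.ne huZ hL.ne' one_ne_zero h7 (by simpa using h8) h3 h4 h5 h6
    h7
    (w := linConst q h u (l + 1) 0 * (qPoch (Z * q) q (l + 1) * qPoch (Z' * q) q (l + 1)))
    (wu := linConst q h u (l + 2) 0 * (qPoch (Z * q) q (l + 2) * qPoch (Z' * q) q (l + 2)))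
    (wm := linConst q h u (l + 1) 0 * (qPoch (Z * q) q (l + 1) * qPoch (Z' * q) q (l + 1)) *
      (u * h * q ^ (l + 1) * (1 - q * q ^ (l + 1)) * (1 - q ^ (l + 1))))
    (wp := linConst q h u (l + 1) 1 * (qPoch (Z * q) q (l + 1) * qPoch (Z' * q) q (l + 1)))
    (wd := linConst q h u l 0 * (qPoch (Z * q) q l * qPoch (Z' * q) q l))
    (y := Y / (q * Z)) (y' := Y' / (q * Z'))
    (G := bigJacobiSum q (l + 1) 0 Y Z) (G' := bigJacobiSum q (l + 1) 0 Y' Z')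
    (Gu := bigJacobiSum q (l + 2) 0 Y Z) (Gu' := bigJacobiSum q (l + 2) 0 Y' Z')
    (Gp := bigJacobiSum q (l + 1) 1 Y Z) (Gp' := bigJacobiSum q (l + 1) 1 Y' Z')
    (Gd := bigJacobiSum q l 0 Y Z) (Gd' := bigJacobiSum q l 0 Y' Z')
    (by simp) (by rw [hwp]; simp; ring)
    (by rw [hwu, hPZ, hPZ']; simp; ring)
    (by
      rw [hwd, qPoch_succ (Z * q) l, qPoch_succ (Z' * q) l]
      rw [show Z * q * q ^ l = Z * q ^ (l + 1) by ring,
        show Z' * q * q ^ l = Z' * q ^ (l + 1) by ring]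
      simp only [mul_one, div_one]
      ring)
    (hm.trans (by ring)) (hm'.trans (by ring)) (by simpa using h0) (by simpa using h0')
    (by
      have e : Z * (Y / (q * Z)) = Y / q := by have := hZ.ne; field_simp
      simp only [mul_one, div_one, one_pow]
      rw [← hp, e])
    (by
      have e : Z' * (Y' / (q * Z')) = Y' / q := by have := hZ'.ne; field_simp
      simp only [mul_one, div_one, one_pow]
      rw [← hp', e])
  have e : linConst q h u (l + 1) 0 * (qPoch (Z * q) q (l + 1) * qPoch (Z' * q) q (l + 1)) *
      (u * h * q ^ (l + 1) * (1 - q * q ^ (l + 1)) * (1 - q ^ (l + 1))) *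
      (q * Z / (q ^ (l + 1) * (1 - q ^ (l + 1)) * (1 - q * q ^ (l + 1))) * ((1 - Y / Z) * (1 - Y)) *
        bigJacobiSum q (l + 1) 1 (q * Y) Z *
      (q * Z' / (q ^ (l + 1) * (1 - q ^ (l + 1)) * (1 - q * q ^ (l + 1))) *
        ((1 - Y' / Z') * (1 - Y')) * bigJacobiSum q (l + 1) 1 (q * Y') Z')) =
      (1 - Y / Z) * (1 - Y) * ((1 - Y' / Z') * (1 - Y')) *
          bigJacobiProd q h u Z Z' (l + 1) 1 (q * Y) (q * Y') := by
    have hZe : Z' = 1 / (u ^ 2 * Z) := by have := hZ.ne; field_simp; linarith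
    have e1 : u * h * q ^ (l + 1) * (1 - q * q ^ (l + 1)) * (1 - q ^ (l + 1)) *
        (q * Z / (q ^ (l + 1) * (1 - q ^ (l + 1)) * (1 - q * q ^ (l + 1)))) *
        (q * Z' / (q ^ (l + 1) * (1 - q ^ (l + 1)) * (1 - q * q ^ (l + 1)))) =
        h ^ 5 / (u * q ^ (l + 1) * (1 - q ^ (l + 1)) * (1 - q * q ^ (l + 1))) := by
      have hZ0 := hZ.ne
      have hL' := hL.ne'
      rw [show h ^ 5 = h * (h ^ 2) ^ 2 by ring, hh, hZe]
      generalize 1 - q * q ^ (l + 1) = A at *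
      generalize 1 - q ^ (l + 1) = A' at *
      field_simp
    unfold bigJacobiProd
    rw [hwp, ← e1]
    ring
  rw [← e]
  exact this

end

end QSpecial

end

/-! ### Orthogonality and linearisation coefficients from recurrences. -/

noncomputable section

namespace QSpecial

/-- Orthogonality of the polynomials of a three-term recurrence, in terms of the matrix of the
values of a functional on products of two of them. -/
theorem orthogonal_of_recurrence {S : ℕ → ℕ → ℝ} {B C H : ℕ → ℝ} (hC : C 0 = 0) (hH0 : H 0 = 1)
    (hH : ∀ m, H (m + 1) = C (m + 1) * H m) (hS0 : ∀ k, S 0 k = if k = 0 then 1 else 0)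
    (hS : ∀ m k, S (m + 1) k + B m * S m k + C m * S (m - 1) k =
      S m (k + 1) + B k * S m k + C k * S m (k - 1)) (m k : ℕ) :
    S m k = if m = k then H m else 0 := by
  induction m using Nat.strong_induction_on generalizing k with
  | _ m ih =>
    cases m with
    | zero =>
      rw [hS0]
      by_cases h : k = 0
      · simp [h, hH0]
      · rw [if_neg h, if_neg (by omega)]
    | succ m =>
      have h1 := ih m (by omega)
      have h2 : C m * S (m - 1) k = if m = k + 1 then H m else 0 := by
        cases m with
        | zero => simp [hC]
        | succ m =>
          rw [Nat.add_sub_cancel, ih m (by omega)]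
          by_cases h : m = k
          · rw [if_pos h, if_pos (by omega), hH]
          · rw [if_neg h, if_neg (by omega), mul_zero]
      have h3 : C k * S m (k - 1) = if m + 1 = k then H (m + 1) else 0 := by
        cases k with
        | zero => simp [hC]
        | succ k =>
          rw [Nat.add_sub_cancel, h1]
          by_cases h : m = k
          · subst h
            rw [if_pos rfl, if_pos rfl, hH]
          · rw [if_neg h, if_neg (by omega), mul_zero]
      have h4 := hS m k
      rw [h2, h3, h1 k, h1 (k + 1)] at h4
      have h5 : B m * (if m = k then H m else 0) = B k * (if m = k then H m else 0) := by
        by_cases h : m = k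
        · rw [h]
        · rw [if_neg h, mul_zero, mul_zero]
      linarith

section

variable {q : ℝ} (hq0 : 0 < q) (hq1 : q < 1)

include hq0 hq1

omit hq0 hq1 in
theorem bigJacobiSum_zero_zero (Y Z : ℝ) : bigJacobiSum q 0 0 Y Z = 1 := by
  simp [bigJacobiSum, bigJacobiTerm, signedPow, qPoch, qFactInv]

theorem bigJacobiSum_one_one (Y : ℝ) {Z : ℝ} (hZ : Z < 0) :
    (1 - Z * q) * bigJacobiSum q 1 1 Y Z = 1 - q ^ 2 := by
  have h1 : 1 - q ≠ 0 := by linarith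
  have h2 : 1 - Z * q ≠ 0 := by nlinarith
  simp [bigJacobiSum, bigJacobiTerm, signedPow, qPoch, qFactInv, Finset.sum_range_succ,
    Finset.prod_range_succ]
  field_simp

theorem bigJacobiSum_one_zero (Y : ℝ) {Z : ℝ} (hZ : Z < 0) :
    (1 - Z * q) * bigJacobiSum q 1 0 Y Z =
      q * Z * (1 + q) * (Y / (q * Z) - (1 + 1 / Z) / (1 + q)) := by
  have h1 : 1 - q ≠ 0 := by linarith
  have h2 : 1 - Z * q ≠ 0 := by nlinarith
  have h3 : 1 + q ≠ 0 := by positivity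
  have h4 := hZ.ne
  have h5 := hq0.ne'
  simp [bigJacobiSum, bigJacobiTerm, signedPow, qPoch, qFactInv, Finset.sum_range_succ,
    Finset.prod_range_succ]
  field_simp
  ring

/-- Since `jacobiUp` never vanishes, the recurrence in l and the values at l = 0 determine S; the
normalised product of big q-Jacobi sums has the same values at l = 0 and satisfies the same
recurrence. -/
theorem linearisation_of_recurrence {h u Z Z' : ℝ} (hh : h ^ 2 = q) (hu : u ≠ 0) (hZ : Z < 0)
    (hZ' : Z' < 0) (huZ : u ^ 2 * (Z * Z') = 1) (p : ℕ) {S : ℕ → ℕ → ℕ → ℝ} {H : ℕ → ℝ}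
    (hH : ∀ m, H (m + 1) = laguerreDown Z Z' (q ^ (m + 1)) (q ^ (m + 1 + p)) * H m)
    (hsymm : ∀ l m k, S l m k = S l k m)
    (hS0 : ∀ m k, S 0 m k = if m = k then H m else 0)
    (hS : ∀ l m k, jacobiUp q l * S (l + 1) m k =
      S l (m + 1) k + (laguerreMid q h u Z Z' (q ^ m) (q ^ (m + p)) - jacobiMid q h u Z Z' l) *
        S l m k + laguerreDown Z Z' (q ^ m) (q ^ (m + p)) * S l (m - 1) k -
        jacobiDown q Z Z' l * S (l - 1) m k) (l n m : ℕ) :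
    S l m (m + n) = H (m + n) *
      bigJacobiProd q h u Z Z' l n (q ^ (m + n + 1) * Z) (q ^ (m + n + 1 + p) * Z') := by
  have hq := hq0.ne'
  have hup : ∀ l, jacobiUp q l ≠ 0 := fun l => by
    have h1 := (one_sub_mul_pow_sq_pos hq0 hq1 l).ne'
    have h2 : 1 + q * q ^ l ≠ 0 := by positivity
    unfold jacobiUp
    exact one_div_ne_zero (mul_ne_zero h1 h2)
  have hZ0 := hZ.ne
  have hZ0' := hZ'.ne
  -- The arguments are chosen so that y and y' in the contiguous relations become q^m and q^{m+p},
  -- the quantities in the recurrence of l_m.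
  have ey : ∀ m n : ℕ, q ^ (m + n + 1) * Z / (q * q ^ n * Z) = q ^ m := fun m n => by
    rw [pow_succ, pow_add]; field_simp
  have ey' : ∀ m n : ℕ, q ^ (m + n + 1 + p) * Z' / (q * q ^ n * Z') = q ^ (m + p) := fun m n => by
    rw [pow_add _ (m + n + 1) p, pow_succ, pow_add, pow_add]; field_simp
  -- The recurrence is of second order in l, so two consecutive levels are carried along. The
  -- passage from level 0 to level 1 is computed directly.
  have key : ∀ l, (∀ n m, S l m (m + n) = H (m + n) *
      bigJacobiProd q h u Z Z' l n (q ^ (m + n + 1) * Z) (q ^ (m + n + 1 + p) * Z')) ∧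
      (∀ n m, S (l + 1) m (m + n) = H (m + n) *
      bigJacobiProd q h u Z Z' (l + 1) n (q ^ (m + n + 1) * Z) (q ^ (m + n + 1 + p) * Z')) := by
    intro l
    induction l with
    | zero =>
      refine ⟨fun n m => ?_, fun n m => ?_⟩
      · rw [hS0]
        rcases Nat.eq_zero_or_pos n with hn | hn
        · subst hn
          simp [bigJacobiProd, bigJacobiSum_zero_zero, linConst, qPoch]
        · rw [if_neg (by omega), bigJacobiProd_eq_zero hn, mul_zero]
      · refine mul_left_cancel₀ (hup 0) ?_
        rw [hS 0 m (m + n)]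
        simp only [hS0]
        have hd : jacobiDown q Z Z' 0 = 0 := by simp [jacobiDown]
        have h1 : 1 - q ≠ 0 := by linarith
        have h2 : 1 + q ≠ 0 := by positivity
        have hdm : laguerreDown Z Z' (q ^ m) (q ^ (m + p)) * (if m - 1 = m + n then H (m - 1) else 0)
            = 0 := by
          by_cases hm : m = 0
          · simp [hm, laguerreDown]
          · rw [if_neg (by omega), mul_zero]
        rw [hdm, hd]
        rcases lt_trichotomy n 1 with hn | hn | hn
        · obtain rfl : n = 0 := by omega
          have h3 := bigJacobiSum_one_zero hq0 hq1 (q ^ (m + 0 + 1) * Z) hZ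
          have h4 := bigJacobiSum_one_zero hq0 hq1 (q ^ (m + 0 + 1 + p) * Z') hZ'
          have e1 := ey m 0
          have e2 := ey' m 0
          rw [pow_zero, mul_one] at e1 e2
          rw [e1] at h3
          rw [e2] at h4
          have e3 : bigJacobiProd q h u Z Z' 1 0 (q ^ (m + 0 + 1) * Z) (q ^ (m + 0 + 1 + p) * Z') =
              linConst q h u 1 0 * (((1 - Z * q) * bigJacobiSum q 1 0 (q ^ (m + 0 + 1) * Z) Z) *
                ((1 - Z' * q) * bigJacobiSum q 1 0 (q ^ (m + 0 + 1 + p) * Z') Z')) := by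
            simp only [bigJacobiProd, qPoch, Finset.prod_range_one, pow_zero, mul_one]
            ring
          rw [zero_add, e3, h3, h4, if_neg (by omega), if_pos (by omega)]
          have hZe : Z' = 1 / (u ^ 2 * Z) := by field_simp; linarith
          have hh0 : h ≠ 0 := by rintro rfl; exact hq (by simpa using hh.symm)
          simp only [laguerreMid, jacobiMid, jacobiUp, linConst, qPoch, Finset.prod_range_one,
            pow_zero, add_zero, mul_one, one_pow, Nat.sub_zero, pow_one,
            zero_mul, sub_zero, zero_add, one_mul, mul_zero]
          generalize q ^ m = y
          generalize q ^ (m + p) = y'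
          subst hZe
          rw [show h ^ (1 + 2) = h * h ^ 2 by ring, hh]
          field_simp
          ring_nf
          simp only [show h ^ 2 = q from hh]
          ring
        · subst hn
          have h3 := bigJacobiSum_one_one hq0 hq1 (q ^ (m + 1 + 1) * Z) hZ
          have h4 := bigJacobiSum_one_one hq0 hq1 (q ^ (m + 1 + 1 + p) * Z') hZ'
          have e3 : bigJacobiProd q h u Z Z' 1 1 (q ^ (m + 1 + 1) * Z) (q ^ (m + 1 + 1 + p) * Z') =
              linConst q h u 1 1 * (((1 - Z * q) * bigJacobiSum q 1 1 (q ^ (m + 1 + 1) * Z) Z) *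
                ((1 - Z' * q) * bigJacobiSum q 1 1 (q ^ (m + 1 + 1 + p) * Z') Z')) := by
            simp only [bigJacobiProd, qPoch, Finset.prod_range_one, pow_zero, mul_one]
            ring
          rw [zero_add, e3, h3, h4, if_pos rfl, if_neg (by omega)]
          have h5 : 1 - q ^ 2 ≠ 0 := one_sub_pow_ne_zero hq0 hq1 (by omega)
          have e4 : linConst q h u 1 1 = 1 / (1 - q ^ 2) := by
            simp [linConst, qPoch, Finset.prod_range_succ]
            field_simp
          have e5 : jacobiUp q 0 = 1 / (1 - q ^ 2) := by
            simp only [jacobiUp, pow_zero, one_pow, mul_one]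
            rw [show (1 - q) * (1 + q) = 1 - q ^ 2 by ring]
          rw [e4, e5]
          field_simp
          ring
        · rw [zero_add, bigJacobiProd_eq_zero hn, if_neg (by omega), if_neg (by omega)]
          ring
    | succ l ih =>
      obtain ⟨ih0, ih1⟩ := ih
      refine ⟨ih1, fun n m => mul_left_cancel₀ (hup (l + 1)) ?_⟩
      rw [hS (l + 1) m (m + n), Nat.add_sub_cancel, ih0 n m, ih1 n m]
      -- For m = 0 the truncated index does no harm: `laguerreDown` contains 1 - q^m.
      have hdm : laguerreDown Z Z' (q ^ m) (q ^ (m + p)) * S (l + 1) (m - 1) (m + n) =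
          laguerreDown Z Z' (q ^ m) (q ^ (m + p)) * (H (m + n) * bigJacobiProd q h u Z Z' (l + 1)
            (n + 1) (q ^ (m + n + 1) * Z) (q ^ (m + n + 1 + p) * Z')) := by
        cases m with
        | zero => simp [laguerreDown]
        | succ m =>
          have := ih1 (n + 1) m
          rw [show m + (n + 1) = m + 1 + n by ring] at this
          rw [Nat.add_sub_cancel, this]
      rw [hdm]
      cases n with
      | zero =>
        -- For n = 0 the entry (m+1, m) lies below the diagonal and is reflected to (m, m+1).
        have h1 := ih1 1 m
        rw [hsymm] at h1
        have h2 := bigJacobiProd_recurrence_zero hq0 hq1 hh hu hZ hZ' huZ l (q ^ (m + 0 + 1) * Z)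
          (q ^ (m + 0 + 1 + p) * Z')
        have e1 := ey m 0
        have e2 := ey' m 0
        rw [pow_zero, mul_one] at e1 e2
        rw [e1, e2] at h2
        rw [show l + 1 + 1 = l + 2 by ring, mul_left_comm (jacobiUp q (l + 1)), h2]
        rw [show m + 0 = m by ring, show S (l + 1) (m + 1) m = _ from h1, hH]
        rw [show q ^ (m + 1 + 1) * Z = q * (q ^ (m + 1) * Z) by ring,
          show q ^ (m + 1 + 1 + p) * Z' = q * (q ^ (m + 1 + p) * Z') by ring]
        have e3 : laguerreDown Z Z' (q ^ (m + 1)) (q ^ (m + 1 + p)) =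
            (1 - q ^ (m + 1) * Z / Z) * (1 - q ^ (m + 1) * Z) *
              ((1 - q ^ (m + 1 + p) * Z' / Z') * (1 - q ^ (m + 1 + p) * Z')) := by
          rw [mul_div_cancel_right₀ _ hZ0, mul_div_cancel_right₀ _ hZ0']
          unfold laguerreDown
          ring
        rw [e3]
        ring
      | succ n =>
        have h1 := ih1 n (m + 1)
        rw [show m + 1 + n = m + (n + 1) by ring] at h1
        have h2 := bigJacobiProd_recurrence hq0 hq1 hh hu hZ hZ' huZ l n (q ^ (m + (n + 1) + 1) * Z)
          (q ^ (m + (n + 1) + 1 + p) * Z')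
        rw [ey, ey'] at h2
        rw [show l + 1 + 1 = l + 2 by ring, mul_left_comm (jacobiUp q (l + 1)), h2, h1, show n + 1 + 1 = n + 2 by ring]
        ring
  exact (key l).1 n m

end

end QSpecial

end

/-! ### The integral of p_l l_m l_{m+n}. -/

noncomputable section

namespace QSpecial

theorem continuous_askeyWilson (n : ℕ) (a b c d q : ℝ) :
    Continuous fun x => askeyWilson n x a b c d q := by
  unfold askeyWilson qPochPair
  fun_prop

theorem askeyWilson_zero (x a b c d q : ℝ) : askeyWilson 0 x a b c d q = 1 := by
  simp [askeyWilson, qPoch, qPochPair]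

/-- The squared norm of `qLaguerre m p`, with `Z = -s⁻²` and `Z' = -t⁻²`. -/
def laguerreNorm (q Z Z' : ℝ) (p m : ℕ) : ℝ :=
  qPoch q q m * qPoch (q ^ (1 + p)) q m * qPoch (q * Z) q m * qPoch (q ^ (1 + p) * Z') q m

theorem laguerreNorm_succ (q Z Z' : ℝ) (p m : ℕ) :
    laguerreNorm q Z Z' p (m + 1) =
      laguerreDown Z Z' (q ^ (m + 1)) (q ^ (m + 1 + p)) * laguerreNorm q Z Z' p m := by
  unfold laguerreNorm laguerreDown
  rw [qPoch_succ, qPoch_succ, qPoch_succ, qPoch_succ]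
  ring

/-- This and the next three lemmas match the recurrence coefficients written in the Askey-Wilson
parameters with those written in Z = -1/s², Z' = -1/t² and u = st; r stands for q^p. -/
theorem laguerreMid_eq {h s t : ℝ} (hh : h ≠ 0) (hs : s ≠ 0) (ht : t ≠ 0) {r : ℝ} (hr : r ≠ 0)
    (y : ℝ) :
    laguerreMid (h ^ 2) h (s * t) (-1 / s ^ 2) (-1 / t ^ 2) y (y * r) =
      h * r * s / t + 1 / (h * r * s / t) -
        (1 - h * r * s / t * (h * t / s) * y) * (1 - h * r * s / t * (-h / (s * t)) * y) /
          (h * r * s / t) -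
        h * r * s / t * (1 - y) * (1 - h * t / s * (-h / (s * t)) * y / h ^ 2) := by
  unfold laguerreMid
  field_simp
  ring

theorem laguerreDown_eq {h s t : ℝ} (hh : h ≠ 0) (hs : s ≠ 0) (ht : t ≠ 0) (r y : ℝ) :
    laguerreDown (-1 / s ^ 2) (-1 / t ^ 2) y (y * r) =
      (1 - y) * (1 - h * t / s * (-h / (s * t)) * y / h ^ 2) *
        (1 - h * r * s / t * (h * t / s) * y / h ^ 2) *
        (1 - h * r * s / t * (-h / (s * t)) * y / h ^ 2) := by
  unfold laguerreDown
  field_simp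

theorem jacobiMid_eq {h s t : ℝ} (hh : h ≠ 0) (hs : s ≠ 0) (ht : t ≠ 0) {L : ℝ}
    (h1 : 1 - h ^ 2 * L ^ 2 ≠ 0) (h2 : 1 + h ^ 2 * L ≠ 0) (h3 : 1 + L ≠ 0) :
    -(2 * h * (s * t) * L * (1 + -1 / s ^ 2) * (1 + -1 / t ^ 2) / ((1 + L) * (1 + h ^ 2 * L))) =
      h * s / t + 1 / (h * s / t) - (1 - h ^ 2 * L) * (1 - h * s / t * (-h / (s * t)) * L) *
          (1 - h * s / t * (-(s * t * h)) * L) /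
          (h * s / t * ((1 - h ^ 2 * L ^ 2) * (1 + h ^ 2 * L))) -
        h * s / t * (1 - L) * (1 - h * t / s * (-h / (s * t)) * L / h ^ 2) *
          (1 - h * t / s * (-(s * t * h)) * L / h ^ 2) / ((1 + L) * (1 - h ^ 2 * L ^ 2)) := by
  obtain ⟨δ, hδ⟩ : ∃ δ, δ = 1 - h ^ 2 * L ^ 2 := ⟨_, rfl⟩
  obtain ⟨δ', hδ'⟩ : ∃ δ', δ' = 1 + h ^ 2 * L := ⟨_, rfl⟩
  rw [← hδ] at h1 ⊢
  rw [← hδ'] at h2 ⊢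
  field_simp
  rw [hδ, hδ']
  ring

theorem jacobiDown_eq {h s t : ℝ} (hh : h ≠ 0) (hs : s ≠ 0) (ht : t ≠ 0) (L D : ℝ) :
    (1 - L) ^ 2 * (1 - -1 / s ^ 2 * L) * (1 - -1 / t ^ 2 * L) * (1 - L / (-1 / s ^ 2)) *
        (1 - L / (-1 / t ^ 2)) / D =
      (1 - L) ^ 2 * (1 - h * t / s * (-h / (s * t)) * L / h ^ 2) *
        (1 - h * t / s * (-(s * t * h)) * L / h ^ 2) *
        (1 - h * s / t * (-h / (s * t)) * L / h ^ 2) *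
        (1 - h * s / t * (-(s * t * h)) * L / h ^ 2) / D := by
  congr 1
  field_simp

section

variable {q : ℝ} (hq0 : 0 < q) (hq1 : q < 1)

include hq0 hq1

theorem hahnIntegral_lin {a b c : ℝ} (h : HahnParams a b c) {f f₁ f₂ f₃ : ℝ → ℝ}
    (h₁ : Continuous f₁) (h₂ : Continuous f₂) (h₃ : Continuous f₃) (r₁ r₂ r₃ : ℝ)
    (hf : ∀ x, f x = r₁ * f₁ x + r₂ * f₂ x + r₃ * f₃ x) :
    hahnIntegral q f a b c = r₁ * hahnIntegral q f₁ a b c + r₂ * hahnIntegral q f₂ a b c +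
      r₃ * hahnIntegral q f₃ a b c := by
  rw [funext hf, hahnIntegral_add hq0 hq1 h (by fun_prop) (by fun_prop),
    hahnIntegral_add hq0 hq1 h (by fun_prop) (by fun_prop), hahnIntegral_const_mul,
    hahnIntegral_const_mul, hahnIntegral_const_mul]

theorem hahnIntegral_sum_qPochPair {a b c : ℝ} (h : HahnParams a b c) (r : ℕ → ℝ) (M : ℕ) :
    hahnIntegral q (fun x => ∑ k ∈ Finset.range M, r k * qPochPair a x q k) a b c =
      (∑ k ∈ Finset.range M, r k * (qPoch (a * b) q k * qPoch (a * c) q k)) *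
        hahnIntegral q (fun _ => 1) a b c := by
  have hc : ∀ k, Continuous fun x => qPochPair a x q k := fun k => by
    unfold qPochPair; fun_prop
  induction M with
  | zero =>
    have := hahnIntegral_const_mul (q := q) 0 (fun _ => 1) a b c
    simpa using this
  | succ M ih =>
    simp only [Finset.sum_range_succ]
    rw [hahnIntegral_add hq0 hq1 h (by fun_prop) (by fun_prop), ih, hahnIntegral_const_mul,
      hahnIntegral_qPochPair hq0 hq1 h]
    ring

/-- A terminating ₁φ₀ at argument q. Its partial sums have a closed form proportional to
(q^{-m};q)_k, which is zero for k = m + 1. -/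
theorem sum_qPoch_neg_pow {m : ℕ} (hm : m ≠ 0) :
    ∑ k ∈ Finset.range (m + 1), qPoch (q ^ (-(m : ℤ))) q k * q ^ k / qPoch q q k = 0 := by
  have hq := hq0.ne'
  have h1 : 1 - (q ^ m)⁻¹ ≠ 0 := by
    have := (one_lt_inv₀ (pow_pos hq0 m)).2 (pow_lt_one₀ hq0.le hq1 hm)
    linarith
  have hz : qPoch (q ^ m)⁻¹ q (m + 1) = 0 := by
    rw [qPoch_succ, inv_mul_cancel₀ (pow_ne_zero m hq), sub_self, mul_zero]
  rw [zpow_neg, zpow_natCast]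
  refine sum_eq_zero_of_telescope (T := fun k => qPoch (q ^ m)⁻¹ q k * q ^ k / qPoch q q k *
    ((1 - q ^ k) / (q ^ k * (1 - (q ^ m)⁻¹)))) (fun k => ?_) (by simp) (by simp [hz])
  rw [qPoch_succ, qPoch_succ q, pow_succ]
  have h2 := (qPoch_self_pos hq0 hq1 k).ne'
  have h3 : 1 - q * q ^ k ≠ 0 := by
    rw [← pow_succ']; exact one_sub_pow_ne_zero hq0 hq1 (by omega)
  have h4 : q ^ k ≠ 0 := pow_ne_zero _ hq
  rw [mul_comm (q ^ k) q]
  generalize (q ^ m)⁻¹ = A at *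
  obtain ⟨δ, hδ⟩ : ∃ δ, δ = 1 - A := ⟨_, rfl⟩
  obtain ⟨δ', hδ'⟩ : ∃ δ', δ' = 1 - q * q ^ k := ⟨_, rfl⟩
  rw [← hδ] at h1 ⊢
  rw [← hδ'] at h3 ⊢
  field_simp
  rw [hδ]
  ring

/-- The integrals of the basis elements carry (ab,ac;q)_k, which cancels the denominators of the
series and leaves the sum of `sum_qPoch_neg_pow`. With the three-term recurrence this alone yields
full orthogonality. -/
theorem hahnIntegral_askeyWilson {a b c : ℝ} (h : HahnParams a b c) (m : ℕ) :
    hahnIntegral q (fun x => askeyWilson m x a b c 0 q) a b c =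
      if m = 0 then hahnIntegral q (fun _ => 1) a b c else 0 := by
  by_cases hm : m = 0
  · subst hm
    simp only [askeyWilson_zero, if_true]
  rw [if_neg hm]
  have e : (fun x => askeyWilson m x a b c 0 q) = fun x =>
      ((a ^ m)⁻¹ * (qPoch (a * b) q m * qPoch (a * c) q m)) * ∑ k ∈ Finset.range (m + 1),
        (qPoch (q ^ (-(m : ℤ))) q k * q ^ k / (qPoch q q k * qPoch (a * b) q k * qPoch (a * c) q k)) *
          qPochPair a x q k := by
    funext x
    unfold askeyWilson
    simp only [mul_zero, zero_mul, qPoch_zero_left, mul_one]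
    refine congrArg _ (Finset.sum_congr rfl fun k _ => ?_)
    ring
  rw [e, hahnIntegral_const_mul, hahnIntegral_sum_qPochPair hq0 hq1 h]
  have e2 : ∀ k ∈ Finset.range (m + 1), qPoch (q ^ (-(m : ℤ))) q k * q ^ k /
      (qPoch q q k * qPoch (a * b) q k * qPoch (a * c) q k) *
        (qPoch (a * b) q k * qPoch (a * c) q k) =
      qPoch (q ^ (-(m : ℤ))) q k * q ^ k / qPoch q q k := fun k _ => by
    have h1 := (qPoch_pos hq0 hq1 h.ab k).ne'
    have h2 := (qPoch_pos hq0 hq1 h.ac k).ne'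
    field_simp
  rw [Finset.sum_congr rfl e2, sum_qPoch_neg_pow hq0 hq1 hm, zero_mul, mul_zero]

/-- The linearisation formula for `qJacobi l 0 0` times `qLaguerre m p`. -/
theorem hahnIntegral_linearisation {h s t : ℝ} (hh : h ^ 2 = q) (hs : 0 < s) (ht : 0 < t)
    (l m n p : ℕ) (hP : HahnParams (h * q ^ p * s / t) (h * t / s) (-h / (s * t))) :
    hahnIntegral q (fun x => askeyWilson l x (h * s / t) (h * t / s) (-h / (s * t)) (-(s * t * h)) q *
        askeyWilson m x (h * q ^ p * s / t) (h * t / s) (-h / (s * t)) 0 q *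
        askeyWilson (m + n) x (h * q ^ p * s / t) (h * t / s) (-h / (s * t)) 0 q)
      (h * q ^ p * s / t) (h * t / s) (-h / (s * t)) =
    laguerreNorm q (-1 / s ^ 2) (-1 / t ^ 2) p (m + n) *
      bigJacobiProd q h (s * t) (-1 / s ^ 2) (-1 / t ^ 2) l n (q ^ (m + n + 1) * (-1 / s ^ 2))
        (q ^ (m + n + 1 + p) * (-1 / t ^ 2)) *
      hahnIntegral q (fun _ => 1) (h * q ^ p * s / t) (h * t / s) (-h / (s * t)) := by
  have hq := hq0.ne'
  have hh0 : h ≠ 0 := by rintro rfl; exact hq (by simpa using hh.symm)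
  have hs0 := hs.ne'
  have ht0 := ht.ne'
  have hI := (hahnIntegral_one_pos hq0 hq1 hP).ne'
  have hZ : -1 / s ^ 2 < 0 := div_neg_of_neg_of_pos (by norm_num) (by positivity)
  have hZ' : -1 / t ^ 2 < 0 := div_neg_of_neg_of_pos (by norm_num) (by positivity)
  have huZ : (s * t) ^ 2 * (-1 / s ^ 2 * (-1 / t ^ 2)) = 1 := by field_simp
  have hπ : q ^ p ≠ 0 := pow_ne_zero _ hq
  set a := h * q ^ p * s / t with ha
  set b := h * t / s with hb
  set c := -h / (s * t) with hc
  set I₀ := hahnIntegral q (fun _ => 1) a b c with hI₀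
  set Z := -1 / s ^ 2 with hZd
  set Z' := -1 / t ^ 2 with hZd'
  have ha0 : a ≠ 0 := by rw [ha]; positivity
  have hlc : ∀ k, Continuous fun x => askeyWilson k x a b c 0 q :=
    fun k => continuous_askeyWilson k a b c 0 q
  have hpc : ∀ k, Continuous fun x => askeyWilson k x (h * s / t) b c (-(s * t * h)) q :=
    fun k => continuous_askeyWilson k (h * s / t) b c (-(s * t * h)) q
  have hllc : ∀ m k, Continuous fun x => askeyWilson m x a b c 0 q * askeyWilson k x a b c 0 q :=
    fun m k => (hlc m).mul (hlc k)
  have hplc : ∀ l m k, Continuous fun x => askeyWilson l x (h * s / t) b c (-(s * t * h)) q *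
      askeyWilson m x a b c 0 q * askeyWilson k x a b c 0 q :=
    fun l m k => ((hpc l).mul (hlc m)).mul (hlc k)
  have hlag : ∀ (m : ℕ) (x : ℝ), 2 * x * askeyWilson m x a b c 0 q =
      askeyWilson (m + 1) x a b c 0 q +
        laguerreMid q h (s * t) Z Z' (q ^ m) (q ^ (m + p)) * askeyWilson m x a b c 0 q +
        laguerreDown Z Z' (q ^ m) (q ^ (m + p)) * askeyWilson (m - 1) x a b c 0 q := by
    intro m x
    rw [askeyWilson_zero_right_recurrence hq0 hq1 m ha0 hP.ab hP.ac x]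
    have e1 := laguerreMid_eq hh0 hs0 ht0 hπ (q ^ m)
    have e2 := laguerreDown_eq hh0 hs0 ht0 (q ^ p) (q ^ m)
    rw [hh, ← pow_add] at e1 e2
    rw [e1, e2]
  have hac' : h * s / t * c = q * Z' := by rw [hc, hZd', ← hh]; field_simp
  have had' : h * s / t * (-(s * t * h)) = -(q * s ^ 2) := by rw [← hh]; field_simp
  have hjac : ∀ (l : ℕ) (x : ℝ), 2 * x * askeyWilson l x (h * s / t) b c (-(s * t * h)) q =
      jacobiUp q l * askeyWilson (l + 1) x (h * s / t) b c (-(s * t * h)) q +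
        jacobiMid q h (s * t) Z Z' l * askeyWilson l x (h * s / t) b c (-(s * t * h)) q +
        jacobiDown q Z Z' l * askeyWilson (l - 1) x (h * s / t) b c (-(s * t * h)) q := by
    intro l x
    have hL : 0 < q ^ l := by positivity
    rw [askeyWilson_recurrence hq0 hq1 l (by rw [hb, ← hh]; field_simp)
      (by rw [hc, ← hh]; field_simp) (lt_of_le_of_lt (le_of_eq hac') (by nlinarith))
      (lt_of_le_of_lt (le_of_eq had') (by nlinarith [sq_nonneg s])) x]
    have e1 := jacobiMid_eq hh0 hs0 ht0 (L := q ^ l)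
      (by rw [hh]; exact (one_sub_mul_pow_sq_pos hq0 hq1 l).ne') (by positivity) (by positivity)
    have e2 := jacobiDown_eq hh0 hs0 ht0 (q ^ l) ((1 + q ^ l) * (1 - q * (q ^ l) ^ 2))
    rw [hh] at e1 e2
    unfold jacobiUp jacobiMid jacobiDown
    rw [e1, e2]
  have hlin := linearisation_of_recurrence hq0 hq1 hh (mul_ne_zero hs0 ht0) hZ hZ' huZ p
    (S := fun l m k => hahnIntegral q (fun x =>
      askeyWilson l x (h * s / t) b c (-(s * t * h)) q * askeyWilson m x a b c 0 q *
        askeyWilson k x a b c 0 q) a b c / I₀)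
    (H := laguerreNorm q Z Z' p) (laguerreNorm_succ q Z Z' p)
    (fun l m k => by
      simp only [mul_right_comm]) ?_ ?_ l n m
  · rw [← hlin]
    field_simp
  · intro m k
    simp only [askeyWilson_zero, one_mul]
    refine orthogonal_of_recurrence (S := fun m k => hahnIntegral q (fun x =>
      askeyWilson m x a b c 0 q * askeyWilson k x a b c 0 q) a b c / I₀)
      (B := fun m => laguerreMid q h (s * t) Z Z' (q ^ m) (q ^ (m + p)))
      (C := fun m => laguerreDown Z Z' (q ^ m) (q ^ (m + p))) (H := laguerreNorm q Z Z' p)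
      (by simp [laguerreDown]) (by simp [laguerreNorm, qPoch]) (laguerreNorm_succ q Z Z' p)
      (fun k => ?_) (fun m k => ?_) m k
    · simp only [askeyWilson_zero, one_mul, hahnIntegral_askeyWilson hq0 hq1 hP k]
      by_cases hk : k = 0
      · rw [if_pos hk, if_pos hk]
        exact div_self hI
      · rw [if_neg hk, if_neg hk, zero_div]
    -- The integral of 2x l_m l_k, expanded by the recurrence in m and by the recurrence in k.
    · have h1 := hahnIntegral_lin hq0 hq1 hP (hllc (m + 1) k) (hllc m k)
        (hllc (m - 1) k) 1 (laguerreMid q h (s * t) Z Z' (q ^ m) (q ^ (m + p)))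
        (laguerreDown Z Z' (q ^ m) (q ^ (m + p)))
        (f := fun x => 2 * x * askeyWilson m x a b c 0 q * askeyWilson k x a b c 0 q)
        (fun x => by rw [hlag]; ring)
      have h2 := hahnIntegral_lin hq0 hq1 hP (hllc m (k + 1)) (hllc m k)
        (hllc m (k - 1)) 1 (laguerreMid q h (s * t) Z Z' (q ^ k) (q ^ (k + p)))
        (laguerreDown Z Z' (q ^ k) (q ^ (k + p)))
        (f := fun x => 2 * x * askeyWilson m x a b c 0 q * askeyWilson k x a b c 0 q)
        (fun x => by linear_combination askeyWilson m x a b c 0 q * hlag k x)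
      rw [h1] at h2
      linear_combination h2 / I₀
  · intro l m k
    -- The integral of 2x p_l l_m l_k, expanded by the recurrence in m and by the recurrence in l.
    have h1 := hahnIntegral_lin hq0 hq1 hP (hplc l (m + 1) k)
        (hplc l m k) (hplc l (m - 1) k)
        1 (laguerreMid q h (s * t) Z Z' (q ^ m) (q ^ (m + p)))
        (laguerreDown Z Z' (q ^ m) (q ^ (m + p)))
        (f := fun x => askeyWilson l x (h * s / t) b c (-(s * t * h)) q *
          (2 * x * askeyWilson m x a b c 0 q) * askeyWilson k x a b c 0 q)
        (fun x => by rw [hlag]; ring)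
    have h2 := hahnIntegral_lin hq0 hq1 hP (hplc (l + 1) m k)
        (hplc l m k) (hplc (l - 1) m k)
        (jacobiUp q l) (jacobiMid q h (s * t) Z Z' l) (jacobiDown q Z Z' l)
        (f := fun x => askeyWilson l x (h * s / t) b c (-(s * t * h)) q *
          (2 * x * askeyWilson m x a b c 0 q) * askeyWilson k x a b c 0 q)
        (fun x => by
          linear_combination (askeyWilson m x a b c 0 q * askeyWilson k x a b c 0 q) * hjac l x)
    rw [h1] at h2
    linear_combination (-1 / I₀) * h2

end

end QSpecial

end

/-! ### Passage to the normalisations of the statement. -/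

noncomputable section

namespace QSpecial

theorem qPoch_add (a q : ℝ) (n k : ℕ) :
    qPoch a q (n + k) = qPoch a q n * qPoch (a * q ^ n) q k := by
  induction k with
  | zero => simp [qPoch]
  | succ k ih =>
    rw [← add_assoc, qPoch_succ, ih, qPoch_succ, pow_add]
    ring

/-- The product is q^{j(j-1)/2}; in terms of h = q^{1/2} no halves occur in the exponents. -/
theorem prod_pow_mul_pow {q h : ℝ} (hh : h ^ 2 = q) (j : ℕ) :
    (∏ i ∈ Finset.range j, q ^ i) * h ^ j = h ^ (j * j) := by
  induction j with
  | zero => simp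
  | succ j ih =>
    rw [Finset.prod_range_succ, ← hh, show (j + 1) * (j + 1) = j * j + (2 * j + 1) by ring,
      pow_add h (j * j), ← ih, ← hh]
    ring

/-- Inversion of the base point of a `q`-shifted factorial. -/
theorem qPoch_neg_div {q W : ℝ} (hq : q ≠ 0) (hW : W ≠ 0) (n j : ℕ) :
    qPoch (-(W / q ^ (n + j))) q j * qPoch (-1 / W * q) q n =
      W ^ j * ((∏ i ∈ Finset.range j, q ^ i) / (q ^ (n + j)) ^ j) *
        qPoch (-1 / W * q) q (n + j) := by
  have h : qPoch (-(W / q ^ (n + j))) q j =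
      W ^ j * ((∏ i ∈ Finset.range j, q ^ i) / (q ^ (n + j)) ^ j) *
        qPoch (-1 / W * q * q ^ n) q j := by
    have e : qPoch (-1 / W * q * q ^ n) q j =
        ∏ i ∈ Finset.range j, (1 - -1 / W * q * q ^ n * q ^ (j - 1 - i)) :=
      (Finset.prod_range_reflect (fun i => 1 - -1 / W * q * q ^ n * q ^ i) j).symm
    have e1 : W ^ j = ∏ _i ∈ Finset.range j, W := by simp
    have e2 : (q ^ (n + j)) ^ j = ∏ _i ∈ Finset.range j, q ^ (n + j) := by simp
    rw [e, e1, e2, ← Finset.prod_div_distrib, ← Finset.prod_mul_distrib, ← Finset.prod_mul_distrib]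
    refine Finset.prod_congr rfl fun i hi => ?_
    rw [Finset.mem_range] at hi
    obtain ⟨r, rfl⟩ : ∃ r, j = i + 1 + r := ⟨j - (i + 1), by omega⟩
    rw [show i + 1 + r - 1 - i = r by omega]
    have h1 : q ^ n ≠ 0 := pow_ne_zero _ hq
    have h2 : q ^ i ≠ 0 := pow_ne_zero _ hq
    have h3 : q ^ r ≠ 0 := pow_ne_zero _ hq
    rw [show q ^ (n + (i + 1 + r)) = q ^ n * q ^ i * q * q ^ r by ring]
    field_simp
    ring
  rw [h, qPoch_add]
  ring

section

variable {q : ℝ} (hq0 : 0 < q) (hq1 : q < 1)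

include hq0 hq1

/-- The hypergeometric series begins with 1, so the prefactor is the reciprocal of the term k = 0 of
the sum. -/
theorem bigQJacobi_eq {W : ℝ} (hW : 0 < W) (n j m : ℕ) :
    bigQJacobi j n n (-(q ^ m)) W 1 q =
      qPoch q q j * qPoch q q n / qPoch q q (n + j + n) * qPoch (-1 / W * q) q n *
        bigJacobiSum q (n + j) n (q ^ (m + n + 1) * (-1 / W)) (-1 / W) := by
  have hq := hq0.ne'
  have hZ : -1 / W * q < 1 := by
    have : -1 / W < 0 := div_neg_of_neg_of_pos (by norm_num) hW
    nlinarith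
  have hs : bigJacobiSum q (n + j) n (q ^ (m + n + 1) * (-1 / W)) (-1 / W) =
      ∑ k ∈ Finset.range (j + 1),
        bigJacobiTerm q (n + j) n (q ^ (m + n + 1) * (-1 / W)) (-1 / W) k := by
    symm
    refine Finset.sum_subset (Finset.range_subset_range.2 (by omega)) fun k _ hk => ?_
    rw [Finset.mem_range, not_lt] at hk
    exact bigJacobiTerm_eq_zero (by omega) _ _
  unfold bigQJacobi
  rw [hs, Finset.mul_sum]
  refine Finset.sum_congr rfl fun k _ => ?_
  have e1 : q ^ ((j : ℝ) + n + n + 1) = q ^ ((n + j + n) + 1) := by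
    rw [← Real.rpow_natCast]; congr 1; push_cast; ring
  have e2 : q ^ ((n : ℝ) + 1) = q ^ (n + 1) := by
    rw [← Real.rpow_natCast]; congr 1; push_cast; ring
  have e3 : q ^ (1 + (n : ℝ)) = q ^ (n + 1) := by rw [add_comm, e2]
  rw [e1, e2, e3, qPoch_pow_succ hq0 hq1, qPoch_pow_succ hq0 hq1,
    show q ^ (n + 1) * -(q ^ m) / W = q ^ (m + n + 1) * (-1 / W) by ring,
    show -(q ^ (n + 1) * 1 / W) = -1 / W * q * q ^ n by ring]
  have h0 := qPoch_neg_pow hq0 hq1 j k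
  have h1 := (qPoch_self_pos hq0 hq1 n).ne'
  have h2 := (qPoch_self_pos hq0 hq1 (n + k)).ne'
  have h3 := (qPoch_pos hq0 hq1 hZ n).ne'
  have h4 := (qPoch_self_pos hq0 hq1 k).ne'
  have h5 := (qPoch_self_pos hq0 hq1 (n + j + n)).ne'
  have h6 := (qPoch_pos hq0 hq1 hZ (n + k)).ne'
  have e4 := qPoch_add (-1 / W * q) q n k
  have h7 : qPoch (-1 / W * q * q ^ n) q k ≠ 0 := fun h => h6 (by rw [e4, h, mul_zero])
  have e5 : qFactInv q (n + j) (n + k) = qFactInv q j k := by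
    unfold qFactInv
    by_cases h : k ≤ j
    · rw [if_pos h, if_pos (by omega), show n + j - (n + k) = j - k by omega]
    · rw [if_neg h, if_neg (by omega)]
  have e6 : q ^ (n + j) / q ^ n = q ^ j := by rw [pow_add]; field_simp
  unfold bigJacobiTerm
  rw [e4, e5, e6]
  generalize qPoch (q ^ (m + n + 1) * (-1 / W)) q k = Y₀
  generalize qPoch (-1 / W * q * q ^ n) q k = A at *
  generalize qPoch (-1 / W * q) q n = A' at *
  generalize qPoch q q (n + k) = A₁ at *
  generalize qPoch q q (n + j + n + k) = A₂ at *
  have e7 : ∀ B C D F : ℝ, B * C * D / F * q ^ k = (B * q ^ k) * (C * D / F) :=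
    fun B C D F => by ring
  rw [e7, h0]
  field_simp

/-- The constant D is the normalisation of `bigJacobiProd` once the prefactors of the two
polynomials from `bigQJacobi_eq` are taken out. -/
theorem addConst_mul {h : ℝ} (hh : h = q ^ (1 / 2 : ℝ)) (n j : ℕ) (τ σ : ℝ) :
    addConst n (n + j) τ σ q *
      ((qPoch q q j * qPoch q q n / qPoch q q (n + j + n) * qPoch (-1 / (q ^ τ) ^ 2 * q) q n) *
      (qPoch q q j * qPoch q q n / qPoch q q (n + j + n) * qPoch (-1 / (q ^ σ) ^ 2 * q) q n)) =
      linConst q h (q ^ τ * q ^ σ) (n + j) n *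
        (qPoch (-1 / (q ^ τ) ^ 2 * q) q (n + j) * qPoch (-1 / (q ^ σ) ^ 2 * q) q (n + j)) := by
  have hq := hq0.ne'
  have hs : 0 < q ^ τ := Real.rpow_pos_of_pos hq0 τ
  have ht : 0 < q ^ σ := Real.rpow_pos_of_pos hq0 σ
  have hh0 : 0 < h := hh ▸ Real.rpow_pos_of_pos hq0 _
  have hh2 : h ^ 2 = q := by
    rw [hh, ← Real.rpow_natCast, ← Real.rpow_mul hq0.le]; norm_num
  have ew : ∀ r : ℝ, q ^ (2 * r - ((n + j : ℕ) : ℝ)) = (q ^ r) ^ 2 / q ^ (n + j) := fun r => by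
    rw [Real.rpow_sub hq0, Real.rpow_natCast, mul_comm 2 r, Real.rpow_mul hq0.le]
    norm_num
  have ee : q ^ ((1 / 2 : ℝ) * (((n + j : ℕ) : ℝ) - n) * (((n + j : ℕ) : ℝ) - n - 2 * σ - 2 * τ)) =
      h ^ (j * j) / (q ^ τ * q ^ σ) ^ j := by
    rw [hh, ← Real.rpow_add hq0, ← Real.rpow_natCast, ← Real.rpow_natCast, ← Real.rpow_mul hq0.le,
      ← Real.rpow_mul hq0.le, ← Real.rpow_sub hq0]
    congr 1
    push_cast
    ring
  have h1 := qPoch_neg_div hq (pow_ne_zero 2 hs.ne') n j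
  have h2 := qPoch_neg_div hq (pow_ne_zero 2 ht.ne') n j
  have hp := prod_pow_mul_pow hh2 j
  unfold addConst
  rw [ew, ew, ee, show n + j - n = j by omega, qPoch_pow_succ hq0 hq1, qPoch_pow_succ hq0 hq1]
  unfold linConst
  rw [show n + j - n = j by omega, show j + n = n + j by ring, show n + (n + j) = n + j + n by ring]
  have h3 := (qPoch_self_pos hq0 hq1 n).ne'
  have h4 := (qPoch_self_pos hq0 hq1 j).ne'
  have h5 := (qPoch_self_pos hq0 hq1 (n + j + n)).ne'
  have hpe : (∏ i ∈ Finset.range j, q ^ i) = h ^ (j * j) / h ^ j := by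
    rw [← hp]; field_simp
  rw [hpe] at h1 h2
  set s := q ^ τ
  set t := q ^ σ
  have e : ∀ A B C D E F G K : ℝ, A * B * C * D * E * ((F * G) * (F * K)) =
      (B * G) * (A * K) * (C * D * E * F * F) := by intros; ring
  rw [e, h1, h2]
  have e1 : (q ^ (n + j)) ^ j = h ^ (2 * (n + j) * j) := by
    rw [← hh2]; ring
  rw [e1]
  generalize qPoch (-1 / s ^ 2 * q) q (n + j) = A
  generalize qPoch (-1 / t ^ 2 * q) q (n + j) = B
  generalize qPoch q q (n + j + n) = A₁ at *
  generalize qPoch q q (n + j) = A₂ at *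
  have e2 : h ^ (j * (n + j + 3 * n + 2)) = (h ^ j) ^ 2 * (h ^ (2 * (n + j) * j)) ^ 2 /
      (h ^ (j * j)) ^ 3 := by
    rw [eq_div_iff (by positivity), ← pow_mul, ← pow_mul, ← pow_mul, ← pow_add, ← pow_add]
    congr 1
    ring
  rw [e2, mul_pow, ← pow_mul, ← pow_mul, mul_comm 2 j, pow_mul s j 2, pow_mul t j 2]
  have g1 : h ^ j ≠ 0 := by positivity
  have g2 : h ^ (2 * (n + j) * j) ≠ 0 := by positivity
  have g3 : h ^ (j * j) ≠ 0 := by positivity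
  have g4 : s ^ j ≠ 0 := by positivity
  have g5 : t ^ j ≠ 0 := by positivity
  generalize h ^ j = x₁ at *
  generalize h ^ (2 * (n + j) * j) = x₂ at *
  generalize h ^ (j * j) = x₃ at *
  generalize s ^ j = x₄ at *
  generalize t ^ j = x₅ at *
  field_simp

end

end QSpecial

end

/-! ### Normalised measure, positivity of the constants and conclusion. -/

noncomputable section

namespace QSpecial

section

variable {q : ℝ} (hq0 : 0 < q) (hq1 : q < 1)

include hq0 hq1

/-- Integration of continuous functions against the normalised measure. -/
theorem integral_smul_askeyWilsonMeasure {a b c : ℝ} (h : HahnParams a b c) {f : ℝ → ℝ}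
    (hf : Continuous f) :
    Integrable f ((askeyWilsonMeasure a b c 0 q Set.univ)⁻¹ • askeyWilsonMeasure a b c 0 q) ∧
      ∫ x, f x ∂((askeyWilsonMeasure a b c 0 q Set.univ)⁻¹ • askeyWilsonMeasure a b c 0 q) =
        hahnIntegral q f a b c / hahnIntegral q (fun _ => 1) a b c := by
  obtain ⟨h1, h2⟩ := askeyWilsonMeasure_integral hq0 hq1 h hf
  obtain ⟨_, h4⟩ := askeyWilsonMeasure_integral hq0 hq1 h (f := fun _ => 1) continuous_const
  have h5 := hahnIntegral_one_pos hq0 hq1 h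
  rw [integral_const, smul_eq_mul, mul_one] at h4
  have h6 : askeyWilsonMeasure a b c 0 q Set.univ ≠ 0 := by
    intro h0
    rw [Measure.real, h0] at h4
    simp at h4
    linarith
  refine ⟨h1.smul_measure (ENNReal.inv_ne_top.2 h6), ?_⟩
  rw [integral_smul_measure, h2, ENNReal.toReal_inv, smul_eq_mul, ← h4, Measure.real]
  ring

theorem addConst_pos (n j : ℕ) (τ σ : ℝ) : 0 < addConst n (n + j) τ σ q := by
  have h1 : ∀ r : ℝ, -(q ^ r) < 1 := fun r => by
    have := Real.rpow_pos_of_pos hq0 r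
    linarith
  have h2 : ∀ k : ℕ, q ^ (k + 1) < 1 := fun k => pow_lt_one₀ hq0.le hq1 (by omega)
  unfold addConst
  have p1 := qPoch_pos hq0 hq1 (h1 (2 * σ - ((n + j : ℕ) : ℝ))) (n + j - n)
  have p2 := qPoch_pos hq0 hq1 (h1 (2 * τ - ((n + j : ℕ) : ℝ))) (n + j - n)
  have p3 := qPoch_pos hq0 hq1 (h2 (n + j - n)) n
  have p4 := qPoch_self_pos hq0 hq1 n
  have p5 := qPoch_pos hq0 hq1 (h2 n) (n + j)
  have p6 := Real.rpow_pos_of_pos hq0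
    ((1 / 2 : ℝ) * (((n + j : ℕ) : ℝ) - n) * (((n + j : ℕ) : ℝ) - n - 2 * σ - 2 * τ))
  positivity

omit hq1 in
theorem laguerreNorm_eq (m p : ℕ) (τ σ : ℝ) :
    laguerreNorm q (-1 / (q ^ τ) ^ 2) (-1 / (q ^ σ) ^ 2) p m =
      qPoch q q m * qPoch (q ^ (1 + p)) q m * qPoch (-(q ^ (1 - 2 * τ))) q m *
        qPoch (-(q ^ (1 + (p : ℝ) - 2 * σ))) q m := by
  have e : ∀ r : ℝ, q ^ (2 * r) = (q ^ r) ^ 2 := fun r => by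
    rw [mul_comm 2 r, Real.rpow_mul hq0.le]
    norm_num
  have e1 : -(q ^ (1 - 2 * τ)) = q * (-1 / (q ^ τ) ^ 2) := by
    rw [Real.rpow_sub hq0, e, Real.rpow_one]
    ring
  have e2 : -(q ^ (1 + (p : ℝ) - 2 * σ)) = q ^ (1 + p) * (-1 / (q ^ σ) ^ 2) := by
    rw [Real.rpow_sub hq0, e, Real.rpow_add hq0, Real.rpow_one, Real.rpow_natCast]
    ring
  rw [e1, e2]
  rfl

theorem laguerreNorm_pos {Z Z' : ℝ} (hZ : Z < 0) (hZ' : Z' < 0) (p m : ℕ) :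
    0 < laguerreNorm q Z Z' p m := by
  have h1 : q * Z < 1 := by nlinarith
  have h2 : q ^ (1 + p) * Z' < 1 := by
    have : q ^ (1 + p) * Z' < 0 := mul_neg_of_pos_of_neg (by positivity) hZ'
    linarith
  have h3 : q ^ (1 + p) < 1 := pow_lt_one₀ hq0.le hq1 (by omega)
  exact mul_pos (mul_pos (mul_pos (qPoch_self_pos hq0 hq1 m) (qPoch_pos hq0 hq1 h3 m))
    (qPoch_pos hq0 hq1 h1 m)) (qPoch_pos hq0 hq1 h2 m)

/-- The pairwise products are q^{p+1}, -q^{p+1}/t² and -q/s², so every real σ and τ is admissible.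
-/
theorem hahnParams_qLaguerre {h s t : ℝ} (hh : h ^ 2 = q) (hs : 0 < s) (ht : 0 < t) (p : ℕ) :
    HahnParams (h * q ^ p * s / t) (h * t / s) (-h / (s * t)) := by
  have hs0 := hs.ne'
  have ht0 := ht.ne'
  refine ⟨?_, ?_, ?_⟩
  · have e : h * q ^ p * s / t * (h * t / s) = q ^ (p + 1) := by
      rw [pow_succ, ← hh]
      field_simp
    rw [e]
    exact pow_lt_one₀ hq0.le hq1 (by omega)
  · have e : h * q ^ p * s / t * (-h / (s * t)) = -(q ^ p * q / t ^ 2) := by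
      rw [← hh]
      field_simp
    have : 0 < q ^ p * q / t ^ 2 := by positivity
    linarith
  · have e : h * t / s * (-h / (s * t)) = -(q / s ^ 2) := by
      rw [← hh]
      field_simp
    have : 0 < q / s ^ 2 := by positivity
    linarith

end

end QSpecial

end


theorem corollary5p1 (q : ℝ) (hq0 : 0 < q) (hq1 : q < 1) (σ τ : ℝ) (l n m p : ℕ) (hn : n ≤ l) :
    MeasureTheory.Integrable
        (fun x : ℝ =>
          QSpecial.qJacobi l 0 0 x (q ^ τ) (q ^ σ) q *
            QSpecial.qLaguerre m p x (q ^ τ) (q ^ σ) q *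
            QSpecial.qLaguerre (m + n) p x (q ^ τ) (q ^ σ) q)
        (QSpecial.qLaguerreMeasure p (q ^ τ) (q ^ σ) q) ∧
      QSpecial.bigQJacobi (l - n) n n (-(q ^ m)) (q ^ (2 * τ)) 1 q *
          QSpecial.bigQJacobi (l - n) n n (-(q ^ (m + p))) (q ^ (2 * σ)) 1 q =
        1 / QSpecial.prodConst n l m p τ σ q *
          ∫ x : ℝ,
            QSpecial.qJacobi l 0 0 x (q ^ τ) (q ^ σ) q *
              QSpecial.qLaguerre m p x (q ^ τ) (q ^ σ) q *
              QSpecial.qLaguerre (m + n) p x (q ^ τ) (q ^ σ) q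
            ∂(QSpecial.qLaguerreMeasure p (q ^ τ) (q ^ σ) q) := by
  obtain ⟨j, rfl⟩ : ∃ j, l = n + j := ⟨l - n, by omega⟩
  have hs : 0 < q ^ τ := Real.rpow_pos_of_pos hq0 τ
  have ht : 0 < q ^ σ := Real.rpow_pos_of_pos hq0 σ
  have hh2 : (q ^ (1 / 2 : ℝ)) ^ 2 = q := by
    rw [← Real.rpow_natCast, ← Real.rpow_mul hq0.le]
    norm_num
  have ep : q ^ (1 / 2 + (p : ℝ)) = q ^ (1 / 2 : ℝ) * q ^ p := by
    rw [Real.rpow_add hq0, Real.rpow_natCast]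
  have e2 : ∀ r : ℝ, q ^ (2 * r) = (q ^ r) ^ 2 := fun r => by
    rw [mul_comm 2 r, Real.rpow_mul hq0.le]
    norm_num
  have hP := QSpecial.hahnParams_qLaguerre hq0 hq1 hh2 hs ht p
  have hlin := QSpecial.hahnIntegral_linearisation hq0 hq1 hh2 hs ht (n + j) m n p hP
  have hI := (QSpecial.hahnIntegral_one_pos hq0 hq1 hP).ne'
  have hD := (QSpecial.addConst_pos hq0 hq1 n j τ σ).ne'
  have hH := (QSpecial.laguerreNorm_pos hq0 hq1
    (div_neg_of_neg_of_pos (by norm_num : (-1 : ℝ) < 0) (pow_pos hs 2))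
    (div_neg_of_neg_of_pos (by norm_num : (-1 : ℝ) < 0) (pow_pos ht 2)) p (m + n)).ne'
  have hD2 := QSpecial.addConst_mul hq0 hq1 (rfl : q ^ (1 / 2 : ℝ) = _) n j τ σ
  unfold QSpecial.qJacobi QSpecial.qLaguerre QSpecial.qLaguerreMeasure QSpecial.prodConst
  simp only [add_zero, ep]
  obtain ⟨hint, heq⟩ := QSpecial.integral_smul_askeyWilsonMeasure hq0 hq1 hP
    (((QSpecial.continuous_askeyWilson (n + j) (q ^ (1 / 2 : ℝ) * q ^ τ / q ^ σ)
      (q ^ (1 / 2 : ℝ) * q ^ σ / q ^ τ) (-(q ^ (1 / 2 : ℝ)) / (q ^ τ * q ^ σ))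
      (-(q ^ τ * q ^ σ * q ^ (1 / 2 : ℝ))) q).mul
      (QSpecial.continuous_askeyWilson m _ _ _ 0 q)).mul
      (QSpecial.continuous_askeyWilson (m + n) _ _ _ 0 q))
  refine ⟨hint, ?_⟩
  refine Eq.trans ?_ (congrArg _ heq.symm)
  refine Eq.trans ?_ (congrArg _ (congrArg (· / _) hlin.symm))
  -- The constant C is D times the squared norm of l_{m+n}. Once both sides are written in big
  -- q-Jacobi sums, D, the norm and the total mass cancel.
  rw [← QSpecial.laguerreNorm_eq hq0, e2, e2, show n + j - n = j by omega,
    QSpecial.bigQJacobi_eq hq0 hq1 (pow_pos hs 2), QSpecial.bigQJacobi_eq hq0 hq1 (pow_pos ht 2),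
    show m + p + n + 1 = m + n + 1 + p by ring]
  unfold QSpecial.bigJacobiProd
  rw [← hD2]
  have hfin : ∀ X G X' G' D H I : ℝ, D ≠ 0 → H ≠ 0 → I ≠ 0 →
      X * G * (X' * G') = 1 / (D * H) * (H * (D * (X * X') * (G * G')) * I / I) := by
    intro X G X' G' D H I h1 h2 h3
    field_simp
  exact hfin _ _ _ _ _ _ _ hD hH hI
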